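/- Fix unit vectors $w_1,w_2,w_3\in\mathbb{R}^2$ with $w_1+w_2+w_3=0$. Let $\mathcal{M}$ be the convex cone of measures $\mu$ on $\mathbb{R}^2$ which are carried by finitely many lines parallel to the vectors $w_j$, which have a nonnegative step-function density with respect to length along these lines (that is, $\mu$ is a finite sum of nonnegative multiples of the length measures of segments, half-lines and lines parallel to some $w_j$), and which satisfy at every point $A\in\mathbb{R}^2$ the balance condition $$\delta_1^+(\mu,A)-\delta_1^-(\mu,A)=\delta_2^+(\mu,A)-\delta_2^-(\mu,A)=\delta_3^+(\mu,A)-\delta_3^-(\mu,A),$$ where $\delta_j^{\pm}(\mu,A)$ is the density of $\mu$ on $\{A\pm tw_j:0<t<\varepsilon\}$ for small $\varepsilon>0$. A point $A$ is a branch point of $\mu$ if at least three of the six numbers $\delta_j^\pm(\mu,A)$ are nonzero. For $r>0$ let $\triangle_r$ be the closed triangle with vertices $0$, $rw_1$, $r(w_1+w_2)$. Let $\mathcal{M}_r$ be the set of those $\mu\in\mathcal{M}$ whose branch points all lie in $\triangle_r$ and for which $\operatorname{supp}(\mu)\setminus\triangle_r$ is a finite union of half-lines $\{A+tw_j:t>0\}$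 with $A\in\partial\triangle_r$ and $j\in\{1,2,3\}$. An exit point of $\mu\in\mathcal{M}_r$ is a point $A\in\partial\triangle_r$ together with a direction $j$ such that $\{A+tw_j:t>0\}\subset\operatorname{supp}(\mu)\setminus\triangle_r$. (For $A$ not a corner of $\triangle_r$ the direction is determined by $A$; two half-lines can leave $\triangle_r$ at a corner, which then counts as two exit points.) For any $\nu\in\mathcal{M}$, the exit density of $\nu$ at $(A,j)$ is $\delta_j^+(\nu,A)$; it is $0$ if the half-line does not meet $\operatorname{supp}(\nu)$ near $A$. An exit point $(A,j)$ is an attachment point if $A$ is not a corner of $\triangle_r$, or if $A$ is a corner and the half-line $\{A+tw_j:t>0\}$ is parallel to the side of $\triangle_r$ opposite to $A$. A measure $\mu\in\mathcal{M}_r$ is rigid if no other $\nu\in\mathcal{M}_r$ has the same exit points and the same exit densities. A nonzero $\mu\in\mathcal{M}$ is extremal if every $\nu\in\mathcal{M}$ with $\nu\le\mu$ is of the form $c\mu$ for a constant $c\ge 0$. Two extremal measures are inequivalent if neither is a multiple of the other. **Proposition.** Let $\mu\in\mathcal{M}_r$ be a rigid measure. Then $\mu$ has finitely many attachment points; denote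 them by $A_1,\dots,A_q$ (pairwise distinct). Suppose that $\mu=\sum_{j=1}^k\mu_j$, where $\mu_1,\dots,\mu_k\in\mathcal{M}$ are mutually inequivalent extremal measures, and let $\alpha_i^{(j)}$ be the exit density of $\mu_j$ at $A_i$. Then the vectors $\alpha^{(j)}=(\alpha_i^{(j)})_{i=1}^q\in\mathbb{R}^q$, $j=1,\dots,k$, are linearly independent. -/

import Mathlib

open MeasureTheory Set Filter Topology
open scoped NNReal

noncomputable section

namespace HoneycombMeasure

/-- The Euclidean plane. -/
abbrev Plane : Type := EuclideanSpace ℝ (Fin 2)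

/-- `w 0, w 1, w 2` are three unit vectors in the plane with sum zero. -/
structure IsUnitTriple (w : Fin 3 → Plane) : Prop where
  norm_eq_one : ∀ j, ‖w j‖ = 1
  sum_eq_zero : w 0 + w 1 + w 2 = 0

/-- The half-line `{A + t v : t > 0}`. -/
def halfLine (A v : Plane) : Set Plane := {B | ∃ t : ℝ, 0 < t ∧ B = A + t • v}

/-- The open segment `{A + t v : 0 < t < ε}`. -/
def shortSegment (A v : Plane) (ε : ℝ) : Set Plane :=
  {B | ∃ t : ℝ, 0 < t ∧ t < ε ∧ B = A + t • v}

/-- For a unit vector `v` and an interval `I`, the length measure on `{A + t v : t ∈ I}`. -/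
def lengthMeasure (A v : Plane) (I : Set ℝ) : Measure Plane :=
  Measure.map (fun t : ℝ => A + t • v) (volume.restrict I)

/-- `μ` is carried by finitely many lines parallel to the vectors `w j`, and its density with
respect to length on these lines is a nonnegative step function: `μ` is a finite sum of
nonnegative multiples of the length measures of segments, half-lines and lines parallel to
some `w j`. -/
def HasStepDensity (w : Fin 3 → Plane) (μ : Measure Plane) : Prop :=
  ∃ (n : ℕ) (A : Fin n → Plane) (j : Fin n → Fin 3) (I : Fin n → Set ℝ) (c : Fin n → ℝ≥0),
    (∀ i, (I i).OrdConnected) ∧ μ = ∑ i, c i • lengthMeasure (A i) (w (j i)) (I i)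

/-- The density of `μ` on the segment `{A + t v : 0 < t < ε}` for small `ε > 0` (where `v` is a
unit vector). If `HasStepDensity w μ` and `v = w j` or `v = -w j`, then the quotient below is
constant for all small `ε > 0`, so that the limit exists. -/
def density (μ : Measure Plane) (A v : Plane) : ℝ :=
  limUnder (𝓝[>] (0 : ℝ)) (fun ε : ℝ => (μ (shortSegment A v ε)).toReal / ε)

/-- The density `δ_j⁺(μ, A)`. -/
def densityPos (w : Fin 3 → Plane) (μ : Measure Plane) (j : Fin 3) (A : Plane) : ℝ :=
  density μ A (w j)

/-- The density `δ_j⁻(μ, A)`. -/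
def densityNeg (w : Fin 3 → Plane) (μ : Measure Plane) (j : Fin 3) (A : Plane) : ℝ :=
  density μ A (-(w j))

/-- The cone `𝓜`: step densities along finitely many lines, balanced at every point. -/
def cone (w : Fin 3 → Plane) : Set (Measure Plane) :=
  {μ | HasStepDensity w μ ∧
    ∀ (A : Plane) (i j : Fin 3),
      densityPos w μ i A - densityNeg w μ i A = densityPos w μ j A - densityNeg w μ j A}

/-- `A` is a branch point of `μ`: at least three of the six densities `δ_j^±(μ, A)` are
different from zero. -/
def IsBranchPoint (w : Fin 3 → Plane) (μ : Measure Plane) (A : Plane) : Prop :=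
  3 ≤ {j : Fin 3 | densityPos w μ j A ≠ 0}.ncard + {j : Fin 3 | densityNeg w μ j A ≠ 0}.ncard

/-- The vertices `r w₁`, `r (w₁ + w₂)`, `0` of the triangle `△_r`. -/
def vertex (w : Fin 3 → Plane) (r : ℝ) : Fin 3 → Plane :=
  ![r • w 0, r • (w 0 + w 1), 0]

/-- The closed triangle `△_r`. -/
def triangle (w : Fin 3 → Plane) (r : ℝ) : Set Plane :=
  convexHull ℝ (range (vertex w r))

/-- The cone `𝓜_r`: the branch points lie in `△_r`, and the support outside `△_r` is a finite
union of half-lines `{A + t w_j : t > 0}` with `A ∈ ∂△_r`. -/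
def coneIn (w : Fin 3 → Plane) (r : ℝ) : Set (Measure Plane) :=
  {μ | μ ∈ cone w ∧
    (∀ A, IsBranchPoint w μ A → A ∈ triangle w r) ∧
    ∃ H : Set (Fin 3 × Plane), H.Finite ∧ (∀ p ∈ H, p.2 ∈ frontier (triangle w r)) ∧
      μ.support \ triangle w r = ⋃ p ∈ H, halfLine p.2 (w p.1)}

/-- The exit points of a measure in `𝓜_r`. An exit point is recorded together with the index of
the direction of its half-line, since at a corner of `△_r` two half-lines can leave the triangle;
such a corner counts as two exit points, each with its own density. -/
def exitPoints (w : Fin 3 → Plane) (r : ℝ) (μ : Measure Plane) : Set (Fin 3 × Plane) :=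
  {p | p.2 ∈ frontier (triangle w r) ∧ halfLine p.2 (w p.1) ⊆ μ.support \ triangle w r}

/-- The density of `μ` on the half-line of an exit point; it is zero when the half-line is
outside the support of `μ`. -/
def exitDensity (w : Fin 3 → Plane) (μ : Measure Plane) (p : Fin 3 × Plane) : ℝ :=
  densityPos w μ p.1 p.2

/-- The attachment points: the exit points that either are not at a corner of `△_r`, or are at a
corner and whose half-line is parallel to the opposite side of `△_r`. -/
def attachmentPoints (w : Fin 3 → Plane) (r : ℝ) (μ : Measure Plane) : Set (Fin 3 × Plane) :=
  {p | p ∈ exitPoints w r μ ∧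
    ((∀ i, p.2 ≠ vertex w r i) ∨
      ∃ i, p.2 = vertex w r i ∧ ∃ s : ℝ, vertex w r (i + 2) - vertex w r (i + 1) = s • w p.1)}

/-- `μ ∈ 𝓜_r` is rigid: no other measure in `𝓜_r` has the same exit points and the same exit
densities. -/
def IsRigid (w : Fin 3 → Plane) (r : ℝ) (μ : Measure Plane) : Prop :=
  μ ∈ coneIn w r ∧
    ∀ ν ∈ coneIn w r, exitPoints w r ν = exitPoints w r μ →
      (∀ p ∈ exitPoints w r μ, exitDensity w ν p = exitDensity w μ p) → ν = μ

/-- `μ` is an extremal measure of the cone `𝓜`. -/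
def IsExtremal (w : Fin 3 → Plane) (μ : Measure Plane) : Prop :=
  μ ∈ cone w ∧ μ ≠ 0 ∧ ∀ ν ∈ cone w, ν ≤ μ → ∃ c : ℝ≥0, ν = c • μ

/-- Neither of the two measures is a multiple of the other. -/
def Inequivalent (μ ν : Measure Plane) : Prop :=
  (∀ c : ℝ≥0, μ ≠ c • ν) ∧ ∀ c : ℝ≥0, ν ≠ c • μ

end HoneycombMeasure

end

/-!
A measure `μ` of the cone is encoded by its *germ density*, the function which assigns to a point
and one of the six directions `±w j` the density of `μ` on short segments there (`germ`). The
functions which arise in this way are the nonnegative step functions (`IsStep`, `isRep_germ`,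
`germ_lineSum`), and the balance condition says that the germs at each point, as vectors, add up
to zero. Let `D` be the germ density of the rigid measure `μ`. The proof has two parts: the germ
densities of the `μ_j` are linearly independent, and a combination of them which vanishes at the
attachment points is zero. Both use rigidity in its infinitesimal form (`IsRigid.eq_zero`): a
balanced step function which vanishes outside the triangle and is nonnegative off the support of
`D` is zero, because a small multiple of it could be added to `μ`. For compactly supported
functions it is not necessary to assume that they vanish outside the triangle
(`InTriangle.confine`).

*Independence.* If a balanced density `y` has its support in the support of `D`, its values are
constant along the edges of `D`, and at the branch points they satisfy linear equations. Since the
six germs at a point are not all in the support of `D` (otherwise they could be replaced by a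
small hexagon, `IsRigid.exists_germ_eq_zero`), there are two kinds of such equations: certain
*linked* germs have the same density, and the density at a *composite* germ is the sum of the
densities at two other germs. Edges and links divide the germs into classes. Each class contains at
most one composite germ (`Conn.composite_unique`). Indeed, along a path of edges and links from
one composite germ to another, two units of density can be replaced by one unit on each of two
parallel paths close by; since both ends of the path are composite, this *tube* can be closed, and
it is a balanced perturbation, which rigidity excludes. Thus the equations are a recursion, which
terminates because the density of `D` decreases from a composite germ to its parts. So `y` is
determined by arbitrary values on the *root* classes, those without a composite germ, and
`y ≥ 0` if and only if these values are nonnegative. The cone of all such `y` is therefore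
simplicial: an extremal measure lives on a single root class (`IsExtremal.exists_root`), and
inequivalent ones live on different root classes (`eq_zero_of_sum_germ`).

*Exits.* Let `E` be a combination of the germ densities of the `μ_j` which vanishes at the
attachment points, and let `c(A)` be the common value of the three differences of opposite
densities of `E` at `A`. Since the half-lines in the support all point in the directions `w j`,
summation of the jumps along the lines of direction `w j` shows that `∑ c(A)` is the total flux of
`E` through the exits of direction `j`, and that `∑ c(A) h_j(A)` is the sum of the fluxes, weighted
by the heights `h_j` of these lines. The only exits of direction `j` which are not attachment points
are at one height `b_j`, and `h_0 + h_1 + h_2 = 0` whereas `b_0 + b_1 + b_2 = -r`; so the total flux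
is zero, hence `E` vanishes at all exits and outside the triangle
(`InTriangle.eq_zero_outside`). By rigidity `E = 0`.
-/

noncomputable section

namespace HoneycombMeasure

section

/-! ### The six directions and the coordinates they define -/

/-- The six directions `w₀, -w₂, w₁, -w₀, w₂, -w₁`, in cyclic order, indexed by `ZMod 6` so that
`k + 3` is opposite to `k` and `dir w k + dir w (k + 2) = dir w (k + 1)`. The order is
counterclockwise or clockwise, according to the orientation of the triple. -/
def dir (w : Fin 3 → Plane) (k : ZMod 6) : Plane :=
  (![w 0, -w 2, w 1, -w 0, w 2, -w 1] : Fin 6 → Plane) k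

/-- The position of `w j` among the six directions; these positions are the even ones. -/
def ev (j : Fin 3) : ZMod 6 := (![0, 2, 4] : Fin 3 → ZMod 6) j

/-- The determinant of two vectors of the plane. -/
def det2 (u v : Plane) : ℝ := u 0 * v 1 - u 1 * v 0

/-- The height of a point over the line through the origin in direction `dir w k`, normalised
to be `1` at `dir w (k + 1)`. The denominator does not depend on `k`, because consecutive
directions have the same determinant. -/
def ht (w : Fin 3 → Plane) (k : ZMod 6) : Plane →ₗ[ℝ] ℝ where
  toFun p := det2 (dir w k) p / det2 (w 0) (w 1)
  map_add' p q := by simp [det2]; ring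
  map_smul' c p := by simp [det2]; ring

lemma six_cases (k : ZMod 6) : k = 0 ∨ k = 1 ∨ k = 2 ∨ k = 3 ∨ k = 4 ∨ k = 5 := by
  revert k; decide

lemma forall_dir_index {P : ZMod 6 → Prop} (i : ZMod 6) (h0 : P i) (h1 : P (i + 1))
    (h2 : P (i + 2)) (h3 : P (i + 3)) (h4 : P (i + 4)) (h5 : P (i + 5)) (k : ZMod 6) : P k := by
  have : ∀ k i : ZMod 6,
      k = i ∨ k = i + 1 ∨ k = i + 2 ∨ k = i + 3 ∨ k = i + 4 ∨ k = i + 5 := by decide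
  rcases this k i with h | h | h | h | h | h <;> rw [h] <;> assumption

lemma add_three_three (k : ZMod 6) : k + 3 + 3 = k := by revert k; decide

lemma ev_or (k : ZMod 6) : ∃ j, k = ev j ∨ k = ev j + 3 := by revert k; decide

lemma dir_ev (w : Fin 3 → Plane) (j : Fin 3) : dir w (ev j) = w j := by
  fin_cases j <;> rfl

variable {w : Fin 3 → Plane}

lemma dir_add_three (w : Fin 3 → Plane) (k : ZMod 6) : dir w (k + 3) = -dir w k := by
  rcases six_cases k with rfl | rfl | rfl | rfl | rfl | rfl
  · change -w 0 = -w 0; rfl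
  · change w 2 = - -w 2; simp
  · change -w 1 = -w 1; rfl
  · change w 0 = - -w 0; simp
  · change -w 2 = -w 2; rfl
  · change w 1 = - -w 1; simp

lemma dir_ev_add_three (w : Fin 3 → Plane) (j : Fin 3) : dir w (ev j + 3) = -w j := by
  rw [dir_add_three, dir_ev]

lemma IsUnitTriple.two_eq (hw : IsUnitTriple w) : w 2 = -w 0 - w 1 := by
  have := hw.sum_eq_zero
  rw [← sub_eq_zero]; rw [← this]; abel

lemma dir_add_two (hw : IsUnitTriple w) (k : ZMod 6) :
    dir w (k + 2) = dir w (k + 1) - dir w k := by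
  have h2 := hw.two_eq
  rcases six_cases k with rfl | rfl | rfl | rfl | rfl | rfl
  · change w 1 = -w 2 - w 0; rw [h2]; abel
  · change -w 0 = w 1 - -w 2; rw [h2]; abel
  · change w 2 = -w 0 - w 1; rw [h2]
  · change -w 1 = w 2 - -w 0; rw [h2]; abel
  · change w 0 = -w 1 - w 2; rw [h2]; abel
  · change -w 2 = w 0 - -w 1; rw [h2]; abel

lemma dir_add_four (w : Fin 3 → Plane) (k : ZMod 6) : dir w (k + 4) = -dir w (k + 1) := by
  rw [← dir_add_three]; congr 1; ring

lemma dir_add_five (hw : IsUnitTriple w) (k : ZMod 6) :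
    dir w (k + 5) = dir w k - dir w (k + 1) := by
  rw [show k + 5 = k + 2 + 3 by ring, dir_add_three, dir_add_two hw]; abel

lemma norm_dir (hw : IsUnitTriple w) (k : ZMod 6) : ‖dir w k‖ = 1 := by
  obtain ⟨j, rfl | rfl⟩ := ev_or k
  · rw [dir_ev]; exact hw.norm_eq_one j
  · rw [dir_ev_add_three, norm_neg]; exact hw.norm_eq_one j

lemma dir_ne_zero (hw : IsUnitTriple w) (k : ZMod 6) : dir w k ≠ 0 := by
  intro h; have := norm_dir hw k; rw [h, norm_zero] at this; exact zero_ne_one this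

lemma IsUnitTriple.det2_ne_zero (hw : IsUnitTriple w) : det2 (w 0) (w 1) ≠ 0 := by
  intro h
  have sq : ∀ v : Plane, ‖v‖ = 1 → v 0 ^ 2 + v 1 ^ 2 = 1 := by
    intro v hv
    have := EuclideanSpace.norm_sq_eq v
    rw [hv, Fin.sum_univ_two] at this
    simp only [Real.norm_eq_abs, sq_abs] at this
    linarith
  have h0 := sq _ (hw.norm_eq_one 0)
  have h1 := sq _ (hw.norm_eq_one 1)
  have h2 := sq _ (hw.norm_eq_one 2)
  rw [hw.two_eq] at h2
  simp only [PiLp.sub_apply, PiLp.neg_apply] at h2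
  have hin : w 0 0 * w 1 0 + w 0 1 * w 1 1 = -1 / 2 := by nlinarith
  unfold det2 at h
  have : (w 0 0 * w 1 0 + w 0 1 * w 1 1) ^ 2 + (w 0 0 * w 1 1 - w 0 1 * w 1 0) ^ 2
      = (w 0 0 ^ 2 + w 0 1 ^ 2) * (w 1 0 ^ 2 + w 1 1 ^ 2) := by ring
  rw [hin, h, h0, h1] at this
  norm_num at this

lemma det2_sub (u v p : Plane) : det2 (u - v) p = det2 u p - det2 v p := by
  simp [det2]; ring

lemma det2_neg (u p : Plane) : det2 (-u) p = -det2 u p := by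
  simp [det2]; ring

lemma det2_dir (hw : IsUnitTriple w) (k : ZMod 6) :
    det2 (dir w k) (dir w (k + 1)) = det2 (w 0) (w 1) := by
  have h2 := hw.two_eq
  rcases six_cases k with rfl | rfl | rfl | rfl | rfl | rfl
  · change det2 (w 0) (-w 2) = _; rw [h2]; simp [det2]; ring
  · change det2 (-w 2) (w 1) = _; rw [h2]; simp [det2]; ring
  · change det2 (w 1) (-w 0) = _; simp [det2]; ring
  · change det2 (-w 0) (w 2) = _; rw [h2]; simp [det2]; ring
  · change det2 (w 2) (-w 1) = _; rw [h2]; simp [det2]; ring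
  · change det2 (-w 1) (w 0) = _; simp [det2]; ring

lemma ht_dir (w : Fin 3 → Plane) (k : ZMod 6) : ht w k (dir w k) = 0 := by
  simp [ht, det2]; left; ring

lemma ht_dir_one (hw : IsUnitTriple w) (k : ZMod 6) : ht w k (dir w (k + 1)) = 1 := by
  change det2 _ _ / _ = _
  rw [det2_dir hw, div_self hw.det2_ne_zero]

lemma ht_dir_two (hw : IsUnitTriple w) (k : ZMod 6) : ht w k (dir w (k + 2)) = 1 := by
  rw [dir_add_two hw, map_sub, ht_dir, ht_dir_one hw]; ring

lemma ht_dir_three (w : Fin 3 → Plane) (k : ZMod 6) : ht w k (dir w (k + 3)) = 0 := by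
  rw [dir_add_three, map_neg, ht_dir, neg_zero]

lemma ht_dir_four (hw : IsUnitTriple w) (k : ZMod 6) : ht w k (dir w (k + 4)) = -1 := by
  rw [dir_add_four, map_neg, ht_dir_one hw]

lemma ht_dir_five (hw : IsUnitTriple w) (k : ZMod 6) : ht w k (dir w (k + 5)) = -1 := by
  rw [dir_add_five hw, map_sub, ht_dir_one hw, ht_dir]; ring

lemma ht_add_three (w : Fin 3 → Plane) (k : ZMod 6) (p : Plane) :
    ht w (k + 3) p = -ht w k p := by
  change det2 _ _ / _ = -(det2 _ _ / _)
  rw [dir_add_three, det2_neg, neg_div]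

lemma ht_add_two (hw : IsUnitTriple w) (k : ZMod 6) (p : Plane) :
    ht w (k + 2) p = ht w (k + 1) p - ht w k p := by
  change det2 _ _ / _ = det2 _ _ / _ - det2 _ _ / _
  rw [dir_add_two hw, det2_sub, sub_div]

lemma ht_add_four (w : Fin 3 → Plane) (k : ZMod 6) (p : Plane) :
    ht w (k + 4) p = -ht w (k + 1) p := by
  rw [← ht_add_three]; congr 2; ring

/-- The coordinates of a point in the basis `dir w k, dir w (k + 1)`. -/
lemma decomp (hw : IsUnitTriple w) (k : ZMod 6) (p : Plane) :
    p = (-ht w (k + 1) p) • dir w k + ht w k p • dir w (k + 1) := by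
  have hd := det2_dir hw k
  have h0 : det2 (dir w k) (dir w (k + 1)) ≠ 0 := by rw [hd]; exact hw.det2_ne_zero
  change p = (-(det2 _ _ / _)) • _ + (det2 _ _ / _) • _
  rw [← hd]
  ext i
  fin_cases i
  · simp only [PiLp.add_apply, PiLp.smul_apply, smul_eq_mul, Fin.zero_eta]
    field_simp
    simp only [det2]; ring
  · simp only [PiLp.add_apply, PiLp.smul_apply, smul_eq_mul, Fin.mk_one]
    field_simp
    simp only [det2]; ring

lemma ht_continuous (w : Fin 3 → Plane) (k : ZMod 6) : Continuous (ht w k) :=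
  LinearMap.continuous_of_finiteDimensional _

lemma ht_smul_add (w : Fin 3 → Plane) (k i : ZMod 6) (p : Plane) (s : ℝ) :
    ht w k (p + s • dir w i) = ht w k p + s * ht w k (dir w i) := by
  rw [map_add, map_smul, smul_eq_mul]

lemma ht_along (w : Fin 3 → Plane) (k : ZMod 6) (p : Plane) (s : ℝ) :
    ht w k (p + s • dir w k) = ht w k p := by
  rw [ht_smul_add, ht_dir]; ring

/-- Two points at the same height over a line differ by a multiple of its direction. -/
lemma exists_along (hw : IsUnitTriple w) {k : ZMod 6} {p q : Plane}
    (h : ht w k p = ht w k q) : ∃ s : ℝ, p = q + s • dir w k := by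
  refine ⟨-ht w (k + 1) (p - q), ?_⟩
  have := decomp hw k (p - q)
  rw [map_sub (ht w k), h, sub_self, zero_smul, add_zero] at this
  rw [← this]; abel

lemma ht_dir_ne_zero (hw : IsUnitTriple w) {k i : ZMod 6} (h : i ≠ k) (h' : i ≠ k + 3) :
    ht w k (dir w i) ≠ 0 := by
  revert h h'
  refine forall_dir_index (P := fun i => i ≠ k → i ≠ k + 3 → ht w k (dir w i) ≠ 0) k
    ?_ ?_ ?_ ?_ ?_ ?_ i <;> intro h h'
  · exact absurd rfl h
  · rw [ht_dir_one hw]; norm_num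
  · rw [ht_dir_two hw]; norm_num
  · exact absurd rfl h'
  · rw [ht_dir_four hw]; norm_num
  · rw [ht_dir_five hw]; norm_num

lemma eq_of_ht_eq (hw : IsUnitTriple w) {k i : ZMod 6} (h : i ≠ k) (h' : i ≠ k + 3)
    {p q : Plane} (hk : ht w k p = ht w k q) (hi : ht w i p = ht w i q) : p = q := by
  obtain ⟨s, rfl⟩ := exists_along hw hk
  rw [ht_smul_add] at hi
  have hne : ht w i (dir w k) ≠ 0 :=
    ht_dir_ne_zero hw (Ne.symm h) (fun e => h' (by rw [e, add_three_three]))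
  have : s = 0 := by
    have : s * ht w i (dir w k) = 0 := by linarith
    exact (mul_eq_zero.1 this).resolve_right hne
  rw [this]; simp

lemma smul_dir_inj (hw : IsUnitTriple w) {A : Plane} {k : ZMod 6} {s t : ℝ}
    (h : A + s • dir w k = A + t • dir w k) : s = t :=
  smul_left_injective ℝ (dir_ne_zero hw k) (add_left_cancel h)

lemma add_smul_dir_ne (hw : IsUnitTriple w) (A : Plane) (k : ZMod 6) {s : ℝ} (hs : s ≠ 0) :
    A + s • dir w k ≠ A := by
  intro h; apply hs
  exact smul_dir_inj hw (A := A) (k := k) (t := 0) (by simpa using h)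

lemma ray_ray (A : Plane) (k : ZMod 6) (s t : ℝ) :
    A + s • dir w k + t • dir w k = A + (s + t) • dir w k := by module

lemma ray_back (A : Plane) (k : ZMod 6) (s t : ℝ) :
    A + s • dir w k + t • dir w (k + 3) = A + (s - t) • dir w k := by
  rw [dir_add_three]; module

/-! ### The triangle -/

lemma mem_triangle_iff (hw : IsUnitTriple w) {r : ℝ} (hr : 0 < r) (p : Plane) :
    p ∈ triangle w r ↔ 0 ≤ ht w 0 p ∧ -r ≤ ht w 2 p ∧ 0 ≤ ht w 4 p := by
  have h2 := ht_add_two hw 0 p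
  have h4 := ht_add_four w 0 p
  rw [zero_add] at h2 h4
  have hp := decomp hw 0 p
  have hd1 : dir w (0 + 1) = w 0 + w 1 := by
    change -w 2 = _; rw [hw.two_eq]; abel
  have hd0 : dir w 0 = w 0 := rfl
  rw [hd1, hd0] at hp
  have hrange : range (vertex w r) = {r • w 0, r • (w 0 + w 1), 0} := by
    ext q
    simp only [vertex, mem_range, Fin.exists_fin_succ, mem_insert_iff, mem_singleton_iff]
    simp [eq_comm]
  rw [triangle, hrange, convexHull_insert (by simp), convexHull_pair, mem_convexJoin]
  constructor
  · rintro ⟨a, ha, b, hb, hab⟩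
    rw [mem_singleton_iff] at ha
    subst ha
    rw [segment_eq_image] at hb hab
    obtain ⟨θ, ⟨h1, h1'⟩, rfl⟩ := hb
    obtain ⟨τ, ⟨h3, h3'⟩, rfl⟩ := hab
    have e0 : ∀ k, ht w k (w 0) = ht w k (dir w 0) := fun k => rfl
    have e1 : ∀ k, ht w k (w 1) = ht w k (dir w 2) := fun k => rfl
    simp only [map_add, map_smul, smul_eq_mul, map_zero, e0, e1]
    have a0 : ht w 0 (dir w 0) = 0 := ht_dir w 0
    have a1 : ht w 0 (dir w 2) = 1 := by simpa using ht_dir_two hw 0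
    have a2 : ht w 2 (dir w 0) = -1 := ht_dir_four hw 2
    have a3 : ht w 2 (dir w 2) = 0 := ht_dir w 2
    have a4 : ht w 4 (dir w 0) = 1 := ht_dir_two hw 4
    have a5 : ht w 4 (dir w 2) = -1 := ht_dir_four hw 4
    rw [a0, a1, a2, a3, a4, a5]
    have k1 : 0 ≤ τ * (1 - θ) := mul_nonneg h3 (by linarith)
    have k2 : 0 ≤ τ * θ := mul_nonneg h3 h1
    refine ⟨?_, ?_, ?_⟩
    · nlinarith [mul_nonneg k1 hr.le]
    · nlinarith [mul_nonneg k2 hr.le]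
    · nlinarith [mul_nonneg (sub_nonneg.2 h3') hr.le]
  · rintro ⟨c0, c2, c4⟩
    set x := -ht w (0 + 1) p with hx
    set y := ht w 0 p with hy
    -- the barycentric coordinates of `p` with respect to `r w₀` and `r (w₀ + w₁)`
    -- are `x / r` and `y / r`
    have hx0 : 0 ≤ x := by rw [h4] at c4; exact c4
    have hxy : x + y ≤ r := by rw [h2] at c2; linarith
    rw [hp]
    by_cases hxr : x = r
    · have hy0 : y = 0 := by linarith
      refine ⟨r • w 0, rfl, 0, right_mem_segment _ _ _, ?_⟩
      rw [hxr, hy0]; simp only [zero_smul, add_zero]; exact left_mem_segment _ _ _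
    · have hlt : 0 < r - x := by
        rcases lt_or_eq_of_le (show x ≤ r by linarith) with h | h
        · linarith
        · exact absurd h hxr
      refine ⟨r • w 0, rfl, (y / (r - x)) • (r • (w 0 + w 1)), ?_, ?_⟩
      · refine ⟨y / (r - x), 1 - y / (r - x), div_nonneg c0 hlt.le, ?_, by ring, by simp⟩
        rw [sub_nonneg, div_le_one hlt]; linarith
      · refine ⟨x / r, 1 - x / r, div_nonneg hx0 hr.le, ?_, by ring, ?_⟩
        · rw [sub_nonneg, div_le_one hr]; linarith
        · rw [smul_smul, smul_smul, smul_smul]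
          congr 2
          · field_simp
          · field_simp

lemma isClosed_triangle (hw : IsUnitTriple w) {r : ℝ} (hr : 0 < r) :
    IsClosed (triangle w r) := by
  have : triangle w r = {p | 0 ≤ ht w 0 p} ∩ ({p | -r ≤ ht w 2 p} ∩ {p | 0 ≤ ht w 4 p}) := by
    ext p; exact mem_triangle_iff hw hr p
  rw [this]
  exact (isClosed_le continuous_const (ht_continuous w 0)).inter
    ((isClosed_le continuous_const (ht_continuous w 2)).inter
      (isClosed_le continuous_const (ht_continuous w 4)))

lemma tendsto_ray (w : Fin 3 → Plane) (A : Plane) (k : ZMod 6) :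
    Tendsto (fun s : ℝ => A + s • dir w k) (𝓝[>] 0) (𝓝 A) := by
  have : Continuous (fun s : ℝ => A + s • dir w k) := by fun_prop
  have h := this.tendsto 0
  simp only [zero_smul, add_zero] at h
  exact h.mono_left nhdsWithin_le_nhds

/-- The lower bounds of the heights `ht w e`, `e = 0, 2, 4`, which define the triangle. At odd `e`
the value has no meaning. -/
def bnd (r : ℝ) (e : ZMod 6) : ℝ := if e = 2 then -r else 0

lemma mem_triangle_iff' (hw : IsUnitTriple w) {r : ℝ} (hr : 0 < r) (p : Plane) :
    p ∈ triangle w r ↔ ∀ j : Fin 3, bnd r (ev j) ≤ ht w (ev j) p := by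
  rw [mem_triangle_iff hw hr, Fin.forall_fin_succ, Fin.forall_fin_succ, Fin.forall_fin_succ]
  simp only [IsEmpty.forall_iff, and_true]
  have a : bnd r (ev 0) = 0 := by
    rw [bnd, if_neg (by decide)]
  have b : bnd r (ev 1) = -r := by
    rw [bnd, if_pos (by decide)]
  have c : bnd r (ev 2) = 0 := by
    rw [bnd, if_neg (by decide)]
  change _ ↔ bnd r (ev 0) ≤ ht w (ev 0) p ∧ bnd r (ev 1) ≤ ht w (ev 1) p ∧
    bnd r (ev 2) ≤ ht w (ev 2) p
  rw [a, b, c]; rfl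

/-- A half-line in direction `w j` can only leave the triangle through the side whose inner
normal decreases along `w j`. -/
lemma ht_eq_of_leaves (hw : IsUnitTriple w) {r : ℝ} (hr : 0 < r) {A : Plane} {j : Fin 3}
    (hA : A ∈ triangle w r) (hout : ∀ s : ℝ, 0 < s → A + s • w j ∉ triangle w r) :
    ht w (ev j + 2) A = bnd r (ev j + 2) := by
  rw [mem_triangle_iff' hw hr] at hA
  have key : ∀ j, ∃ i, ev i = ev j + 2 := by decide
  obtain ⟨i, hi⟩ := key j
  rw [← hi]
  by_contra hne
  have hlt : bnd r (ev i) < ht w (ev i) A := lt_of_le_of_ne (hA i) (Ne.symm hne)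
  have hs : 0 < ht w (ev i) A - bnd r (ev i) := by linarith
  refine hout _ hs ((mem_triangle_iff' hw hr _).2 fun l => ?_)
  rw [← dir_ev w j, ht_smul_add]
  have hl : ∀ l j, ev l = ev j ∨ ev l = ev j + 2 ∨ ev l = ev j + 4 := by decide
  rcases hl l j with h | h | h
  · have : ht w (ev l) (dir w (ev j)) = 0 := by rw [h]; exact ht_dir w _
    rw [this]; linarith [hA l]
  · have e : ev j = ev l + 4 := by rw [h, add_assoc]; exact (add_zero _).symm
    have : ht w (ev l) (dir w (ev j)) = -1 := by rw [e]; exact ht_dir_four hw _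
    have h' : ev l = ev i := h.trans hi.symm
    rw [this, h']; linarith
  · have e : ev j = ev l + 2 := by rw [h, add_assoc]; exact (add_zero _).symm
    have : ht w (ev l) (dir w (ev j)) = 1 := by rw [e]; exact ht_dir_two hw _
    rw [this]; linarith [hA l]

lemma mem_frontier_of_leaves {r : ℝ} {A : Plane} {j : Fin 3}
    (hA : A ∈ triangle w r) (hout : ∀ s : ℝ, 0 < s → A + s • w j ∉ triangle w r) :
    A ∈ frontier (triangle w r) := by
  refine ⟨subset_closure hA, fun hi => ?_⟩
  have h : ∀ᶠ s in 𝓝[>] (0 : ℝ), A + s • dir w (ev j) ∈ triangle w r :=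
    tendsto_ray w A (ev j) (mem_interior_iff_mem_nhds.1 hi)
  obtain ⟨s, hs, hs0⟩ := (h.and self_mem_nhdsWithin).exists
  rw [dir_ev] at hs
  exact hout s hs0 hs

lemma frontier_subset_triangle (hw : IsUnitTriple w) {r : ℝ} (hr : 0 < r) :
    frontier (triangle w r) ⊆ triangle w r :=
  (isClosed_triangle hw hr).frontier_subset

end

section

variable {w : Fin 3 → Plane}

/-! ### Germ densities -/

/-- A germ is a point together with one of the six directions. A function on germs is *step* if
it is constant along short segments, where the two opposite germs have to agree, if it is carried
by finitely many lines, and if it jumps at finitely many points only. Such a function records the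
six densities `δ_j^±` of a (signed) measure with step density at every point. -/
structure IsStep (w : Fin 3 → Plane) (D : Plane → ZMod 6 → ℝ) : Prop where
  loc : ∀ A k, ∀ᶠ s in 𝓝[>] (0 : ℝ),
    D (A + s • dir w k) k = D A k ∧ D (A + s • dir w k) (k + 3) = D A k
  lines : ∀ k, {b | ∃ A, D A k ≠ 0 ∧ ht w k A = b}.Finite
  jumps : {A | ∃ k, D A k ≠ D A (k + 3)}.Finite

/-- The balance condition for a function on germs. Since `k` ranges over all six directions, this
says that `D A k - D A (k + 3)` is the same for `k = 0, 2, 4`. -/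
def IsBalanced (D : Plane → ZMod 6 → ℝ) : Prop :=
  ∀ A k, D A k - D A (k + 3) = D A (k + 2) - D A (k + 5)

lemma IsStep.zero : IsStep w (fun _ _ => 0) :=
  ⟨fun A k => by simp, fun k => by simp, by simp⟩

lemma IsStep.add {D E : Plane → ZMod 6 → ℝ} (hD : IsStep w D) (hE : IsStep w E) :
    IsStep w (fun A k => D A k + E A k) := by
  refine ⟨fun A k => ?_, fun k => ?_, ?_⟩
  · filter_upwards [hD.loc A k, hE.loc A k] with s h1 h2
    rw [h1.1, h1.2, h2.1, h2.2]; simp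
  · refine ((hD.lines k).union (hE.lines k)).subset ?_
    rintro b ⟨A, hA, rfl⟩
    by_cases h : D A k = 0
    · right; refine ⟨A, fun h' => hA ?_, rfl⟩; rw [h, h', add_zero]
    · left; exact ⟨A, h, rfl⟩
  · refine (hD.jumps.union hE.jumps).subset ?_
    rintro A ⟨k, hk⟩
    by_cases h : D A k = D A (k + 3)
    · right; refine ⟨k, fun h' => hk ?_⟩; rw [h, h']
    · left; exact ⟨k, h⟩

lemma IsStep.smul {D : Plane → ZMod 6 → ℝ} (hD : IsStep w D) (c : ℝ) :
    IsStep w (fun A k => c * D A k) := by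
  refine ⟨fun A k => ?_, fun k => ?_, ?_⟩
  · filter_upwards [hD.loc A k] with s h1
    rw [h1.1, h1.2]; simp
  · refine (hD.lines k).subset ?_
    rintro b ⟨A, hA, rfl⟩
    exact ⟨A, fun h => hA (by rw [h, mul_zero]), rfl⟩
  · refine hD.jumps.subset ?_
    rintro A ⟨k, hk⟩
    exact ⟨k, fun h => hk (by rw [h])⟩

lemma IsStep.sum {ι : Type*} (s : Finset ι) {D : ι → Plane → ZMod 6 → ℝ}
    (hD : ∀ i ∈ s, IsStep w (D i)) : IsStep w (fun A k => ∑ i ∈ s, D i A k) := by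
  classical
  induction s using Finset.induction_on with
  | empty => simpa using IsStep.zero
  | insert a s ha ih =>
    simp only [Finset.sum_insert ha]
    exact (hD a (Finset.mem_insert_self _ _)).add
      (ih fun i hi => hD i (Finset.mem_insert_of_mem hi))

lemma IsBalanced.add {D E : Plane → ZMod 6 → ℝ} (hD : IsBalanced D) (hE : IsBalanced E) :
    IsBalanced (fun A k => D A k + E A k) := fun A k => by
  have h1 := hD A k; have h2 := hE A k; linarith

lemma IsBalanced.smul {D : Plane → ZMod 6 → ℝ} (hD : IsBalanced D) (c : ℝ) :
    IsBalanced (fun A k => c * D A k) := fun A k => by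
  have h1 := hD A k
  change c * _ - c * _ = c * _ - c * _
  rw [← mul_sub, h1, mul_sub]

lemma IsBalanced.sum {ι : Type*} (s : Finset ι) {D : ι → Plane → ZMod 6 → ℝ}
    (hD : ∀ i ∈ s, IsBalanced (D i)) : IsBalanced (fun A k => ∑ i ∈ s, D i A k) := fun A k => by
  rw [← Finset.sum_sub_distrib, ← Finset.sum_sub_distrib]
  exact Finset.sum_congr rfl fun i hi => hD i hi A k

lemma IsBalanced.four {D : Plane → ZMod 6 → ℝ} (hD : IsBalanced D) (A : Plane) (k : ZMod 6) :
    D A k - D A (k + 3) = D A (k + 4) - D A (k + 1) := by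
  have h1 := hD A k
  have h2 := hD A (k + 2)
  have e1 : k + 2 + 3 = k + 5 := by ring
  have e2 : k + 2 + 2 = k + 4 := by ring
  have e3 : ∀ k : ZMod 6, k + 2 + 5 = k + 1 := by decide
  rw [e1, e2, e3] at h2
  linarith

lemma eventually_notMem_of_finite {F : Set ℝ} (hF : F.Finite) :
    ∀ᶠ s in 𝓝[>] (0 : ℝ), s ∉ F := by
  have h1 : ((F \ {0})ᶜ : Set ℝ) ∈ 𝓝 (0 : ℝ) :=
    (hF.subset sdiff_subset).isClosed.isOpen_compl.mem_nhds (by simp)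
  filter_upwards [nhdsWithin_le_nhds h1, self_mem_nhdsWithin] with s hs h0 hF
  exact hs ⟨hF, ne_of_gt h0⟩

/-- Close to a point, a ray meets no other carrying line. -/
lemma IsStep.eventually_only (hw : IsUnitTriple w) {D : Plane → ZMod 6 → ℝ} (hD : IsStep w D)
    (A : Plane) (k : ZMod 6) :
    ∀ᶠ s in 𝓝[>] (0 : ℝ), ∀ i, i ≠ k → i ≠ k + 3 → D (A + s • dir w k) i = 0 := by
  rw [Filter.eventually_all]
  intro i
  by_cases hi : i ≠ k ∧ i ≠ k + 3
  · have hne : ht w i (dir w k) ≠ 0 :=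
      ht_dir_ne_zero hw (Ne.symm hi.1) (fun e => hi.2 (by rw [e, add_three_three]))
    have hfin : {s : ℝ | ht w i A + s * ht w i (dir w k) ∈
        {b | ∃ A, D A i ≠ 0 ∧ ht w i A = b}}.Finite := by
      refine Set.Finite.preimage (fun s _ t _ h => ?_) (hD.lines i)
      have : s * ht w i (dir w k) = t * ht w i (dir w k) := by
        simpa using h
      exact mul_right_cancel₀ hne this
    filter_upwards [eventually_notMem_of_finite hfin] with s hs _ _
    by_contra h
    exact hs ⟨_, h, ht_smul_add w i k A s⟩
  · refine Eventually.of_forall fun s h1 h2 => absurd ⟨h1, h2⟩ hi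

/-- A step function is constant along a segment without jumps in its interior. -/
lemma IsStep.const {D : Plane → ZMod 6 → ℝ} (hD : IsStep w D) {A : Plane} {k : ZMod 6} {t : ℝ}
    (ht : 0 < t)
    (hj : ∀ s, 0 < s → s < t → D (A + s • dir w k) k = D (A + s • dir w k) (k + 3)) :
    (∀ s, 0 < s → s < t → D (A + s • dir w k) k = D A k) ∧
      D (A + t • dir w k) (k + 3) = D A k := by
  have hder : ∀ s ∈ Ioo 0 t, HasDerivAt (fun s : ℝ => D (A + s • dir w k) k) 0 s := by
    intro s hs
    have h1 := hD.loc (A + s • dir w k) k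
    have h2 := hD.loc (A + s • dir w k) (k + 3)
    rw [add_three_three] at h2
    have hev : ∀ᶠ x in 𝓝 s, D (A + x • dir w k) k = D (A + s • dir w k) k := by
      rw [eventually_nhdsWithin_iff, Metric.eventually_nhds_iff] at h1 h2
      obtain ⟨ε₁, hε₁, h1⟩ := h1
      obtain ⟨ε₂, hε₂, h2⟩ := h2
      rw [Metric.eventually_nhds_iff]
      refine ⟨min ε₁ ε₂, lt_min hε₁ hε₂, fun x hx => ?_⟩
      rw [Real.dist_eq, lt_min_iff] at hx
      rcases lt_trichotomy x s with h | h | h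
      · have := (h2 (y := s - x) (by
          rw [Real.dist_eq, sub_zero, abs_sub_comm]; exact hx.2) (by simpa using h)).2
        rw [ray_back, show s - (s - x) = x by ring] at this
        rw [this, ← hj s hs.1 hs.2]
      · rw [h]
      · have := (h1 (y := x - s) (by
          rw [Real.dist_eq, sub_zero]; exact hx.1) (by simpa using h)).1
        rw [ray_ray, show s + (x - s) = x by ring] at this
        rw [this]
    exact (hasDerivAt_const s (D (A + s • dir w k) k)).congr_of_eventuallyEq hev
  have hconst : ∀ s ∈ Ioo 0 t, ∀ u ∈ Ioo 0 t,
      D (A + s • dir w k) k = D (A + u • dir w k) k := by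
    intro s hs u hu
    exact isOpen_Ioo.is_const_of_deriv_eq_zero isPreconnected_Ioo
      (fun x hx => (hder x hx).differentiableAt.differentiableWithinAt)
      (fun x hx => (hder x hx).deriv) hs hu
  have hsmall : ∀ᶠ u in 𝓝[>] (0 : ℝ), u ∈ Ioo 0 t := Ioo_mem_nhdsGT ht
  have hA : ∀ s, 0 < s → s < t → D (A + s • dir w k) k = D A k := by
    intro s h0 h1
    obtain ⟨u, hu, hl⟩ := (hsmall.and (hD.loc A k)).exists
    rw [hconst s ⟨h0, h1⟩ u hu, hl.1]
  refine ⟨hA, ?_⟩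
  have hl := hD.loc (A + t • dir w k) (k + 3)
  rw [add_three_three] at hl
  obtain ⟨u, hu, hl⟩ := (hsmall.and hl).exists
  rw [ray_back] at hl
  rw [← hl.2]
  exact hA _ (by linarith [hu.2]) (by linarith [hu.1])

/-- A step function of bounded support vanishes along a ray without jumps. -/
lemma IsStep.eq_zero_of_ray (hw : IsUnitTriple w) {D : Plane → ZMod 6 → ℝ} (hD : IsStep w D)
    {R : ℝ} (hR : ∀ A k, D A k ≠ 0 → ‖A‖ ≤ R) {A : Plane} {k : ZMod 6}
    (hj : ∀ s : ℝ, 0 < s → D (A + s • dir w k) k = D (A + s • dir w k) (k + 3)) : D A k = 0 := by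
  set t := |R| + ‖A‖ + 1 with ht
  have ht0 : 0 < t := by positivity
  rw [← (hD.const ht0 fun s h0 _ => hj s h0).2]
  by_contra h
  have h1 := hR _ _ h
  have h2 : ‖t • dir w k‖ ≤ ‖A + t • dir w k‖ + ‖A‖ := by
    have := norm_sub_le (A + t • dir w k) A
    rwa [add_sub_cancel_left] at this
  rw [norm_smul, norm_dir hw, Real.norm_eq_abs, abs_of_pos ht0, mul_one] at h2
  linarith [le_abs_self R]

/-- The points at which the germs of at least two nonparallel directions are nonzero. -/
lemma IsStep.finite_crossings (hw : IsUnitTriple w) {D : Plane → ZMod 6 → ℝ} (hD : IsStep w D) :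
    {A | ∃ i k, i ≠ k ∧ i ≠ k + 3 ∧ D A i ≠ 0 ∧ D A k ≠ 0}.Finite := by
  have : {A | ∃ i k, i ≠ k ∧ i ≠ k + 3 ∧ D A i ≠ 0 ∧ D A k ≠ 0} ⊆
      ⋃ i, ⋃ k, {A | i ≠ k ∧ i ≠ k + 3 ∧ D A i ≠ 0 ∧ D A k ≠ 0} := by
    rintro A ⟨i, k, h⟩
    exact mem_iUnion.2 ⟨i, mem_iUnion.2 ⟨k, h⟩⟩
  refine Set.Finite.subset (Set.finite_iUnion fun i => Set.finite_iUnion fun k => ?_) this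
  refine Set.Finite.of_finite_image (f := fun A => (ht w i A, ht w k A))
    (((hD.lines i).prod (hD.lines k)).subset ?_) ?_
  · rintro _ ⟨A, ⟨-, -, h1, h2⟩, rfl⟩
    exact ⟨⟨A, h1, rfl⟩, ⟨A, h2, rfl⟩⟩
  · rintro A ⟨h1, h2, -, -⟩ B - hAB
    rw [Prod.mk.injEq] at hAB
    exact eq_of_ht_eq hw h1 h2 hAB.2 hAB.1

/-! ### Branch points of germ densities -/

/-- All germs at `A` outside one line vanish. For nonnegative balanced densities this means that
`A` is not a branch point. -/
def NonBranch (D : Plane → ZMod 6 → ℝ) (A : Plane) : Prop :=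
  ∃ i, ∀ k, k ≠ i → k ≠ i + 3 → D A k = 0

lemma NonBranch.no_jump {D : Plane → ZMod 6 → ℝ} (hb : IsBalanced D) {A : Plane}
    (h : NonBranch D A) (k : ZMod 6) : D A k = D A (k + 3) := by
  obtain ⟨i, hi⟩ := h
  have key : ∀ i k : ZMod 6, (k + 2 ≠ i ∧ k + 2 ≠ i + 3 ∧ k + 5 ≠ i ∧ k + 5 ≠ i + 3) ∨
    (k + 4 ≠ i ∧ k + 4 ≠ i + 3 ∧ k + 1 ≠ i ∧ k + 1 ≠ i + 3) := by decide
  rcases key i k with ⟨h1, h2, h3, h4⟩ | ⟨h1, h2, h3, h4⟩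
  · have := hb A k
    rw [hi _ h1 h2, hi _ h3 h4] at this; linarith
  · have := hb.four A k
    rw [hi _ h1 h2, hi _ h3 h4] at this; linarith

lemma NonBranch.eq_zero {D : Plane → ZMod 6 → ℝ} {A : Plane}
    (h : NonBranch D A) {k i : ZMod 6} (hk : D A k ≠ 0) (h1 : i ≠ k) (h2 : i ≠ k + 3) :
    D A i = 0 := by
  obtain ⟨l, hl⟩ := h
  have : k = l ∨ k = l + 3 := by
    by_contra! hne; exact hk (hl k hne.1 hne.2)
  rcases this with rfl | rfl
  · exact hl i h1 h2
  · rw [add_three_three] at h2; exact hl i h2 h1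

lemma finite_branch (hw : IsUnitTriple w) {D : Plane → ZMod 6 → ℝ} (hD : IsStep w D) :
    {A | ¬NonBranch D A}.Finite := by
  refine (hD.finite_crossings hw).subset fun A hA => ?_
  by_contra hno
  apply hA
  by_cases h : ∃ k, D A k ≠ 0
  · obtain ⟨k, hk⟩ := h
    refine ⟨k, fun i h1 h2 => ?_⟩
    by_contra h3
    exact hno ⟨i, k, h1, h2, h3, hk⟩
  · push Not at h
    exact ⟨0, fun k _ _ => h k⟩

lemma eventually_nonBranch (hw : IsUnitTriple w) {D : Plane → ZMod 6 → ℝ} (hD : IsStep w D)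
    (A : Plane) (k : ZMod 6) : ∀ᶠ s in 𝓝[>] (0 : ℝ), NonBranch D (A + s • dir w k) := by
  filter_upwards [hD.eventually_only hw A k] with s hs using ⟨k, hs⟩

/-- With nonnegative balanced densities, a point with fewer than three nonzero germs is not a
branch point: its nonzero germs are opposite to each other. -/
lemma nonBranch_of_card {D : Plane → ZMod 6 → ℝ} (hb : IsBalanced D)
    (hn : ∀ A k, 0 ≤ D A k) {A : Plane}
    (h : (Finset.univ.filter fun k : ZMod 6 => D A k ≠ 0).card < 3) : NonBranch D A := by
  by_cases hz : ∃ k, D A k ≠ 0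
  swap
  · push Not at hz; exact ⟨0, fun k _ _ => hz k⟩
  obtain ⟨k, hk⟩ := hz
  have hpos : 0 < D A k := lt_of_le_of_ne (hn A k) (Ne.symm hk)
  have three : ∀ a b c : ZMod 6, a ≠ b → a ≠ c → b ≠ c → D A a ≠ 0 → D A b ≠ 0 → D A c ≠ 0 →
      False := by
    intro a b c hab hac hbc ha hb hc
    have : ({a, b, c} : Finset (ZMod 6)) ⊆ Finset.univ.filter fun k : ZMod 6 => D A k ≠ 0 := by
      intro x hx
      simp only [Finset.mem_insert, Finset.mem_singleton] at hx
      simp only [Finset.mem_filter, Finset.mem_univ, true_and]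
      rcases hx with rfl | rfl | rfl <;> assumption
    have := Finset.card_le_card this
    rw [Finset.card_eq_three.2 ⟨a, b, c, hab, hac, hbc, rfl⟩] at this
    omega
  have hne : ∀ k : ZMod 6, k ≠ k + 2 ∧ k ≠ k + 4 ∧ k + 2 ≠ k + 4 ∧ k ≠ k + 3 := by decide
  have h3 : D A (k + 3) ≠ 0 := by
    intro h3
    have e1 := hb A k
    have e2 := hb.four A k
    refine three k (k + 2) (k + 4) (hne k).1 (hne k).2.1 (hne k).2.2.1 hk ?_ ?_
    · intro h0; linarith [hn A (k + 5)]
    · intro h0; linarith [hn A (k + 1)]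
  refine ⟨k, fun i h1 h2 => ?_⟩
  by_contra h4
  exact three k (k + 3) i (hne k).2.2.2 (Ne.symm h1) (Ne.symm h2) hk h3 h4

end

section

variable {w : Fin 3 → Plane}

/-! ### Measures on the carrying lines -/

/-- The point with coordinate `t` on the line of direction `w j` at height `b`. -/
def linePt (w : Fin 3 → Plane) (j : Fin 3) (b t : ℝ) : Plane :=
  b • dir w (ev j + 1) + t • dir w (ev j)

/-- The measure on a line of direction `w j` whose density is the restriction of `D`. -/
def lineMeas (w : Fin 3 → Plane) (D : Plane → ZMod 6 → ℝ) (j : Fin 3) (b : ℝ) : Measure Plane :=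
  Measure.map (linePt w j b)
    (volume.withDensity fun t => ENNReal.ofReal (D (linePt w j b t) (ev j)))

/-- The measure with germ densities `D`, assembled from finitely many lines. -/
def lineSum (w : Fin 3 → Plane) (L : Finset (Fin 3 × ℝ)) (D : Plane → ZMod 6 → ℝ) :
    Measure Plane :=
  ∑ p ∈ L, lineMeas w D p.1 p.2

/-- The coordinate of a point along a line of direction `w j`. -/
def pos (w : Fin 3 → Plane) (j : Fin 3) (A : Plane) : ℝ := -ht w (ev j + 1) A

lemma linePt_pos (hw : IsUnitTriple w) (j : Fin 3) (A : Plane) :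
    linePt w j (ht w (ev j) A) (pos w j A) = A := by
  conv_rhs => rw [decomp hw (ev j) A]
  rw [linePt, pos, add_comm]

lemma ht_linePt (hw : IsUnitTriple w) (j : Fin 3) (b t : ℝ) :
    ht w (ev j) (linePt w j b t) = b := by
  rw [linePt, map_add, map_smul, map_smul, ht_dir_one hw, ht_dir]; simp

lemma linePt_add (w : Fin 3 → Plane) (j : Fin 3) (b t s : ℝ) :
    linePt w j b (t + s) = linePt w j b t + s • dir w (ev j) := by
  simp only [linePt]; module

lemma linePt_sub (w : Fin 3 → Plane) (j : Fin 3) (b t s : ℝ) :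
    linePt w j b (t - s) = linePt w j b t + s • dir w (ev j + 3) := by
  rw [dir_add_three]; simp only [linePt]; module

lemma linePt_injective (hw : IsUnitTriple w) (j : Fin 3) (b : ℝ) :
    Function.Injective (linePt w j b) := fun _ _ h =>
  smul_left_injective ℝ (dir_ne_zero hw (ev j)) (add_left_cancel h)

lemma pos_linePt (hw : IsUnitTriple w) (j : Fin 3) (b t : ℝ) :
    pos w j (linePt w j b t) = t := by
  apply linePt_injective hw j b
  conv_lhs => rw [← ht_linePt hw j b t]
  rw [ht_linePt hw]
  have := linePt_pos hw j (linePt w j b t)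
  rwa [ht_linePt hw] at this

lemma continuous_linePt (w : Fin 3 → Plane) (j : Fin 3) (b : ℝ) : Continuous (linePt w j b) := by
  unfold linePt; fun_prop

lemma continuous_pos (w : Fin 3 → Plane) (j : Fin 3) : Continuous (pos w j) :=
  (ht_continuous w _).neg

lemma measurableEmbedding_linePt (hw : IsUnitTriple w) (j : Fin 3) (b : ℝ) :
    MeasurableEmbedding (linePt w j b) :=
  (continuous_linePt w j b).measurableEmbedding (linePt_injective hw j b)

lemma mem_shortSegment {A v B : Plane} {ε : ℝ} :
    B ∈ shortSegment A v ε ↔ ∃ t : ℝ, 0 < t ∧ t < ε ∧ B = A + t • v := Iff.rfl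

lemma preimage_shortSegment (hw : IsUnitTriple w) (j : Fin 3) (A : Plane) (ε : ℝ) :
    linePt w j (ht w (ev j) A) ⁻¹' shortSegment A (dir w (ev j)) ε =
      Ioo (pos w j A) (pos w j A + ε) := by
  ext t
  rw [mem_preimage, mem_shortSegment]
  conv_lhs => rw [← linePt_pos hw j A]
  simp only [ht_linePt hw, ← linePt_add]
  constructor
  · rintro ⟨s, h1, h2, h3⟩
    rw [linePt_injective hw j _ h3]; constructor <;> linarith
  · rintro ⟨h1, h2⟩
    exact ⟨t - pos w j A, by linarith, by linarith, by congr 1; ring⟩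

lemma preimage_shortSegment_neg (hw : IsUnitTriple w) (j : Fin 3) (A : Plane) (ε : ℝ) :
    linePt w j (ht w (ev j) A) ⁻¹' shortSegment A (dir w (ev j + 3)) ε =
      Ioo (pos w j A - ε) (pos w j A) := by
  ext t
  rw [mem_preimage, mem_shortSegment]
  conv_lhs => rw [← linePt_pos hw j A]
  simp only [ht_linePt hw, ← linePt_sub]
  constructor
  · rintro ⟨s, h1, h2, h3⟩
    rw [linePt_injective hw j _ h3]; constructor <;> linarith
  · rintro ⟨h1, h2⟩
    exact ⟨pos w j A - t, by linarith, by linarith, by congr 1; ring⟩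

lemma preimage_shortSegment_other (hw : IsUnitTriple w) {j : Fin 3} {b : ℝ} {A : Plane}
    {k : ZMod 6} (h : ¬((k = ev j ∨ k = ev j + 3) ∧ ht w (ev j) A = b)) (ε : ℝ) :
    (linePt w j b ⁻¹' shortSegment A (dir w k) ε).Subsingleton := by
  rintro t ⟨s, -, -, h1⟩ t' ⟨s', -, -, h2⟩
  apply linePt_injective hw j b
  have e1 : ht w (ev j) A + s * ht w (ev j) (dir w k) = b := by
    rw [← ht_smul_add, ← h1, ht_linePt hw]
  have e2 : ht w (ev j) A + s' * ht w (ev j) (dir w k) = b := by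
    rw [← ht_smul_add, ← h2, ht_linePt hw]
  by_cases hk : k = ev j ∨ k = ev j + 3
  · exfalso; apply h ⟨hk, _⟩
    have : ht w (ev j) (dir w k) = 0 := by
      rcases hk with rfl | rfl
      · exact ht_dir w _
      · exact ht_dir_three w _
    rw [this, mul_zero, add_zero] at e1
    exact e1
  · push Not at hk
    have : s = s' := mul_right_cancel₀ (ht_dir_ne_zero hw hk.1 hk.2) (by linarith)
    rw [h1, h2, this]

/-- The measure `μ` has constant density `c` on short segments at `A` in direction `v`; here `v` is
a unit vector. -/
def HasDens (μ : Measure Plane) (A v : Plane) (c : ℝ) : Prop :=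
  0 ≤ c ∧ ∀ᶠ ε in 𝓝[>] (0 : ℝ), μ (shortSegment A v ε) = ENNReal.ofReal (c * ε)

lemma HasDens.density_eq {μ : Measure Plane} {A v : Plane} {c : ℝ} (h : HasDens μ A v c) :
    density μ A v = c := by
  refine Tendsto.limUnder_eq ((tendsto_const_nhds (x := c)).congr' ?_)
  filter_upwards [h.2, self_mem_nhdsWithin] with ε hε h0
  have h0 : 0 < ε := h0
  rw [hε, ENNReal.toReal_ofReal (mul_nonneg h.1 h0.le)]
  field_simp

lemma HasDens.zero (A v : Plane) : HasDens 0 A v 0 := ⟨le_rfl, by simp⟩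

lemma HasDens.add {μ ν : Measure Plane} {A v : Plane} {c d : ℝ} (h : HasDens μ A v c)
    (h' : HasDens ν A v d) : HasDens (μ + ν) A v (c + d) := by
  refine ⟨add_nonneg h.1 h'.1, ?_⟩
  filter_upwards [h.2, h'.2, self_mem_nhdsWithin] with ε h1 h2 h0
  have h0 : 0 < ε := h0
  rw [Measure.add_apply, h1, h2, add_mul,
    ENNReal.ofReal_add (mul_nonneg h.1 h0.le) (mul_nonneg h'.1 h0.le)]

lemma HasDens.sum {ι : Type*} (s : Finset ι) {μ : ι → Measure Plane} {A v : Plane} {c : ι → ℝ}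
    (h : ∀ i ∈ s, HasDens (μ i) A v (c i)) : HasDens (∑ i ∈ s, μ i) A v (∑ i ∈ s, c i) := by
  classical
  induction s using Finset.induction_on with
  | empty => simpa using HasDens.zero A v
  | insert a s ha ih =>
    rw [Finset.sum_insert ha, Finset.sum_insert ha]
    exact (h a (Finset.mem_insert_self _ _)).add
      (ih fun i hi => h i (Finset.mem_insert_of_mem hi))

lemma lineMeas_apply (hw : IsUnitTriple w) (D : Plane → ZMod 6 → ℝ) (j : Fin 3) (b : ℝ)
    (E : Set Plane) : lineMeas w D j b E =
      ∫⁻ t in linePt w j b ⁻¹' E, ENNReal.ofReal (D (linePt w j b t) (ev j)) := by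
  rw [lineMeas, (measurableEmbedding_linePt hw j b).map_apply, withDensity_apply']

lemma hasDens_lineMeas (hw : IsUnitTriple w) {D : Plane → ZMod 6 → ℝ} (hD : IsStep w D)
    (hn : ∀ A k, 0 ≤ D A k) (j : Fin 3) (b : ℝ) (A : Plane) (k : ZMod 6) :
    HasDens (lineMeas w D j b) A (dir w k)
      (if (k = ev j ∨ k = ev j + 3) ∧ ht w (ev j) A = b then D A k else 0) := by
  by_cases h : (k = ev j ∨ k = ev j + 3) ∧ ht w (ev j) A = b
  swap
  · rw [if_neg h]
    refine ⟨le_rfl, Eventually.of_forall fun ε => ?_⟩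
    rw [lineMeas_apply hw, Measure.restrict_zero_set, lintegral_zero_measure, zero_mul,
      ENNReal.ofReal_zero]
    exact (preimage_shortSegment_other hw h ε).measure_zero _
  rw [if_pos h]
  refine ⟨hn A k, ?_⟩
  obtain ⟨hk, rfl⟩ := h
  have hloc := hD.loc A k
  rw [eventually_nhdsWithin_iff, Metric.eventually_nhds_iff] at hloc
  obtain ⟨δ, hδ, hloc⟩ := hloc
  filter_upwards [Ioo_mem_nhdsGT hδ] with ε hε
  have hA := linePt_pos hw j A
  rw [lineMeas_apply hw]
  rcases hk with rfl | rfl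
  · rw [preimage_shortSegment hw, setLIntegral_congr_fun (g := fun _ => ENNReal.ofReal (D A (ev j)))
      measurableSet_Ioo, setLIntegral_const, Real.volume_Ioo, add_sub_cancel_left,
      ← ENNReal.ofReal_mul (hn _ _)]
    intro t ht
    have := (hloc (y := t - pos w j A) (by
      rw [Real.dist_eq, sub_zero, abs_of_pos (by linarith [ht.1])]; linarith [ht.2, hε.2])
      (by simpa using ht.1)).1
    conv_lhs at this => rw [← hA]
    rw [pos_linePt hw, ← linePt_add, add_sub_cancel] at this
    simp only [this]
  · rw [preimage_shortSegment_neg hw,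
      setLIntegral_congr_fun (g := fun _ => ENNReal.ofReal (D A (ev j + 3)))
      measurableSet_Ioo, setLIntegral_const, Real.volume_Ioo, sub_sub_cancel,
      ← ENNReal.ofReal_mul (hn _ _)]
    intro t ht
    have := (hloc (y := pos w j A - t) (by
      rw [Real.dist_eq, sub_zero, abs_of_pos (by linarith [ht.2])]; linarith [ht.1, hε.2])
      (by simpa using ht.2)).2
    conv_lhs at this => rw [← hA]
    rw [pos_linePt hw, ← linePt_sub, sub_sub_cancel, add_three_three] at this
    simp only [this]

/-- The finite set `L` contains all lines which carry `D`. Lines are recorded by their direction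
and height. The germs in direction `-w j` need not be mentioned, since they agree with germs in
direction `w j` at nearby points. -/
def Carries (w : Fin 3 → Plane) (L : Finset (Fin 3 × ℝ)) (D : Plane → ZMod 6 → ℝ) : Prop :=
  ∀ A j, D A (ev j) ≠ 0 → (j, ht w (ev j) A) ∈ L

lemma IsStep.exists_carries {D : Plane → ZMod 6 → ℝ} (hD : IsStep w D) :
    ∃ L, Carries w L D := by
  classical
  refine ⟨Finset.univ.biUnion fun j => (hD.lines (ev j)).toFinset.image fun b => (j, b), ?_⟩
  intro A j h
  simp only [Finset.mem_biUnion, Finset.mem_univ, true_and, Finset.mem_image,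
    Set.Finite.mem_toFinset]
  exact ⟨j, _, ⟨A, h, rfl⟩, rfl⟩

lemma Carries.mono {L L' : Finset (Fin 3 × ℝ)} {D : Plane → ZMod 6 → ℝ} (h : Carries w L D)
    (hL : L ⊆ L') : Carries w L' D := fun A j hA => hL (h A j hA)

lemma ev_inj {k : ZMod 6} {i j : Fin 3} (hi : k = ev i ∨ k = ev i + 3)
    (hj : k = ev j ∨ k = ev j + 3) : i = j := by
  have : ∀ (k : ZMod 6) (i j : Fin 3), (k = ev i ∨ k = ev i + 3) → (k = ev j ∨ k = ev j + 3) →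
      i = j := by decide
  exact this k i j hi hj

/-- A nonnegative step function is the germ density of the measure it defines. -/
lemma hasDens_lineSum (hw : IsUnitTriple w) {D : Plane → ZMod 6 → ℝ} (hD : IsStep w D)
    (hn : ∀ A k, 0 ≤ D A k) {L : Finset (Fin 3 × ℝ)} (hL : Carries w L D) (A : Plane)
    (k : ZMod 6) : HasDens (lineSum w L D) A (dir w k) (D A k) := by
  have h := HasDens.sum L (fun p _ => hasDens_lineMeas hw hD hn p.1 p.2 A k)
  obtain ⟨j, hj⟩ := ev_or k
  suffices hsum : ∑ p ∈ L, (if (k = ev p.1 ∨ k = ev p.1 + 3) ∧ ht w (ev p.1) A = p.2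
      then D A k else 0) = D A k by
    rw [hsum] at h; exact h
  rw [Finset.sum_eq_single (j, ht w (ev j) A), if_pos ⟨hj, rfl⟩]
  · rintro ⟨i, b⟩ _ hne
    rw [if_neg]
    rintro ⟨hi, hb⟩
    obtain rfl := ev_inj (i := i) hi hj
    exact hne (Prod.ext rfl hb.symm)
  · intro hnot
    rw [if_pos ⟨hj, rfl⟩]
    by_contra h0
    apply hnot
    rcases hj with rfl | rfl
    · exact hL A j h0
    · obtain ⟨s, hs⟩ := (hD.loc A (ev j + 3)).exists
      rw [add_three_three] at hs
      have := hL _ j (by rw [hs.2]; exact h0)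
      rwa [ht_smul_add, ht_dir_three, mul_zero, add_zero] at this

lemma lineMeas_mono {D E : Plane → ZMod 6 → ℝ} (h : ∀ A k, D A k ≤ E A k)
    (j : Fin 3) (b : ℝ) : lineMeas w D j b ≤ lineMeas w E j b :=
  Measure.map_mono (withDensity_mono (Eventually.of_forall fun _ =>
    ENNReal.ofReal_le_ofReal (h _ _))) (continuous_linePt w j b).measurable

lemma lineSum_mono {D E : Plane → ZMod 6 → ℝ} (h : ∀ A k, D A k ≤ E A k)
    (L : Finset (Fin 3 × ℝ)) : lineSum w L D ≤ lineSum w L E :=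
  Finset.sum_le_sum fun _ _ => lineMeas_mono h _ _

lemma IsStep.finite_line_jumps (hw : IsUnitTriple w) {D : Plane → ZMod 6 → ℝ} (hD : IsStep w D)
    (j : Fin 3) (b : ℝ) :
    {t | D (linePt w j b t) (ev j) ≠ D (linePt w j b t) (ev j + 3)}.Finite :=
  (hD.jumps.preimage (linePt_injective hw j b).injOn).subset fun _ ht => ⟨ev j, ht⟩

lemma IsStep.line_const {D : Plane → ZMod 6 → ℝ} (hD : IsStep w D) {j : Fin 3} {b x y : ℝ}
    (hxy : x < y) (h : ∀ t, x < t → t ≤ y →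
      D (linePt w j b t) (ev j) = D (linePt w j b t) (ev j + 3)) :
    D (linePt w j b y) (ev j) = D (linePt w j b x) (ev j) := by
  have := (hD.const (A := linePt w j b x) (k := ev j) (t := y - x) (by linarith) (by
    intro s h1 h2
    rw [← linePt_add]
    exact h _ (by linarith) (by linarith))).2
  rw [← linePt_add, add_sub_cancel] at this
  rw [h y hxy le_rfl, this]

/-- For a finite set `F` of reals, the points outside `F` which lie above exactly the elements of
`T ⊆ F`. -/
def cell (F T : Finset ℝ) : Set ℝ := {t | t ∉ F ∧ ∀ a ∈ F, a < t ↔ a ∈ T}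

lemma cell_ordConnected (F T : Finset ℝ) : (cell F T).OrdConnected := by
  refine ⟨fun x hx y hy z hz => ⟨fun hzF => ?_, fun a ha => ⟨fun h => ?_, fun h => ?_⟩⟩⟩
  · rcases eq_or_lt_of_le hz.2 with h | h
    · exact hy.1 (h ▸ hzF)
    · have := (hx.2 z hzF).2 ((hy.2 z hzF).1 h)
      linarith [hz.1]
  · exact (hy.2 a ha).1 (lt_of_lt_of_le h hz.2)
  · exact lt_of_lt_of_le ((hx.2 a ha).2 h) hz.1

lemma mem_cell_iff {F T : Finset ℝ} (hT : T ⊆ F) {t : ℝ} (ht : t ∉ F) :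
    t ∈ cell F T ↔ T = F.filter (· < t) := by
  constructor
  · rintro ⟨-, h⟩
    ext a
    rw [Finset.mem_filter]
    exact ⟨fun ha => ⟨hT ha, (h a (hT ha)).2 ha⟩, fun ha => (h a ha.1).1 ha.2⟩
  · rintro rfl
    exact ⟨ht, fun a ha => by simp [ha]⟩

lemma HasStepDensity.zero : HasStepDensity w 0 :=
  ⟨0, Fin.elim0, Fin.elim0, Fin.elim0, Fin.elim0, fun i => i.elim0, by simp⟩

lemma HasStepDensity.add {μ ν : Measure Plane} (hμ : HasStepDensity w μ)
    (hν : HasStepDensity w ν) : HasStepDensity w (μ + ν) := by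
  obtain ⟨n, A, j, I, c, hI, rfl⟩ := hμ
  obtain ⟨n', A', j', I', c', hI', rfl⟩ := hν
  refine ⟨n + n', Fin.append A A', Fin.append j j', Fin.append I I', Fin.append c c',
    fun i => ?_, ?_⟩
  · refine Fin.addCases (fun i => ?_) (fun i => ?_) i
    · rw [Fin.append_left]; exact hI i
    · rw [Fin.append_right]; exact hI' i
  · rw [Fin.sum_univ_add]; simp

lemma HasStepDensity.sum {ι : Type*} (s : Finset ι) {μ : ι → Measure Plane}
    (h : ∀ i ∈ s, HasStepDensity w (μ i)) : HasStepDensity w (∑ i ∈ s, μ i) := by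
  classical
  induction s using Finset.induction_on with
  | empty => simpa using HasStepDensity.zero
  | insert a s ha ih =>
    rw [Finset.sum_insert ha]
    exact (h a (Finset.mem_insert_self _ _)).add
      (ih fun i hi => h i (Finset.mem_insert_of_mem hi))

lemma HasStepDensity.smul {μ : Measure Plane} (hμ : HasStepDensity w μ) (c : ℝ≥0) :
    HasStepDensity w (c • μ) := by
  obtain ⟨n, A, j, I, d, hI, rfl⟩ := hμ
  refine ⟨n, A, j, I, fun i => c * d i, hI, ?_⟩
  rw [Finset.smul_sum]
  exact Finset.sum_congr rfl fun i _ => by rw [smul_smul]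

lemma HasStepDensity.lengthMeasure (A : Plane) (j : Fin 3) {I : Set ℝ} (hI : I.OrdConnected) :
    HasStepDensity w (HoneycombMeasure.lengthMeasure A (w j) I) :=
  ⟨1, fun _ => A, fun _ => j, fun _ => I, fun _ => 1, fun _ => hI, by simp⟩

/-- The line is cut at the jumps of `D`. Between the jumps `D` is constant, and the pieces are the
cells of the finite set of jumps; the jumps themselves are a null set. -/
lemma hasStepDensity_lineMeas (hw : IsUnitTriple w) {D : Plane → ZMod 6 → ℝ} (hD : IsStep w D)
    (j : Fin 3) (b : ℝ) : HasStepDensity w (lineMeas w D j b) := by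
  classical
  set F := (hD.finite_line_jumps hw j b).toFinset with hF
  set f : ℝ → ℝ := fun t => D (linePt w j b t) (ev j) with hf
  have hjump : ∀ t, t ∉ F → D (linePt w j b t) (ev j) = D (linePt w j b t) (ev j + 3) := by
    intro t ht
    simpa [hF] using ht
  -- the value of `f` on a cell
  set c : Finset ℝ → ℝ≥0 := fun T =>
    if h : (cell F T).Nonempty then (f h.choose).toNNReal else 0 with hc
  have hlt : ∀ T, ∀ x ∈ cell F T, ∀ y ∈ cell F T, x < y → f y = f x := by
    intro T x hx y hy hxy
    refine hD.line_const hxy fun t h1 h2 => hjump t fun htF => ?_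
    exact ((cell_ordConnected F T).out hx hy ⟨h1.le, h2⟩).1 htF
  have hconst : ∀ T, ∀ x ∈ cell F T, (c T : ENNReal) = ENNReal.ofReal (f x) := by
    intro T x hx
    have hne : (cell F T).Nonempty := ⟨x, hx⟩
    have : f hne.choose = f x := by
      rcases lt_trichotomy x hne.choose with h | h | h
      · exact hlt T x hx _ hne.choose_spec h
      · rw [← h]
      · exact (hlt T _ hne.choose_spec x hx h).symm
    simp only [hc]
    rw [dif_pos hne, this]; rfl
  have key : lineMeas w D j b =
      ∑ T ∈ F.powerset, c T • lengthMeasure (linePt w j b 0) (w j) (cell F T) := by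
    have hmap : ∀ T, lengthMeasure (linePt w j b 0) (w j) (cell F T) =
        Measure.map (linePt w j b) (volume.restrict (cell F T)) := by
      intro T
      rw [lengthMeasure]
      congr 1
      ext1 t
      rw [← dir_ev w j, ← linePt_add, zero_add]
    simp only [hmap]
    have hdens : volume.withDensity (fun t => ENNReal.ofReal (f t)) =
        ∑ T ∈ F.powerset, c T • volume.restrict (cell F T) := by
      ext s hs
      have hae : ∀ᵐ t : ℝ, t ∉ F := by
        rw [ae_iff]; simpa using F.countable_toSet.measure_zero volume
      rw [withDensity_apply _ hs, Measure.finsetSum_apply]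
      have h1 : ∫⁻ t in s, ENNReal.ofReal (f t) =
          ∫⁻ t in s, ∑ T ∈ F.powerset, (cell F T).indicator (fun _ => (c T : ENNReal)) t := by
        refine lintegral_congr_ae (ae_restrict_of_ae ?_)
        filter_upwards [hae] with t ht
        rw [Finset.sum_eq_single (F.filter (· < t))]
        · have hm := (mem_cell_iff (Finset.filter_subset (· < t) F) ht).2 rfl
          rw [indicator_of_mem hm, hconst _ t hm]
        · intro T hT hne
          rw [indicator_of_notMem]
          rwa [mem_cell_iff (Finset.mem_powerset.1 hT) ht]
        · intro h
          exact absurd (Finset.mem_powerset.2 (Finset.filter_subset _ _)) h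
      rw [h1, lintegral_finsetSum]
      · refine Finset.sum_congr rfl fun T _ => ?_
        rw [lintegral_indicator_const (cell_ordConnected F T).measurableSet, Measure.smul_apply,
          Measure.restrict_apply (cell_ordConnected F T).measurableSet,
          Measure.restrict_apply hs, inter_comm]
        rfl
      · intro T _
        exact measurable_const.indicator (cell_ordConnected F T).measurableSet
    change Measure.map _ (volume.withDensity (fun t => ENNReal.ofReal (f t))) = _
    rw [hdens]
    have hm := (continuous_linePt w j b).measurable
    rw [← Measure.mapₗ_apply_of_measurable hm, map_sum]
    refine Finset.sum_congr rfl fun T _ => ?_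
    rw [Measure.mapₗ_apply_of_measurable hm, Measure.map_smul]
  rw [key]
  exact HasStepDensity.sum _ fun T _ =>
    (HasStepDensity.lengthMeasure _ j (cell_ordConnected F T)).smul _

lemma hasStepDensity_lineSum (hw : IsUnitTriple w) {D : Plane → ZMod 6 → ℝ} (hD : IsStep w D)
    (L : Finset (Fin 3 × ℝ)) : HasStepDensity w (lineSum w L D) :=
  HasStepDensity.sum _ fun _ _ => hasStepDensity_lineMeas hw hD _ _

end

section

variable {w : Fin 3 → Plane}

/-! ### Germ densities of measures with step density -/

/-- `D` is the germ density of `μ`, and `μ` is recovered from `D` on any sufficiently large finite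
set of lines. The bounds on the values of `D` hold because there are finitely many of them. -/
structure IsRep (w : Fin 3 → Plane) (μ : Measure Plane) (D : Plane → ZMod 6 → ℝ) : Prop where
  step : IsStep w D
  nonneg : ∀ A k, 0 ≤ D A k
  bdd : ∃ C, ∀ A k, D A k ≤ C
  low : ∃ ε, 0 < ε ∧ ∀ A k, D A k ≠ 0 → ε ≤ D A k
  eq : ∃ L₀, ∀ L, L₀ ⊆ L → μ = lineSum w L D

lemma IsRep.exists_eq {μ : Measure Plane} {D : Plane → ZMod 6 → ℝ} (h : IsRep w μ D) :
    ∃ L₀, ∀ L, L₀ ⊆ L → Carries w L D ∧ μ = lineSum w L D := by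
  classical
  obtain ⟨L₀, h0⟩ := h.eq
  obtain ⟨L₁, h1⟩ := h.step.exists_carries
  exact ⟨L₀ ∪ L₁, fun L hL => ⟨h1.mono (Finset.union_subset_right hL),
    h0 L (Finset.union_subset_left hL)⟩⟩

lemma IsRep.hasDens (hw : IsUnitTriple w) {μ : Measure Plane} {D : Plane → ZMod 6 → ℝ}
    (h : IsRep w μ D) (A : Plane) (k : ZMod 6) : HasDens μ A (dir w k) (D A k) := by
  obtain ⟨L, hL⟩ := h.exists_eq
  obtain ⟨h1, h2⟩ := hL L subset_rfl
  rw [h2]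
  exact hasDens_lineSum hw h.step h.nonneg h1 A k

lemma IsRep.hasStepDensity (hw : IsUnitTriple w) {μ : Measure Plane} {D : Plane → ZMod 6 → ℝ}
    (h : IsRep w μ D) : HasStepDensity w μ := by
  obtain ⟨L, hL⟩ := h.exists_eq
  rw [(hL L subset_rfl).2]
  exact hasStepDensity_lineSum hw h.step L

lemma IsRep.zero : IsRep w 0 (fun _ _ => 0) := by
  refine ⟨IsStep.zero, fun _ _ => le_rfl, ⟨0, fun _ _ => le_rfl⟩,
    ⟨1, one_pos, fun _ _ h => absurd rfl h⟩, ⟨∅, fun L _ => ?_⟩⟩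
  symm
  refine Finset.sum_eq_zero fun p _ => ?_
  simp [lineMeas]

lemma IsStep.measurable_line (hw : IsUnitTriple w) {D : Plane → ZMod 6 → ℝ} (hD : IsStep w D)
    (j : Fin 3) (b : ℝ) : Measurable fun t => D (linePt w j b t) (ev j) := by
  set F := {t | D (linePt w j b t) (ev j) ≠ D (linePt w j b t) (ev j + 3)} with hF
  have hfin : F.Finite := hD.finite_line_jumps hw j b
  intro U _
  set f := fun t => D (linePt w j b t) (ev j) with hf
  rw [← inter_union_compl (f ⁻¹' U) F]
  refine (hfin.subset inter_subset_right).measurableSet.union (IsOpen.measurableSet ?_)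
  -- outside its finitely many jumps, `f` is locally constant
  rw [isOpen_iff_mem_nhds]
  rintro t ⟨htU, htF⟩
  have hno : D (linePt w j b t) (ev j) = D (linePt w j b t) (ev j + 3) := by
    by_contra h; exact htF h
  have h1 := hD.loc (linePt w j b t) (ev j)
  have h2 := hD.loc (linePt w j b t) (ev j + 3)
  rw [eventually_nhdsWithin_iff, Metric.eventually_nhds_iff] at h1 h2
  obtain ⟨ε₁, hε₁, h1⟩ := h1
  obtain ⟨ε₂, hε₂, h2⟩ := h2
  have hev : ∀ᶠ x in 𝓝 t, f x = f t := by
    rw [Metric.eventually_nhds_iff]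
    refine ⟨min ε₁ ε₂, lt_min hε₁ hε₂, fun x hx => ?_⟩
    rw [Real.dist_eq, lt_min_iff] at hx
    rcases lt_trichotomy x t with h | h | h
    · have := (h2 (y := t - x) (by
        rw [Real.dist_eq, sub_zero, abs_sub_comm]; exact hx.2) (by simpa using h)).2
      rw [← linePt_sub, sub_sub_cancel, add_three_three, ← hno] at this
      exact this
    · rw [h]
    · have := (h1 (y := x - t) (by
        rw [Real.dist_eq, sub_zero]; exact hx.1) (by simpa using h)).1
      rw [← linePt_add, add_sub_cancel] at this
      exact this
  have hF' : Fᶜ ∈ 𝓝 t := hfin.isClosed.isOpen_compl.mem_nhds htF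
  filter_upwards [hev, hF'] with x hx hxF
  exact ⟨by rw [mem_preimage, hx]; exact htU, hxF⟩

lemma lineMeas_add (hw : IsUnitTriple w) {D E : Plane → ZMod 6 → ℝ} (hD : IsStep w D)
    (hDn : ∀ A k, 0 ≤ D A k) (hEn : ∀ A k, 0 ≤ E A k) (j : Fin 3) (b : ℝ) :
    lineMeas w (fun A k => D A k + E A k) j b = lineMeas w D j b + lineMeas w E j b := by
  unfold lineMeas
  rw [← Measure.map_add _ _ (continuous_linePt w j b).measurable,
    ← withDensity_add_left (hD.measurable_line hw j b).ennreal_ofReal]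
  congr 2
  ext1 t
  exact ENNReal.ofReal_add (hDn _ _) (hEn _ _)

lemma lineMeas_smul (hw : IsUnitTriple w) {D : Plane → ZMod 6 → ℝ} (hD : IsStep w D)
    (c : ℝ≥0) (j : Fin 3) (b : ℝ) :
    lineMeas w (fun A k => c * D A k) j b = c • lineMeas w D j b := by
  unfold lineMeas
  rw [← Measure.map_smul]
  congr 1
  have := withDensity_smul (μ := volume) (c : ENNReal)
    (hD.measurable_line hw j b).ennreal_ofReal
  rw [show (c • volume.withDensity fun t => ENNReal.ofReal (D (linePt w j b t) (ev j))) =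
    (c : ENNReal) • volume.withDensity fun t => ENNReal.ofReal (D (linePt w j b t) (ev j)) from rfl,
    ← this]
  congr 1
  ext1 t
  change ENNReal.ofReal ((c : ℝ) * D (linePt w j b t) (ev j)) = _
  rw [ENNReal.ofReal_mul c.coe_nonneg, ENNReal.ofReal_coe_nnreal]; rfl

lemma IsRep.add (hw : IsUnitTriple w) {μ ν : Measure Plane} {D E : Plane → ZMod 6 → ℝ}
    (hD : IsRep w μ D) (hE : IsRep w ν E) : IsRep w (μ + ν) (fun A k => D A k + E A k) := by
  classical
  refine ⟨hD.step.add hE.step, fun A k => add_nonneg (hD.nonneg A k) (hE.nonneg A k), ?_, ?_, ?_⟩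
  · obtain ⟨C, hC⟩ := hD.bdd
    obtain ⟨C', hC'⟩ := hE.bdd
    exact ⟨C + C', fun A k => add_le_add (hC A k) (hC' A k)⟩
  · obtain ⟨ε, h0, h⟩ := hD.low
    obtain ⟨ε', h0', h'⟩ := hE.low
    refine ⟨min ε ε', lt_min h0 h0', fun A k hne => ?_⟩
    by_cases hz : D A k = 0
    · rw [hz, zero_add] at hne ⊢
      exact (min_le_right _ _).trans (h' A k hne)
    · exact (min_le_left _ _).trans ((h A k hz).trans (le_add_of_nonneg_right (hE.nonneg A k)))
  · obtain ⟨L, hL⟩ := hD.eq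
    obtain ⟨L', hL'⟩ := hE.eq
    refine ⟨L ∪ L', fun M hM => ?_⟩
    rw [hL M (Finset.union_subset_left hM), hL' M (Finset.union_subset_right hM)]
    unfold lineSum
    rw [← Finset.sum_add_distrib]
    exact Finset.sum_congr rfl fun p _ =>
      (lineMeas_add hw hD.step hD.nonneg hE.nonneg p.1 p.2).symm

lemma IsRep.smul (hw : IsUnitTriple w) {μ : Measure Plane} {D : Plane → ZMod 6 → ℝ}
    (hD : IsRep w μ D) (c : ℝ≥0) : IsRep w (c • μ) (fun A k => c * D A k) := by
  refine ⟨hD.step.smul c, fun A k => mul_nonneg c.2 (hD.nonneg A k), ?_, ?_, ?_⟩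
  · obtain ⟨C, hC⟩ := hD.bdd
    exact ⟨c * C, fun A k => mul_le_mul_of_nonneg_left (hC A k) c.2⟩
  · obtain ⟨ε, h0, h⟩ := hD.low
    rcases eq_or_lt_of_le c.2 with hc | hc
    · refine ⟨1, one_pos, fun A k hne => absurd ?_ hne⟩
      have : (c : ℝ) = 0 := hc.symm
      rw [this, zero_mul]
    · refine ⟨c * ε, mul_pos hc h0, fun A k hne => ?_⟩
      exact mul_le_mul_of_nonneg_left (h A k fun hz => hne (by rw [hz, mul_zero])) c.2
  · obtain ⟨L, hL⟩ := hD.eq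
    refine ⟨L, fun M hM => ?_⟩
    rw [hL M hM]
    unfold lineSum
    rw [Finset.smul_sum]
    exact Finset.sum_congr rfl fun p _ => (lineMeas_smul hw hD.step c p.1 p.2).symm

lemma IsRep.sum (hw : IsUnitTriple w) {ι : Type*} (s : Finset ι) {μ : ι → Measure Plane}
    {D : ι → Plane → ZMod 6 → ℝ} (h : ∀ i ∈ s, IsRep w (μ i) (D i)) :
    IsRep w (∑ i ∈ s, μ i) (fun A k => ∑ i ∈ s, D i A k) := by
  classical
  induction s using Finset.induction_on with
  | empty => simpa using IsRep.zero
  | insert a s ha ih =>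
    simp only [Finset.sum_insert ha]
    exact (h a (Finset.mem_insert_self _ _)).add hw
      (ih fun i hi => h i (Finset.mem_insert_of_mem hi))

/-! ### The germ densities of a length measure -/

/-- `1` if the interval `I` contains a right neighbourhood of `a`, and `0` otherwise. -/
def germR (I : Set ℝ) (a : ℝ) : ℝ :=
  open Classical in if ∃ ε > 0, Ioo a (a + ε) ⊆ I then 1 else 0

/-- `1` if the interval `I` contains a left neighbourhood of `a`, and `0` otherwise. -/
def germL (I : Set ℝ) (a : ℝ) : ℝ :=
  open Classical in if ∃ ε > 0, Ioo (a - ε) a ⊆ I then 1 else 0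

lemma germR_zero_or_one (I : Set ℝ) (a : ℝ) : germR I a = 0 ∨ germR I a = 1 := by
  unfold germR; split_ifs <;> simp

lemma germL_zero_or_one (I : Set ℝ) (a : ℝ) : germL I a = 0 ∨ germL I a = 1 := by
  unfold germL; split_ifs <;> simp

lemma germR_eq_one {I : Set ℝ} {a : ℝ} (h : germR I a ≠ 0) : ∃ ε > 0, Ioo a (a + ε) ⊆ I := by
  unfold germR at h; by_contra hc; exact h (if_neg hc)

lemma germL_eq_one {I : Set ℝ} {a : ℝ} (h : germL I a ≠ 0) : ∃ ε > 0, Ioo (a - ε) a ⊆ I := by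
  unfold germL at h; by_contra hc; exact h (if_neg hc)

lemma germR_of_subset {I : Set ℝ} {a b : ℝ} (hab : a < b) (h : Ioo a b ⊆ I) : germR I a = 1 := by
  unfold germR; exact if_pos ⟨b - a, sub_pos.2 hab, by rwa [add_sub_cancel]⟩

lemma germL_of_subset {I : Set ℝ} {a b : ℝ} (hab : a < b) (h : Ioo a b ⊆ I) : germL I b = 1 := by
  unfold germL; exact if_pos ⟨b - a, sub_pos.2 hab, by rwa [sub_sub_cancel]⟩

lemma germR_of_disjoint {I : Set ℝ} {a b : ℝ} (hab : a < b) (h : ∀ t ∈ Ioo a b, t ∉ I) :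
    germR I a = 0 := by
  by_contra hc
  obtain ⟨ε, h0, hI⟩ := germR_eq_one hc
  have hm : a < min b (a + ε) := lt_min hab (by linarith)
  obtain ⟨t, h1, h2⟩ := exists_between hm
  exact h t ⟨h1, h2.trans_le (min_le_left _ _)⟩ (hI ⟨h1, h2.trans_le (min_le_right _ _)⟩)

lemma germL_of_disjoint {I : Set ℝ} {a b : ℝ} (hab : a < b) (h : ∀ t ∈ Ioo a b, t ∉ I) :
    germL I b = 0 := by
  by_contra hc
  obtain ⟨ε, h0, hI⟩ := germL_eq_one hc
  have hm : max a (b - ε) < b := max_lt hab (by linarith)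
  obtain ⟨t, h1, h2⟩ := exists_between hm
  exact h t ⟨(le_max_left _ _).trans_lt h1, h2⟩ (hI ⟨(le_max_right _ _).trans_lt h1, h2⟩)

lemma right_germ {I : Set ℝ} (hI : I.OrdConnected) (a : ℝ) :
    ∃ b > a, Ioo a b ⊆ I ∨ ∀ t ∈ Ioo a b, t ∉ I := by
  by_cases h : ∀ b > a, ∃ t ∈ Ioo a b, t ∈ I
  · obtain ⟨t, ht, htI⟩ := h (a + 1) (by linarith)
    refine ⟨t, ht.1, Or.inl fun x hx => ?_⟩
    obtain ⟨u, hu, huI⟩ := h x hx.1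
    exact hI.out huI htI ⟨hu.2.le, hx.2.le⟩
  · push Not at h
    obtain ⟨b, hb, h⟩ := h
    exact ⟨b, hb, Or.inr h⟩

lemma left_germ {I : Set ℝ} (hI : I.OrdConnected) (a : ℝ) :
    ∃ b < a, Ioo b a ⊆ I ∨ ∀ t ∈ Ioo b a, t ∉ I := by
  by_cases h : ∀ b < a, ∃ t ∈ Ioo b a, t ∈ I
  · obtain ⟨t, ht, htI⟩ := h (a - 1) (by linarith)
    refine ⟨t, ht.2, Or.inl fun x hx => ?_⟩
    obtain ⟨u, hu, huI⟩ := h x hx.2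
    exact hI.out htI huI ⟨hx.1.le, hu.1.le⟩
  · push Not at h
    obtain ⟨b, hb, h⟩ := h
    exact ⟨b, hb, Or.inr h⟩

lemma germ_right_const {I : Set ℝ} (hI : I.OrdConnected) (a : ℝ) :
    ∀ᶠ s in 𝓝[>] (0 : ℝ), germR I (a + s) = germR I a ∧ germL I (a + s) = germR I a := by
  obtain ⟨b, hb, h⟩ := right_germ hI a
  filter_upwards [Ioo_mem_nhdsGT (sub_pos.2 hb)] with s hs
  have h1 : a < a + s := by linarith [hs.1]
  have h2 : a + s < b := by linarith [hs.2]
  rcases h with h | h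
  · rw [germR_of_subset hb h, germR_of_subset h2 ((Ioo_subset_Ioo_left h1.le).trans h),
      germL_of_subset h1 ((Ioo_subset_Ioo_right h2.le).trans h)]
    exact ⟨rfl, rfl⟩
  · rw [germR_of_disjoint hb h,
      germR_of_disjoint h2 fun t ht => h t (Ioo_subset_Ioo_left h1.le ht),
      germL_of_disjoint h1 fun t ht => h t (Ioo_subset_Ioo_right h2.le ht)]
    exact ⟨rfl, rfl⟩

lemma germ_left_const {I : Set ℝ} (hI : I.OrdConnected) (a : ℝ) :
    ∀ᶠ s in 𝓝[>] (0 : ℝ), germL I (a - s) = germL I a ∧ germR I (a - s) = germL I a := by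
  obtain ⟨b, hb, h⟩ := left_germ hI a
  filter_upwards [Ioo_mem_nhdsGT (sub_pos.2 hb)] with s hs
  have h1 : a - s < a := by linarith [hs.1]
  have h2 : b < a - s := by linarith [hs.2]
  rcases h with h | h
  · rw [germL_of_subset hb h, germL_of_subset h2 ((Ioo_subset_Ioo_right h1.le).trans h),
      germR_of_subset h1 ((Ioo_subset_Ioo_left h2.le).trans h)]
    exact ⟨rfl, rfl⟩
  · rw [germL_of_disjoint hb h,
      germL_of_disjoint h2 fun t ht => h t (Ioo_subset_Ioo_right h1.le ht),
      germR_of_disjoint h1 fun t ht => h t (Ioo_subset_Ioo_left h2.le ht)]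
    exact ⟨rfl, rfl⟩

lemma finite_germ_jumps {I : Set ℝ} (hI : I.OrdConnected) :
    {a | germR I a ≠ germL I a}.Finite := by
  have h1 : {a | germR I a ≠ 0 ∧ germL I a = 0}.Subsingleton := by
    intro a ha b hb
    by_contra hne
    wlog hab : a < b generalizing a b
    · exact this hb ha (Ne.symm hne) (lt_of_le_of_ne (not_lt.1 hab) (Ne.symm hne))
    obtain ⟨ε, h0, h⟩ := germR_eq_one ha.1
    obtain ⟨ε', h0', h'⟩ := germR_eq_one hb.1
    obtain ⟨x, hx1, hx2⟩ := exists_between (show a < min b (a + ε) from lt_min hab (by linarith))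
    have hxI := h ⟨hx1, hx2.trans_le (min_le_right _ _)⟩
    have hyI := h' (show b + ε' / 2 ∈ Ioo b (b + ε') from ⟨by linarith, by linarith⟩)
    have := germL_of_subset (I := I) (hx2.trans_le (min_le_left _ _)) fun t ht =>
      hI.out hxI hyI ⟨ht.1.le, by linarith [ht.2]⟩
    rw [hb.2] at this
    exact zero_ne_one this
  have h2 : {a | germL I a ≠ 0 ∧ germR I a = 0}.Subsingleton := by
    intro a ha b hb
    by_contra hne
    wlog hab : a < b generalizing a b
    · exact this hb ha (Ne.symm hne) (lt_of_le_of_ne (not_lt.1 hab) (Ne.symm hne))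
    obtain ⟨ε, h0, h⟩ := germL_eq_one ha.1
    obtain ⟨ε', h0', h'⟩ := germL_eq_one hb.1
    obtain ⟨x, hx1, hx2⟩ := exists_between (show max a (b - ε') < b from max_lt hab (by linarith))
    have hxI := h' ⟨(le_max_right _ _).trans_lt hx1, hx2⟩
    have hyI := h (show a - ε / 2 ∈ Ioo (a - ε) a from ⟨by linarith, by linarith⟩)
    have := germR_of_subset (I := I) ((le_max_left _ _).trans_lt hx1) fun t ht =>
      hI.out hyI hxI ⟨by linarith [ht.1], ht.2.le⟩
    rw [ha.2] at this
    exact zero_ne_one this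
  refine (h1.finite.union h2.finite).subset fun a ha => ?_
  rcases germR_zero_or_one I a with h | h <;> rcases germL_zero_or_one I a with h' | h'
  · exact absurd (h.trans h'.symm) ha
  · right; exact ⟨by rw [h']; exact one_ne_zero, h⟩
  · left; exact ⟨by rw [h]; exact one_ne_zero, h'⟩
  · exact absurd (h.trans h'.symm) ha

lemma ae_germR {I : Set ℝ} (hI : I.OrdConnected) :
    ∀ᵐ t : ℝ, ENNReal.ofReal (germR I t) = I.indicator 1 t := by
  have h1 : {t | t ∈ I ∧ germR I t = 0}.Subsingleton := by
    intro a ha b hb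
    by_contra hne
    wlog hab : a < b generalizing a b
    · exact this hb ha (Ne.symm hne) (lt_of_le_of_ne (not_lt.1 hab) (Ne.symm hne))
    have := germR_of_subset (I := I) hab fun t ht => hI.out ha.1 hb.1 ⟨ht.1.le, ht.2.le⟩
    rw [ha.2] at this
    exact zero_ne_one this
  have h2 : {t | t ∉ I ∧ germR I t ≠ 0}.Subsingleton := by
    intro a ha b hb
    by_contra hne
    wlog hab : a < b generalizing a b
    · exact this hb ha (Ne.symm hne) (lt_of_le_of_ne (not_lt.1 hab) (Ne.symm hne))
    obtain ⟨ε, h0, h⟩ := germR_eq_one ha.2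
    obtain ⟨ε', h0', h'⟩ := germR_eq_one hb.2
    obtain ⟨x, hx1, hx2⟩ := exists_between (show a < min b (a + ε) from lt_min hab (by linarith))
    have hxI := h ⟨hx1, hx2.trans_le (min_le_right _ _)⟩
    have hyI := h' (show b + ε' / 2 ∈ Ioo b (b + ε') from ⟨by linarith, by linarith⟩)
    exact hb.1 (hI.out hxI hyI ⟨(hx2.trans_le (min_le_left _ _)).le, by linarith⟩)
  have hnull := (h1.finite.union h2.finite).measure_zero volume
  rw [ae_iff]
  refine measure_mono_null (fun t ht => ?_) hnull
  by_contra hc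
  simp only [mem_union, mem_ofPred_eq, not_or, not_and, not_not] at hc
  apply ht
  by_cases htI : t ∈ I
  · rw [indicator_of_mem htI, (germR_zero_or_one I t).resolve_left (hc.1 htI)]; simp
  · rw [indicator_of_notMem htI, hc.2 htI]; simp

/-- The germ density of the length measure of an interval `I` on the line of direction `w j` at
height `b`. -/
def lenD (w : Fin 3 → Plane) (j : Fin 3) (b : ℝ) (I : Set ℝ) (A : Plane) (k : ZMod 6) : ℝ :=
  open Classical in
  if ht w (ev j) A = b then
    if k = ev j then germR I (pos w j A) else if k = ev j + 3 then germL I (pos w j A) else 0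
  else 0

lemma ev_ne (j : Fin 3) : ev j + 3 ≠ ev j := by revert j; decide

lemma lenD_self {j : Fin 3} {b : ℝ} {I : Set ℝ} {A : Plane} (h : ht w (ev j) A = b) :
    lenD w j b I A (ev j) = germR I (pos w j A) := by
  rw [lenD, if_pos h, if_pos rfl]

lemma lenD_opp {j : Fin 3} {b : ℝ} {I : Set ℝ} {A : Plane} (h : ht w (ev j) A = b) :
    lenD w j b I A (ev j + 3) = germL I (pos w j A) := by
  rw [lenD, if_pos h, if_neg (ev_ne j), if_pos rfl]

lemma lenD_ne {j : Fin 3} {b : ℝ} {I : Set ℝ} {A : Plane} (h : ht w (ev j) A ≠ b) (k : ZMod 6) :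
    lenD w j b I A k = 0 := by
  rw [lenD, if_neg h]

lemma lenD_other {j : Fin 3} {b : ℝ} {I : Set ℝ} {A : Plane} {k : ZMod 6} (h : k ≠ ev j)
    (h' : k ≠ ev j + 3) : lenD w j b I A k = 0 := by
  rw [lenD]; split_ifs; rfl; rfl

lemma lenD_zero_or_one (j : Fin 3) (b : ℝ) (I : Set ℝ) (A : Plane) (k : ZMod 6) :
    lenD w j b I A k = 0 ∨ lenD w j b I A k = 1 := by
  by_cases h : ht w (ev j) A = b
  swap
  · left; exact lenD_ne h k
  by_cases h1 : k = ev j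
  · rw [h1, lenD_self h]; exact germR_zero_or_one _ _
  by_cases h2 : k = ev j + 3
  · rw [h2, lenD_opp h]; exact germL_zero_or_one _ _
  left; exact lenD_other h1 h2

lemma lenD_supp {j : Fin 3} {b : ℝ} {I : Set ℝ} {A : Plane} {k : ZMod 6}
    (h : lenD w j b I A k ≠ 0) : (k = ev j ∨ k = ev j + 3) ∧ ht w (ev j) A = b := by
  constructor
  · by_contra hc; push Not at hc; exact h (lenD_other hc.1 hc.2)
  · by_contra hc; exact h (lenD_ne hc k)

lemma pos_add (hw : IsUnitTriple w) (j : Fin 3) (A : Plane) (s : ℝ) :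
    pos w j (A + s • dir w (ev j)) = pos w j A + s := by
  have : ht w (ev j + 1) (dir w (ev j)) = -1 := by
    have e : ev j = ev j + 1 + 5 := by revert j; decide
    conv_lhs => rw [e]
    have := ht_dir_five hw (ev j + 1)
    rwa [← e] at this ⊢
  rw [pos, ht_smul_add, this, pos]; ring

lemma pos_sub (hw : IsUnitTriple w) (j : Fin 3) (A : Plane) (s : ℝ) :
    pos w j (A + s • dir w (ev j + 3)) = pos w j A - s := by
  have := pos_add hw j A (-s)
  rw [dir_add_three, smul_neg, ← neg_smul, this]; ring

lemma isStep_lenD (hw : IsUnitTriple w) (j : Fin 3) (b : ℝ) {I : Set ℝ} (hI : I.OrdConnected) :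
    IsStep w (lenD w j b I) := by
  refine ⟨fun A k => ?_, fun k => ?_, ?_⟩
  · by_cases h1 : k = ev j
    · subst h1
      have hh : ∀ s : ℝ, ht w (ev j) (A + s • dir w (ev j)) = ht w (ev j) A := ht_along w _ A
      by_cases h : ht w (ev j) A = b
      · filter_upwards [germ_right_const hI (pos w j A)] with s hs
        rw [lenD_self h, lenD_self ((hh s).trans h), lenD_opp ((hh s).trans h), pos_add hw]
        exact hs
      · refine Eventually.of_forall fun s => ?_
        rw [lenD_ne h, lenD_ne (by rw [hh]; exact h), lenD_ne (by rw [hh]; exact h)]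
        exact ⟨rfl, rfl⟩
    by_cases h2 : k = ev j + 3
    · subst h2
      have hh : ∀ s : ℝ, ht w (ev j) (A + s • dir w (ev j + 3)) = ht w (ev j) A := by
        intro s; rw [ht_smul_add, ht_dir_three]; ring
      rw [add_three_three]
      by_cases h : ht w (ev j) A = b
      · filter_upwards [germ_left_const hI (pos w j A)] with s hs
        rw [lenD_opp h, lenD_opp ((hh s).trans h), lenD_self ((hh s).trans h), pos_sub hw]
        exact hs
      · refine Eventually.of_forall fun s => ?_
        rw [lenD_ne h, lenD_ne (by rw [hh]; exact h), lenD_ne (by rw [hh]; exact h)]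
        exact ⟨rfl, rfl⟩
    · refine Eventually.of_forall fun s => ?_
      have h3 : k + 3 ≠ ev j := fun h => h2 (by rw [← h, add_three_three])
      have h4 : k + 3 ≠ ev j + 3 := fun h => h1 (add_right_cancel h)
      rw [lenD_other h1 h2, lenD_other h1 h2, lenD_other h3 h4]
      exact ⟨rfl, rfl⟩
  · refine (Set.toFinite {b, -b}).subset ?_
    rintro _ ⟨A, hA, rfl⟩
    obtain ⟨rfl | rfl, h⟩ := lenD_supp hA
    · left; exact h
    · right; rw [ht_add_three, h]; rfl
  · refine ((finite_germ_jumps hI).image (linePt w j b)).subset ?_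
    rintro A ⟨k, hk⟩
    have hb : ht w (ev j) A = b := by
      by_contra h; rw [lenD_ne h, lenD_ne h] at hk; exact hk rfl
    refine ⟨pos w j A, ?_, by rw [← hb]; exact linePt_pos hw j A⟩
    by_cases h1 : k = ev j
    · rw [h1, lenD_self hb, lenD_opp hb] at hk; exact hk
    by_cases h2 : k = ev j + 3
    · rw [h2, add_three_three, lenD_self hb, lenD_opp hb] at hk; exact hk.symm
    have h3 : k + 3 ≠ ev j := fun h => h2 (by rw [← h, add_three_three])
    have h4 : k + 3 ≠ ev j + 3 := fun h => h1 (add_right_cancel h)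
    rw [lenD_other h1 h2, lenD_other h3 h4] at hk
    exact absurd rfl hk

/-- The parameter of a length measure starts at `A`, that of `linePt` at the foot of the line, so
the interval has to be shifted. -/
lemma lengthMeasure_eq (hw : IsUnitTriple w) (A : Plane) (j : Fin 3) {I : Set ℝ}
    (hI : I.OrdConnected) : lengthMeasure A (w j) I =
      lineMeas w (lenD w j (ht w (ev j) A) ((fun t => -pos w j A + t) ⁻¹' I)) j
        (ht w (ev j) A) := by
  set b := ht w (ev j) A with hb
  set a := pos w j A with ha
  set I' := (fun t => -a + t) ⁻¹' I with hI'
  have hI'c : I'.OrdConnected := hI.preimage_mono fun x y h => by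
    change -a + x ≤ -a + y; linarith
  have hdens : (volume.withDensity fun t =>
      ENNReal.ofReal (lenD w j b I' (linePt w j b t) (ev j))) = volume.restrict I' := by
    rw [← withDensity_indicator_one hI'c.measurableSet]
    refine withDensity_congr_ae ?_
    filter_upwards [ae_germR hI'c] with t ht
    rw [lenD_self (ht_linePt hw j b t), pos_linePt hw, ht]
  rw [lineMeas, hdens, lengthMeasure]
  have hshift : volume.restrict I' = Measure.map (fun t => a + t) (volume.restrict I) := by
    have := (measurableEmbedding_addLeft a).restrict_map (volume : Measure ℝ) I'
    rw [map_add_left_eq_self] at this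
    rw [this]
    congr 2
    ext t; simp [hI']
  rw [hshift, Measure.map_map (continuous_linePt w j b).measurable (by fun_prop)]
  congr 1
  ext1 t
  simp only [Function.comp]
  rw [linePt_add, hb, ha, linePt_pos hw, dir_ev]

lemma isRep_lengthMeasure (hw : IsUnitTriple w) (A : Plane) (j : Fin 3) {I : Set ℝ}
    (hI : I.OrdConnected) : ∃ D, IsRep w (lengthMeasure A (w j) I) D := by
  have hI'c : ((fun t => -pos w j A + t) ⁻¹' I).OrdConnected := hI.preimage_mono fun x y h => by
    change -pos w j A + x ≤ -pos w j A + y; linarith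
  rw [lengthMeasure_eq hw A j hI]
  set b := ht w (ev j) A
  set I' := (fun t => -pos w j A + t) ⁻¹' I
  refine ⟨lenD w j b I', isStep_lenD hw j b hI'c, fun A k => ?_, ⟨1, fun A k => ?_⟩,
    ⟨1, one_pos, fun A k h => ?_⟩, ⟨{(j, b)}, fun L hL => ?_⟩⟩
  · rcases lenD_zero_or_one (w := w) j b I' A k with h | h <;> rw [h]; exact zero_le_one
  · rcases lenD_zero_or_one (w := w) j b I' A k with h | h <;> rw [h]; exact zero_le_one
  · rw [(lenD_zero_or_one (w := w) j b I' A k).resolve_left h]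
  · rw [lineSum, Finset.sum_eq_single (j, b)]
    · rintro ⟨i, c⟩ _ hne
      have : (fun t => ENNReal.ofReal (lenD w j b I' (linePt w i c t) (ev i))) = 0 := by
        ext1 t
        by_cases h0 : lenD w j b I' (linePt w i c t) (ev i) = 0
        · rw [h0]; simp
        · exfalso
          obtain ⟨h1, h2⟩ := lenD_supp h0
          obtain rfl := ev_inj (Or.inl rfl) h1
          rw [ht_linePt hw] at h2
          exact hne (by rw [h2])
      simp only [lineMeas]
      rw [this]; simp
    · intro h
      exact absurd (hL (Finset.mem_singleton_self _)) h

lemma exists_isRep (hw : IsUnitTriple w) {μ : Measure Plane} (hμ : HasStepDensity w μ) :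
    ∃ D, IsRep w μ D := by
  obtain ⟨n, A, j, I, c, hI, rfl⟩ := hμ
  choose D hD using fun i => isRep_lengthMeasure hw (A i) (j i) (hI i)
  exact ⟨_, IsRep.sum hw Finset.univ fun i _ => (hD i).smul hw (c i)⟩

/-- The germ densities of a measure. For a measure with step density the limit in `density` exists,
by `IsRep.hasDens`. -/
def germ (w : Fin 3 → Plane) (μ : Measure Plane) (A : Plane) (k : ZMod 6) : ℝ :=
  density μ A (dir w k)

lemma IsRep.germ_eq (hw : IsUnitTriple w) {μ : Measure Plane} {D : Plane → ZMod 6 → ℝ}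
    (h : IsRep w μ D) : germ w μ = D := by
  ext A k; exact (h.hasDens hw A k).density_eq

lemma isRep_germ (hw : IsUnitTriple w) {μ : Measure Plane} (hμ : HasStepDensity w μ) :
    IsRep w μ (germ w μ) := by
  obtain ⟨D, hD⟩ := exists_isRep hw hμ
  rw [hD.germ_eq hw]; exact hD

lemma germ_lineSum (hw : IsUnitTriple w) {D : Plane → ZMod 6 → ℝ} (hD : IsStep w D)
    (hn : ∀ A k, 0 ≤ D A k) {L : Finset (Fin 3 × ℝ)} (hL : Carries w L D) :
    germ w (lineSum w L D) = D := by
  ext A k; exact (hasDens_lineSum hw hD hn hL A k).density_eq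

/-- A measure with step density is determined by its germ densities. -/
lemma eq_of_germ_eq (hw : IsUnitTriple w) {μ ν : Measure Plane} (hμ : HasStepDensity w μ)
    (hν : HasStepDensity w ν) (h : germ w μ = germ w ν) : μ = ν := by
  classical
  obtain ⟨L, hL⟩ := (isRep_germ hw hμ).eq
  obtain ⟨L', hL'⟩ := (isRep_germ hw hν).eq
  rw [hL (L ∪ L') Finset.subset_union_left, hL' (L ∪ L') Finset.subset_union_right, h]

/-! ### The support -/

lemma notMem_support_lineMeas (hw : IsUnitTriple w) {D : Plane → ZMod 6 → ℝ} (hD : IsStep w D)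
    {A : Plane} (hA : ∀ k, D A k = 0) (j : Fin 3) (b : ℝ) :
    A ∉ (lineMeas w D j b).support := by
  rw [Measure.notMem_support_iff_exists]
  by_cases hb : ht w (ev j) A = b
  swap
  · refine ⟨{p | ht w (ev j) p ≠ b}, (isOpen_ne_fun (ht_continuous w _)
      continuous_const).mem_nhds hb, ?_⟩
    rw [lineMeas_apply hw]
    have : linePt w j b ⁻¹' {p | ht w (ev j) p ≠ b} = ∅ := by
      ext t; simp [ht_linePt hw]
    rw [this]; simp
  have h1 := hD.loc A (ev j)
  have h2 := hD.loc A (ev j + 3)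
  rw [eventually_nhdsWithin_iff, Metric.eventually_nhds_iff] at h1 h2
  obtain ⟨ε₁, hε₁, h1⟩ := h1
  obtain ⟨ε₂, hε₂, h2⟩ := h2
  set a := pos w j A with ha
  have hAa : linePt w j b a = A := by rw [← hb]; exact linePt_pos hw j A
  refine ⟨pos w j ⁻¹' Metric.ball a (min ε₁ ε₂), (continuous_pos w j).continuousAt.preimage_mem_nhds
    (Metric.ball_mem_nhds _ (lt_min hε₁ hε₂)), ?_⟩
  rw [lineMeas_apply hw, setLIntegral_congr_fun (g := fun _ => 0), lintegral_zero]
  · exact ((continuous_pos w j).comp (continuous_linePt w j b)).measurable measurableSet_ball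
  intro t ht
  have hx : |t - a| < ε₁ ∧ |t - a| < ε₂ := by
    rw [mem_preimage, mem_preimage, pos_linePt hw, Metric.mem_ball, Real.dist_eq, lt_min_iff] at ht
    exact ht
  have : D (linePt w j b t) (ev j) = 0 := by
    rcases lt_trichotomy t a with h | h | h
    · have := (h2 (y := a - t) (by
        rw [Real.dist_eq, sub_zero, abs_sub_comm]; exact hx.2) (by simpa using h)).2
      rw [add_three_three, ← hAa, ← linePt_sub, sub_sub_cancel] at this
      rw [this, hAa, hA]
    · rw [h, hAa, hA]
    · have := (h1 (y := t - a) (by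
        rw [Real.dist_eq, sub_zero]; exact hx.1) (by simpa using h)).1
      rw [← hAa, ← linePt_add, add_sub_cancel] at this
      rw [this, hAa, hA]
  simp only [this, ENNReal.ofReal_zero]

lemma mem_support_iff_germ (hw : IsUnitTriple w) {μ : Measure Plane} (hμ : HasStepDensity w μ)
    (A : Plane) : A ∈ μ.support ↔ ∃ k, germ w μ A k ≠ 0 := by
  have hrep := isRep_germ hw hμ
  constructor
  · intro h
    by_contra! hz
    obtain ⟨L, hL⟩ := hrep.eq
    rw [hL L subset_rfl, lineSum] at h
    clear hL
    classical
    induction L using Finset.induction_on with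
    | empty => simp [Measure.support_zero] at h
    | insert p s hp ih =>
      rw [Finset.sum_insert hp, Measure.support_add] at h
      rcases h with h | h
      · exact notMem_support_lineMeas hw hrep.step hz _ _ h
      · exact ih h
  · rintro ⟨k, hk⟩
    rw [Measure.mem_support_iff_forall]
    intro U hU
    have hd := hrep.hasDens hw A k
    have hU' : ∀ᶠ s in 𝓝[>] (0 : ℝ), A + s • dir w k ∈ U := tendsto_ray w A k hU
    rw [eventually_nhdsWithin_iff, Metric.eventually_nhds_iff] at hU'
    obtain ⟨δ, hδ, hU'⟩ := hU'
    obtain ⟨ε, ⟨h1, h2⟩⟩ := (hd.2.and (Ioo_mem_nhdsGT hδ)).exists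
    have hsub : shortSegment A (dir w k) ε ⊆ U := by
      rintro _ ⟨t, ht0, ht1, rfl⟩
      refine hU' (y := t) ?_ ht0
      rw [Real.dist_eq, sub_zero, abs_of_pos ht0]; linarith [h2.2]
    refine lt_of_lt_of_le ?_ (measure_mono hsub)
    rw [h1, ENNReal.ofReal_pos]
    exact mul_pos (lt_of_le_of_ne hd.1 (Ne.symm hk)) h2.1

end

section

variable {w : Fin 3 → Plane}

/-! ### The cones in terms of germ densities -/

lemma densityPos_eq (μ : Measure Plane) (j : Fin 3) (A : Plane) :
    densityPos w μ j A = germ w μ A (ev j) := by rw [densityPos, germ, dir_ev]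

lemma densityNeg_eq (μ : Measure Plane) (j : Fin 3) (A : Plane) :
    densityNeg w μ j A = germ w μ A (ev j + 3) := by rw [densityNeg, germ, dir_ev_add_three]

lemma ev_add_one (j : Fin 3) : ev (j + 1) = ev j + 2 ∧ ev (j + 1) + 3 = ev j + 5 := by
  revert j; decide

lemma mem_cone_iff (μ : Measure Plane) :
    μ ∈ cone w ↔ HasStepDensity w μ ∧ IsBalanced (germ w μ) := by
  refine and_congr_right fun _ => ?_
  simp only [densityPos_eq, densityNeg_eq]
  constructor
  · intro h A k
    obtain ⟨j, rfl | rfl⟩ := ev_or k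
    · have := h A j (j + 1)
      rwa [(ev_add_one j).1, add_assoc (ev j) 2 3] at this
    · have := h A j (j + 1)
      have e1 : ∀ j, ev j + 3 + 2 = ev (j + 1) + 3 := by decide
      have e2 : ∀ j, ev j + 3 + 5 = ev (j + 1) := by decide
      rw [e1, e2, add_three_three]; linarith
  · intro h A i j
    have step : ∀ j, germ w μ A (ev j) - germ w μ A (ev j + 3) =
        germ w μ A (ev (j + 1)) - germ w μ A (ev (j + 1) + 3) := by
      intro j
      rw [(ev_add_one j).2, (ev_add_one j).1]; exact h A (ev j)
    have hij : ∀ i j : Fin 3, j = i ∨ j = i + 1 ∨ j = i + 1 + 1 := by decide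
    rcases hij i j with rfl | rfl | rfl
    · rfl
    · exact step i
    · exact (step i).trans (step _)

lemma isBranchPoint_iff (μ : Measure Plane) (A : Plane) : IsBranchPoint w μ A ↔
    3 ≤ (Finset.univ.filter fun k : ZMod 6 => germ w μ A k ≠ 0).card := by
  classical
  rw [IsBranchPoint]
  simp only [densityPos_eq, densityNeg_eq, Set.ncard_eq_toFinset_card', Set.toFinset_ofPred,
    Finset.card_filter, Fin.sum_univ_three]
  rw [show (∑ k : ZMod 6, if germ w μ A k ≠ 0 then 1 else 0) =
    (if germ w μ A 0 ≠ 0 then 1 else 0) + (if germ w μ A 1 ≠ 0 then 1 else 0) +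
    (if germ w μ A 2 ≠ 0 then 1 else 0) + (if germ w μ A 3 ≠ 0 then 1 else 0) +
    (if germ w μ A 4 ≠ 0 then 1 else 0) + (if germ w μ A 5 ≠ 0 then 1 else 0) from
    Fin.sum_univ_six _]
  rw [show ev 0 = 0 from rfl, show ev 1 = 2 from rfl, show ev 2 = 4 from rfl,
    show (0 : ZMod 6) + 3 = 3 from rfl, show (2 : ZMod 6) + 3 = 5 from rfl,
    show (4 : ZMod 6) + 3 = 1 from rfl]
  refine iff_of_eq (congrArg _ ?_)
  ring

/-- The properties of the germ density of a measure in `𝓜_r`. Outside the triangle,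
the nonzero germs lie on half-lines which leave the triangle. -/
structure InTriangle (w : Fin 3 → Plane) (r : ℝ) (D : Plane → ZMod 6 → ℝ) : Prop where
  step : IsStep w D
  nonneg : ∀ A k, 0 ≤ D A k
  balanced : IsBalanced D
  nonBranch : ∀ A, A ∉ triangle w r → NonBranch D A
  exits : ∀ A k, A ∉ triangle w r → D A k ≠ 0 → ∃ (j : Fin 3) (P : Plane) (t : ℝ),
    P ∈ triangle w r ∧ (∀ s : ℝ, 0 < s → P + s • w j ∉ triangle w r) ∧ 0 < t ∧
      A = P + t • w j ∧ (k = ev j ∨ k = ev j + 3)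

lemma inTriangle_germ (hw : IsUnitTriple w) {r : ℝ} (hr : 0 < r) {μ : Measure Plane}
    (hμ : μ ∈ coneIn w r) : InTriangle w r (germ w μ) := by
  obtain ⟨hcone, hbr, H, hH, hfr, hsupp⟩ := hμ
  obtain ⟨hsd, hbal⟩ := (mem_cone_iff μ).1 hcone
  have hrep := isRep_germ hw hsd
  refine ⟨hrep.step, hrep.nonneg, hbal, fun A hA => ?_, fun A k hA hk => ?_⟩
  · refine nonBranch_of_card hbal hrep.nonneg ?_
    by_contra h
    exact hA (hbr A ((isBranchPoint_iff μ A).2 (not_lt.1 h)))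
  have h1 : ∀ᶠ s in 𝓝[>] (0 : ℝ), A + s • dir w k ∉ triangle w r :=
    tendsto_ray w A k ((isClosed_triangle hw hr).isOpen_compl.mem_nhds hA)
  have h2 : ∀ᶠ s in 𝓝[>] (0 : ℝ), ∃ p ∈ H, A + s • dir w k ∈ halfLine p.2 (w p.1) := by
    filter_upwards [h1, hrep.step.loc A k] with s hs1 hs2
    have : A + s • dir w k ∈ μ.support \ triangle w r := by
      refine ⟨(mem_support_iff_germ hw hsd _).2 ⟨k, ?_⟩, hs1⟩
      rw [hs2.1]; exact hk
    rw [hsupp] at this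
    simpa using this
  -- one of the finitely many half-lines contains points of the germ arbitrarily close to `A`
  obtain ⟨p, hp, hfreq⟩ : ∃ p ∈ H, ∃ᶠ s in 𝓝[>] (0 : ℝ),
      A + s • dir w k ∈ halfLine p.2 (w p.1) := by
    by_contra! hc
    have hc' : ∀ p ∈ H, ∀ᶠ s in 𝓝[>] (0 : ℝ), A + s • dir w k ∉ halfLine p.2 (w p.1) :=
      hc
    rw [← Filter.eventually_all_finite hH] at hc'
    obtain ⟨s, ⟨q, hq, hs⟩, hs'⟩ := (h2.and hc').exists
    exact hs' q hq hs
  obtain ⟨j, P⟩ := p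
  have hP : P ∈ triangle w r := frontier_subset_triangle hw hr (hfr _ hp)
  have hleave : ∀ s : ℝ, 0 < s → P + s • w j ∉ triangle w r := by
    intro s hs
    have : P + s • w j ∈ μ.support \ triangle w r := by
      rw [hsupp]
      exact mem_iUnion₂.2 ⟨(j, P), hp, s, hs, rfl⟩
    exact this.2
  have hk' : k = ev j ∨ k = ev j + 3 := by
    by_contra! hne
    have hne0 := ht_dir_ne_zero hw hne.1 hne.2
    have hsub : {s : ℝ | ht w (ev j) (A + s • dir w k) = ht w (ev j) P}.Subsingleton := by
      intro s hs s' hs'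
      have hs : ht w (ev j) (A + s • dir w k) = ht w (ev j) P := hs
      have hs' : ht w (ev j) (A + s' • dir w k) = ht w (ev j) P := hs'
      rw [ht_smul_add] at hs hs'
      exact mul_right_cancel₀ hne0 (by linarith)
    obtain ⟨s, hs, hs'⟩ := (hfreq.and_eventually
      (eventually_notMem_of_finite hsub.finite)).exists
    apply hs'
    obtain ⟨t, -, hst⟩ := hs
    change ht w (ev j) _ = _
    rw [hst, ← dir_ev w j, ht_along]
  have hline : ∃ t : ℝ, A = P + t • w j := by
    obtain ⟨s, t, -, hs⟩ := hfreq.exists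
    simp only at hs
    rcases hk' with rfl | rfl
    · rw [dir_ev] at hs
      exact ⟨t - s, by rw [sub_smul, ← add_sub_assoc, ← hs]; abel⟩
    · rw [dir_ev_add_three] at hs
      exact ⟨t + s, by rw [add_smul, ← add_assoc, ← hs, smul_neg]; abel⟩
  obtain ⟨t, rfl⟩ := hline
  refine ⟨j, P, t, hP, hleave, ?_, rfl, hk'⟩
  by_contra ht0
  rcases eq_or_lt_of_le (not_lt.1 ht0) with h0 | h0
  · rw [h0, zero_smul, add_zero] at hA; exact hA hP
  obtain ⟨s, ⟨t', ht', hs⟩, hs1⟩ := (hfreq.and_eventually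
    (Ioo_mem_nhdsGT (show 0 < -t by linarith))).exists
  simp only at hs
  have hinj : ∀ x : ℝ, P + x • w j = P + t' • w j → x = t' := by
    intro x hx
    rw [← dir_ev w j] at hx
    exact smul_dir_inj hw hx
  rcases hk' with rfl | rfl
  · rw [dir_ev, add_assoc, ← add_smul] at hs
    have := hinj _ hs
    linarith [hs1.2]
  · rw [dir_ev_add_three, smul_neg, ← neg_smul, add_assoc, ← add_smul] at hs
    have := hinj _ hs
    linarith [hs1.1]

/-- A compactly supported balanced step function which is nonnegative off the support of `D`
vanishes outside the triangle: beyond a side of the triangle, the lowest of its jumps cannot be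
balanced. -/
lemma InTriangle.confine (hw : IsUnitTriple w) {r : ℝ} (hr : 0 < r)
    {D δ : Plane → ZMod 6 → ℝ} (hD : InTriangle w r D) (hδ : IsStep w δ) (hb : IsBalanced δ)
    {R : ℝ} (hR : ∀ A k, δ A k ≠ 0 → ‖A‖ ≤ R) (hs : ∀ A k, D A k = 0 → 0 ≤ δ A k)
    (A : Plane) (hA : A ∉ triangle w r) (k : ZMod 6) : δ A k = 0 := by
  classical
  rw [mem_triangle_iff' hw hr] at hA
  push Not at hA
  obtain ⟨i, hi⟩ := hA
  set e := ev i with he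
  -- below the side, the support of `D` consists of half-lines in one direction
  have hdirs : ∀ B k, ht w e B < bnd r e → D B k ≠ 0 → k = e + 4 ∨ k = e + 1 := by
    intro B k hB hk
    have hBt : B ∉ triangle w r := fun h => by
      have := (mem_triangle_iff' hw hr B).1 h i
      linarith
    obtain ⟨j, P, t, hP, -, ht, rfl, hkj⟩ := hD.exits B k hBt hk
    have hP' := (mem_triangle_iff' hw hr P).1 hP i
    rw [← dir_ev w j, ht_smul_add] at hB
    have hl : ∀ i j, ev j = ev i ∨ ev j = ev i + 2 ∨ ev j = ev i + 4 := by decide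
    rcases hl i j with h | h | h
    · rw [h, ← he, ht_dir] at hB; linarith
    · rw [h, ← he, ht_dir_two hw] at hB; linarith
    · rw [h] at hkj
      rcases hkj with h | h
      · exact Or.inl h
      · right; rw [h, add_assoc]; congr 1
  have hsign : ∀ B k, ht w e B < bnd r e → k ≠ e + 4 → k ≠ e + 1 → 0 ≤ δ B k := by
    intro B k hB h1 h2
    refine hs B k ?_
    by_contra h
    rcases hdirs B k hB h with h | h
    · exact h1 h
    · exact h2 h
  set N := hδ.jumps.toFinset.filter fun B => ht w e B < bnd r e with hN
  have hNmem : ∀ B, ht w e B < bnd r e → B ∉ N → ∀ k, δ B k = δ B (k + 3) := by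
    intro B hB hBN k
    by_contra h
    apply hBN
    rw [hN, Finset.mem_filter, Set.Finite.mem_toFinset]
    exact ⟨⟨k, h⟩, hB⟩
  -- Otherwise there is a lowest jump, with respect to `ht w e`, and among these one which is
  -- extreme in direction `dir w e`. The three rays into the jump-free region carry nothing, and
  -- the remaining germs cannot be balanced.
  have hempty : N = ∅ := by
    by_contra hne
    obtain ⟨B₀, hB₀, hmin⟩ := N.exists_min_image (ht w e) (Finset.nonempty_iff_ne_empty.2 hne)
    obtain ⟨B, hB, hmax⟩ := (N.filter fun B => ht w e B = ht w e B₀).exists_max_image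
      (fun B => -ht w (e + 1) B) ⟨B₀, by simp [hB₀]⟩
    rw [Finset.mem_filter] at hB
    have hBlow : ht w e B < bnd r e := (Finset.mem_filter.1 hB.1).2
    have down : ∀ k, ht w e (dir w k) = -1 → δ B k = 0 := by
      intro k hk
      refine hδ.eq_zero_of_ray hw hR fun s hs0 => ?_
      have hlow : ht w e (B + s • dir w k) < ht w e B := by
        rw [ht_smul_add, hk]; linarith
      refine hNmem _ (hlow.trans hBlow) (fun hmem => ?_) k
      have := hmin _ hmem
      rw [hB.2] at hlow
      linarith
    have d4 := down (e + 4) (ht_dir_four hw e)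
    have d5 := down (e + 5) (ht_dir_five hw e)
    have d0 : δ B e = 0 := by
      refine hδ.eq_zero_of_ray hw hR fun s hs0 => ?_
      have hsame : ht w e (B + s • dir w e) = ht w e B := ht_along w e B s
      refine hNmem _ (by rw [hsame]; exact hBlow) (fun hmem => ?_) e
      have := hmax _ (Finset.mem_filter.2 ⟨hmem, hsame.trans hB.2⟩)
      have h5 : ht w (e + 1) (dir w e) = -1 := by
        have h := ht_dir_five hw (e + 1)
        rwa [show e + 1 + 5 = e by rw [add_assoc]; exact add_zero e] at h
      simp only [ht_smul_add, h5] at this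
      linarith
    have n2 : 0 ≤ δ B (e + 2) := hsign B _ hBlow (by simp; decide) (by simp; decide)
    have n3 : 0 ≤ δ B (e + 3) := hsign B _ hBlow (by simp; decide) (by simp; decide)
    have b0 := hb B e
    have b1 := hb.four B e
    rw [d0, d5] at b0
    rw [d0, d4] at b1
    have z3 : δ B (e + 3) = 0 := by linarith
    have z2 : δ B (e + 2) = 0 := by linarith
    have z1 : δ B (e + 1) = 0 := by linarith
    have hall : ∀ k, δ B k = 0 := forall_dir_index e d0 z1 z2 z3 d4 d5
    have hBj := (Finset.mem_filter.1 hB.1).1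
    rw [Set.Finite.mem_toFinset] at hBj
    obtain ⟨k, hk⟩ := hBj
    exact hk (by rw [hall, hall])
  have hnoj : ∀ B, ht w e B < bnd r e → ∀ k, δ B k = δ B (k + 3) := fun B hB =>
    hNmem B hB (by rw [hempty]; exact Finset.notMem_empty _)
  have ray : ∀ k, ht w e (dir w k) ≤ 0 → δ A k = 0 := by
    intro k hk
    refine hδ.eq_zero_of_ray hw hR fun s hs0 => hnoj _ ?_ k
    rw [ht_smul_add]
    nlinarith
  refine forall_dir_index (P := fun k => δ A k = 0) e ?_ ?_ ?_ ?_ ?_ ?_ k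
  · exact ray _ (ht_dir w e).le
  · rw [hnoj A hi, show e + 1 + 3 = e + 4 by ring]
    exact ray _ (by rw [ht_dir_four hw]; norm_num)
  · rw [hnoj A hi, show e + 2 + 3 = e + 5 by ring]
    exact ray _ (by rw [ht_dir_five hw]; norm_num)
  · exact ray _ (ht_dir_three w e).le
  · exact ray _ (by rw [ht_dir_four hw]; norm_num)
  · exact ray _ (by rw [ht_dir_five hw]; norm_num)

/-- The infinitesimal form of rigidity: no nonzero balanced step function which vanishes outside
the triangle is nonnegative off the support of `μ`. Otherwise a small multiple of it could be
added to `μ`. -/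
lemma IsRigid.eq_zero (hw : IsUnitTriple w) {r : ℝ} {μ : Measure Plane}
    (hμ : IsRigid w r μ) {δ : Plane → ZMod 6 → ℝ} (hδ : IsStep w δ) (hb : IsBalanced δ)
    {C : ℝ} (hC : ∀ A k, -C ≤ δ A k) (hs : ∀ A k, germ w μ A k = 0 → 0 ≤ δ A k)
    (hout : ∀ A, A ∉ triangle w r → ∀ k, δ A k = 0) (A : Plane) (k : ZMod 6) : δ A k = 0 := by
  obtain ⟨⟨hcone, hbr, H, hH, hfr, hsupp⟩, hrig⟩ := hμ
  obtain ⟨hsd, hbal⟩ := (mem_cone_iff μ).1 hcone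
  have hrep := isRep_germ hw hsd
  obtain ⟨ε, hε, hlow⟩ := hrep.low
  -- `ε` bounds the nonzero densities of `μ` from below, so `μ + t δ` stays nonnegative
  set t := ε / (|C| + 1) with ht
  have ht0 : 0 < t := by positivity
  set E : Plane → ZMod 6 → ℝ := fun A k => germ w μ A k + t * δ A k with hE
  have hEn : ∀ A k, 0 ≤ E A k := by
    intro A k
    by_cases h : germ w μ A k = 0
    · simp only [hE, h, zero_add]
      exact mul_nonneg ht0.le (hs A k h)
    · have h1 := hlow A k h
      have h2 : t * (|C| + 1) = ε := by rw [ht]; field_simp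
      have h3 : -(|C| + 1) ≤ δ A k := by linarith [hC A k, le_abs_self C]
      have h4 := mul_le_mul_of_nonneg_left h3 ht0.le
      simp only [hE]
      linarith
  have hEstep : IsStep w E := hrep.step.add (hδ.smul t)
  obtain ⟨L, hL⟩ := hEstep.exists_carries
  set ν := lineSum w L E with hν
  have hνsd : HasStepDensity w ν := hasStepDensity_lineSum hw hEstep L
  have hνg : germ w ν = E := germ_lineSum hw hEstep hEn hL
  have hsame : ∀ A, A ∉ triangle w r → ∀ k, germ w ν A k = germ w μ A k := by
    intro A hA k
    rw [hνg]; simp only [hE]; rw [hout A hA, mul_zero, add_zero]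
  have hsuppeq : ν.support \ triangle w r = μ.support \ triangle w r := by
    ext B
    rw [Set.mem_sdiff, Set.mem_sdiff]
    refine and_congr_left fun hB => ?_
    rw [mem_support_iff_germ hw hνsd, mem_support_iff_germ hw hsd]
    simp only [hsame B hB]
  have hνin : ν ∈ coneIn w r := by
    refine ⟨(mem_cone_iff ν).2 ⟨hνsd, ?_⟩, fun B hB => ?_, H, hH, hfr, ?_⟩
    · rw [hνg]; exact hbal.add (hb.smul t)
    · by_contra hBt
      refine hBt (hbr B ?_)
      rw [isBranchPoint_iff] at hB ⊢
      simpa only [hsame B hBt] using hB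
    · rw [hsuppeq, hsupp]
  have hexit : exitPoints w r ν = exitPoints w r μ := by
    simp only [exitPoints, hsuppeq]
  have heq := hrig ν hνin hexit (by
    rintro ⟨j, P⟩ ⟨-, hp⟩
    simp only [exitDensity, densityPos_eq]
    obtain ⟨s, h1, h2⟩ := ((hδ.loc P (ev j)).and self_mem_nhdsWithin).exists
    have hPs : P + s • w j ∉ triangle w r := (hp ⟨s, h2, rfl⟩).2
    rw [dir_ev] at h1
    rw [hνg]
    simp only [hE]
    rw [← h1.1, hout _ hPs, mul_zero, add_zero])
  have : E A k = germ w μ A k := by rw [← hνg, heq]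
  simp only [hE] at this
  have h0 : t * δ A k = 0 := by linarith
  exact (mul_eq_zero.1 h0).resolve_left ht0.ne'

end

section

variable {w : Fin 3 → Plane}

/-! ### Segments and their boundaries -/

/-- The germ density of the length measure of the segment from `P` to `P + l • dir w k`. -/
def segD (w : Fin 3 → Plane) (P : Plane) (k : ZMod 6) (l : ℝ) (A : Plane) (i : ZMod 6) : ℝ :=
  open Classical in
  if (i = k ∧ ∃ s : ℝ, 0 ≤ s ∧ s < l ∧ A = P + s • dir w k) ∨
    (i = k + 3 ∧ ∃ s : ℝ, 0 < s ∧ s ≤ l ∧ A = P + s • dir w k) then 1 else 0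

lemma add_three_ne (k : ZMod 6) : k + 3 ≠ k := by revert k; decide

lemma segD_self (hw : IsUnitTriple w) (P : Plane) (k : ZMod 6) (l s : ℝ) :
    segD w P k l (P + s • dir w k) k = if 0 ≤ s ∧ s < l then 1 else 0 := by
  unfold segD
  congr 1
  refine propext ⟨?_, fun h => Or.inl ⟨rfl, s, h.1, h.2, rfl⟩⟩
  rintro (⟨-, s', h1, h2, h3⟩ | ⟨h, -⟩)
  · rw [smul_dir_inj hw h3]; exact ⟨h1, h2⟩
  · exact absurd h.symm (add_three_ne k)

lemma segD_opp (hw : IsUnitTriple w) (P : Plane) (k : ZMod 6) (l s : ℝ) :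
    segD w P k l (P + s • dir w k) (k + 3) = if 0 < s ∧ s ≤ l then 1 else 0 := by
  unfold segD
  congr 1
  refine propext ⟨?_, fun h => Or.inr ⟨rfl, s, h.1, h.2, rfl⟩⟩
  rintro (⟨h, -⟩ | ⟨-, s', h1, h2, h3⟩)
  · exact absurd h (add_three_ne k)
  · rw [smul_dir_inj hw h3]; exact ⟨h1, h2⟩

lemma segD_other {P : Plane} {k : ZMod 6} {l : ℝ} {i : ZMod 6} (h : i ≠ k) (h' : i ≠ k + 3)
    (A : Plane) : segD w P k l A i = 0 := by
  unfold segD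
  rw [if_neg]
  rintro (⟨h1, -⟩ | ⟨h1, -⟩)
  · exact h h1
  · exact h' h1

lemma segD_off {P : Plane} {k : ZMod 6} {l : ℝ} {A : Plane} (h : ∀ s : ℝ, A ≠ P + s • dir w k)
    (i : ZMod 6) : segD w P k l A i = 0 := by
  unfold segD
  rw [if_neg]
  rintro (⟨-, s, -, -, h1⟩ | ⟨-, s, -, -, h1⟩) <;> exact h s h1

lemma segD_nonneg (P : Plane) (k : ZMod 6) (l : ℝ) (A : Plane) (i : ZMod 6) :
    0 ≤ segD w P k l A i := by
  unfold segD; split_ifs; exacts [zero_le_one, le_rfl]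

lemma segD_le_one (P : Plane) (k : ZMod 6) (l : ℝ) (A : Plane) (i : ZMod 6) :
    segD w P k l A i ≤ 1 := by
  unfold segD; split_ifs; exacts [le_rfl, zero_le_one]

lemma segD_supp {P : Plane} {k : ZMod 6} {l : ℝ} {A : Plane} {i : ZMod 6}
    (h : segD w P k l A i ≠ 0) :
    (i = k ∧ ∃ s : ℝ, 0 ≤ s ∧ s < l ∧ A = P + s • dir w k) ∨
      (i = k + 3 ∧ ∃ s : ℝ, 0 < s ∧ s ≤ l ∧ A = P + s • dir w k) := by
  unfold segD at h; by_contra hc; exact h (if_neg hc)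

lemma isStep_segD (hw : IsUnitTriple w) (P : Plane) (k : ZMod 6) (l : ℝ) :
    IsStep w (segD w P k l) := by
  refine ⟨fun A i => ?_, fun i => ?_, ?_⟩
  · by_cases hA : ∃ s : ℝ, A = P + s • dir w k
    · obtain ⟨s, rfl⟩ := hA
      by_cases h1 : i = k
      · subst h1
        have hev : ∀ᶠ u in 𝓝[>] (0 : ℝ), (s < 0 → u < -s) ∧ (s < l → u < l - s) := by
          refine (eventually_imp_distrib_left.2 fun h => ?_).and
            (eventually_imp_distrib_left.2 fun h => ?_)
          · exact eventually_nhdsWithin_of_eventually_nhds (eventually_lt_nhds (by linarith))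
          · exact eventually_nhdsWithin_of_eventually_nhds (eventually_lt_nhds (by linarith))
        filter_upwards [hev, self_mem_nhdsWithin] with u hu h0
        have h0 : 0 < u := h0
        rw [ray_ray, segD_self hw, segD_opp hw, segD_self hw]
        constructor
        · congr 1
          refine propext ⟨fun h => ⟨?_, by linarith [h.2]⟩, fun h => ⟨by linarith [h.1], ?_⟩⟩
          · by_contra hs; have := hu.1 (not_le.1 hs); linarith [h.1]
          · have := hu.2 h.2; linarith
        · congr 1
          refine propext ⟨fun h => ⟨?_, by linarith [h.2]⟩, fun h => ⟨by linarith [h.1], ?_⟩⟩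
          · by_contra hs; have := hu.1 (not_le.1 hs); linarith [h.1]
          · have := hu.2 h.2; linarith
      by_cases h2 : i = k + 3
      · subst h2
        have hev : ∀ᶠ u in 𝓝[>] (0 : ℝ), (0 < s → u < s) ∧ (l < s → u < s - l) := by
          refine (eventually_imp_distrib_left.2 fun h => ?_).and
            (eventually_imp_distrib_left.2 fun h => ?_)
          · exact eventually_nhdsWithin_of_eventually_nhds (eventually_lt_nhds h)
          · exact eventually_nhdsWithin_of_eventually_nhds (eventually_lt_nhds (by linarith))
        filter_upwards [hev, self_mem_nhdsWithin] with u hu h0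
        have h0 : 0 < u := h0
        rw [ray_back, add_three_three, segD_self hw, segD_opp hw, segD_opp hw]
        constructor
        · congr 1
          refine propext ⟨fun h => ⟨by linarith [h.1], ?_⟩, fun h => ⟨?_, by linarith [h.2]⟩⟩
          · by_contra hs; have := hu.2 (not_le.1 hs); linarith [h.2]
          · have := hu.1 h.1; linarith
        · congr 1
          refine propext ⟨fun h => ⟨by linarith [h.1], ?_⟩, fun h => ⟨?_, by linarith [h.2]⟩⟩
          · by_contra hs; have := hu.2 (not_le.1 hs); linarith [h.2]
          · have := hu.1 h.1; linarith
      · refine Eventually.of_forall fun u => ?_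
        have h3 : i + 3 ≠ k := fun h => h2 (by rw [← h, add_three_three])
        have h4 : i + 3 ≠ k + 3 := fun h => h1 (add_right_cancel h)
        rw [segD_other h1 h2, segD_other h1 h2, segD_other h3 h4]
        exact ⟨rfl, rfl⟩
    · push Not at hA
      refine Eventually.of_forall fun u => ?_
      by_cases h1 : i = k ∨ i = k + 3
      · have hoff : ∀ s : ℝ, A + u • dir w i ≠ P + s • dir w k := by
          intro s hs
          rcases h1 with rfl | rfl
          · refine hA (s - u) ?_
            rw [sub_smul, ← add_sub_assoc, ← hs]; abel
          · refine hA (s + u) ?_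
            rw [add_smul, ← add_assoc, ← hs, dir_add_three, smul_neg]; abel
        rw [segD_off hA, segD_off hoff, segD_off hoff]
        exact ⟨rfl, rfl⟩
      · push Not at h1
        have h3 : i + 3 ≠ k := fun h => h1.2 (by rw [← h, add_three_three])
        have h4 : i + 3 ≠ k + 3 := fun h => h1.1 (add_right_cancel h)
        rw [segD_other h1.1 h1.2, segD_other h1.1 h1.2, segD_other h3 h4]
        exact ⟨rfl, rfl⟩
  · refine (Set.toFinite {ht w k P, -ht w k P}).subset ?_
    rintro _ ⟨A, hA, rfl⟩
    rcases segD_supp hA with ⟨rfl, s, -, -, rfl⟩ | ⟨rfl, s, -, -, rfl⟩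
    · left; exact ht_along w _ P s
    · right; rw [ht_add_three, ht_along]; rfl
  · refine (Set.toFinite {P, P + l • dir w k}).subset ?_
    rintro A ⟨i, hi⟩
    by_cases hA : ∃ s : ℝ, A = P + s • dir w k
    · obtain ⟨s, rfl⟩ := hA
      have key : (if 0 ≤ s ∧ s < l then (1 : ℝ) else 0) ≠ (if 0 < s ∧ s ≤ l then 1 else 0) := by
        by_cases h1 : i = k
        · subst h1; rwa [segD_self hw, segD_opp hw] at hi
        by_cases h2 : i = k + 3
        · subst h2; rw [add_three_three, segD_self hw, segD_opp hw] at hi; exact hi.symm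
        have h3 : i + 3 ≠ k := fun h => h2 (by rw [← h, add_three_three])
        have h4 : i + 3 ≠ k + 3 := fun h => h1 (add_right_cancel h)
        rw [segD_other h1 h2, segD_other h3 h4] at hi
        exact absurd rfl hi
      by_cases h0 : s = 0
      · left; rw [h0]; simp
      by_cases h1 : s = l
      · right; rw [h1]; rfl
      exfalso; apply key
      congr 1
      exact propext ⟨fun h => ⟨lt_of_le_of_ne h.1 (Ne.symm h0), h.2.le⟩,
        fun h => ⟨h.1.le, lt_of_le_of_ne h.2 h1⟩⟩
    · push Not at hA
      rw [segD_off hA, segD_off hA] at hi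
      exact absurd rfl hi

/-- The vector `v` placed at the point `P`. -/
def pt (P : Plane) : Plane →ₗ[ℝ] (Plane → Plane) :=
  open Classical in LinearMap.single ℝ (fun _ : Plane => Plane) P

lemma pt_self (P v : Plane) : pt P v P = v := by
  classical
  simp [pt]

lemma pt_ne {P A : Plane} (v : Plane) (h : A ≠ P) : pt P v A = 0 := by
  classical
  simp [pt, h]

/-- The boundary of a function on germs: at each point, the sum of its germs as vectors. It
vanishes exactly at the balanced points. -/
def bd (w : Fin 3 → Plane) (D : Plane → ZMod 6 → ℝ) (A : Plane) : Plane :=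
  ∑ k, D A k • dir w k

lemma sum_six {M : Type*} [AddCommMonoid M] (f : ZMod 6 → M) (k : ZMod 6) :
    ∑ i, f i = f k + f (k + 1) + f (k + 2) + f (k + 3) + f (k + 4) + f (k + 5) := by
  rw [← Equiv.sum_comp (Equiv.addLeft k) f]
  have := Fin.sum_univ_six (fun i : Fin 6 => f (Equiv.addLeft k i))
  refine this.trans ?_
  change f (k + 0) + _ + _ + _ + _ + _ = _
  rw [add_zero]; rfl

lemma bd_add (D E : Plane → ZMod 6 → ℝ) :
    bd w (fun A k => D A k + E A k) = bd w D + bd w E := by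
  ext1 A
  simp only [bd, Pi.add_apply, add_smul, Finset.sum_add_distrib]

lemma bd_neg (D : Plane → ZMod 6 → ℝ) : bd w (fun A k => -D A k) = -bd w D := by
  ext1 A
  simp only [bd, Pi.neg_apply, neg_smul, Finset.sum_neg_distrib]

lemma isBalanced_of_bd (hw : IsUnitTriple w) {D : Plane → ZMod 6 → ℝ} (h : bd w D = 0) :
    IsBalanced D := by
  intro A k
  have h1 := congrArg (ht w (k + 4)) (congrFun h A)
  rw [bd, sum_six _ (k + 4)] at h1
  simp only [map_add, map_smul, smul_eq_mul, ht_dir, ht_dir_one hw, ht_dir_two hw, ht_dir_three,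
    ht_dir_four hw, ht_dir_five hw, Pi.zero_apply, map_zero] at h1
  have e : ∀ k : ZMod 6, k + 4 + 1 = k + 5 ∧ k + 4 + 2 = k ∧ k + 4 + 4 = k + 2 ∧
    k + 4 + 5 = k + 3 := by decide
  rw [(e k).1, (e k).2.1, (e k).2.2.1, (e k).2.2.2] at h1
  linarith

lemma bd_segD (hw : IsUnitTriple w) (P : Plane) (k : ZMod 6) {l : ℝ} (hl : 0 < l) :
    bd w (segD w P k l) = pt P (dir w k) - pt (P + l • dir w k) (dir w k) := by
  ext1 A
  have e : ∀ k : ZMod 6, k + 1 ≠ k ∧ k + 1 ≠ k + 3 ∧ k + 2 ≠ k ∧ k + 2 ≠ k + 3 ∧ k + 4 ≠ k ∧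
    k + 4 ≠ k + 3 ∧ k + 5 ≠ k ∧ k + 5 ≠ k + 3 := by decide
  obtain ⟨e1, e2, e3, e4, e5, e6, e7, e8⟩ := e k
  rw [bd, sum_six _ k, segD_other e1 e2, segD_other e3 e4, segD_other e5 e6, segD_other e7 e8]
  simp only [zero_smul, add_zero, Pi.sub_apply]
  by_cases hA : ∃ s : ℝ, A = P + s • dir w k
  · obtain ⟨s, rfl⟩ := hA
    rw [segD_self hw, segD_opp hw, dir_add_three]
    by_cases h0 : s = 0
    · subst h0
      have hP : P + (0 : ℝ) • dir w k = P := by simp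
      rw [hP, if_pos ⟨le_rfl, hl⟩, if_neg (by simp), pt_self, pt_ne]
      · simp
      · exact (add_smul_dir_ne hw P k hl.ne').symm
    by_cases h1 : s = l
    · subst h1
      rw [if_neg (by simp), if_pos ⟨hl, le_rfl⟩, pt_self, pt_ne]
      · simp
      · exact add_smul_dir_ne hw P k hl.ne'
    rw [pt_ne _ (add_smul_dir_ne hw P k h0), pt_ne _ fun h => h1 (smul_dir_inj hw h)]
    by_cases h : 0 ≤ s ∧ s < l
    · rw [if_pos h, if_pos ⟨lt_of_le_of_ne h.1 (Ne.symm h0), h.2.le⟩]; simp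
    · rw [if_neg h, if_neg fun h' => h ⟨h'.1.le, lt_of_le_of_ne h'.2 h1⟩]; simp
  · push Not at hA
    rw [segD_off hA, segD_off hA, pt_ne, pt_ne]
    · simp
    · exact hA l
    · intro h; exact hA 0 (by rw [h]; simp)

/-! ### Perturbations of a germ density -/

/-- A compactly supported step function which can be added to `D` in a small multiple without
destroying nonnegativity. -/
structure IsPerturbation (w : Fin 3 → Plane) (D δ : Plane → ZMod 6 → ℝ) : Prop where
  step : IsStep w δ
  lower : ∃ C, ∀ A k, -C ≤ δ A k
  supp : ∃ R, ∀ A k, δ A k ≠ 0 → ‖A‖ ≤ R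
  sign : ∀ A k, D A k = 0 → 0 ≤ δ A k

lemma IsPerturbation.add {D δ ε : Plane → ZMod 6 → ℝ} (h : IsPerturbation w D δ)
    (h' : IsPerturbation w D ε) : IsPerturbation w D (fun A k => δ A k + ε A k) := by
  obtain ⟨C, hC⟩ := h.lower
  obtain ⟨C', hC'⟩ := h'.lower
  obtain ⟨R, hR⟩ := h.supp
  obtain ⟨R', hR'⟩ := h'.supp
  refine ⟨h.step.add h'.step, ⟨C + C', fun A k => ?_⟩, ⟨max R R', fun A k hne => ?_⟩,
    fun A k h0 => add_nonneg (h.sign A k h0) (h'.sign A k h0)⟩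
  · linarith [hC A k, hC' A k]
  · by_cases hz : δ A k = 0
    · rw [hz, zero_add] at hne; exact (hR' A k hne).trans (le_max_right _ _)
    · exact (hR A k hz).trans (le_max_left _ _)

lemma segD_norm_le (hw : IsUnitTriple w) {P : Plane} {k : ZMod 6} {l : ℝ} {A : Plane} {i : ZMod 6}
    (h : segD w P k l A i ≠ 0) : ‖A‖ ≤ ‖P‖ + l := by
  have key : ∃ s : ℝ, 0 ≤ s ∧ s ≤ l ∧ A = P + s • dir w k := by
    rcases segD_supp h with ⟨-, s, h1, h2, h3⟩ | ⟨-, s, h1, h2, h3⟩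
    · exact ⟨s, h1, h2.le, h3⟩
    · exact ⟨s, h1.le, h2, h3⟩
  obtain ⟨s, h1, h2, rfl⟩ := key
  refine (norm_add_le _ _).trans ?_
  rw [norm_smul, norm_dir hw, Real.norm_eq_abs, abs_of_nonneg h1, mul_one]
  linarith

/-- All germs of the segment from `P` to `P + l • dir w k` are positive for `D`. -/
def Covers (w : Fin 3 → Plane) (D : Plane → ZMod 6 → ℝ) (P : Plane) (k : ZMod 6) (l : ℝ) :
    Prop :=
  (∀ s, 0 ≤ s → s < l → 0 < D (P + s • dir w k) k) ∧
    ∀ s, 0 < s → s ≤ l → 0 < D (P + s • dir w k) (k + 3)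

/-- The finitely supported vector field `F` is the boundary of a perturbation of `D`. -/
def IsBd (w : Fin 3 → Plane) (D : Plane → ZMod 6 → ℝ) (F : Plane → Plane) : Prop :=
  ∃ δ, IsPerturbation w D δ ∧ bd w δ = F

/-- The vector field `F` is the boundary of a perturbation of `D` of value at least `1` at the
germ `(T, i)`; in particular, the perturbation is not zero. -/
def IsBdAt (w : Fin 3 → Plane) (D : Plane → ZMod 6 → ℝ) (T : Plane) (i : ZMod 6)
    (F : Plane → Plane) : Prop :=
  ∃ δ, IsPerturbation w D δ ∧ bd w δ = F ∧ 1 ≤ δ T i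

variable {D : Plane → ZMod 6 → ℝ}

lemma IsBd.add {F G : Plane → Plane} (h : IsBd w D F) (h' : IsBd w D G) : IsBd w D (F + G) := by
  obtain ⟨δ, h1, rfl⟩ := h
  obtain ⟨ε, h2, rfl⟩ := h'
  exact ⟨_, h1.add h2, bd_add _ _⟩

lemma IsBdAt.add {F G : Plane → Plane} {T : Plane} {i : ZMod 6} (hT : D T i = 0)
    (h : IsBdAt w D T i F) (h' : IsBd w D G) : IsBdAt w D T i (F + G) := by
  obtain ⟨δ, h1, rfl, h3⟩ := h
  obtain ⟨ε, h2, rfl⟩ := h'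
  exact ⟨_, h1.add h2, bd_add _ _, by linarith [h2.sign T i hT]⟩

lemma isPerturbation_segD (hw : IsUnitTriple w) (P : Plane) (k : ZMod 6) (l : ℝ) :
    IsPerturbation w D (segD w P k l) :=
  ⟨isStep_segD hw P k l, ⟨0, fun A i => by rw [neg_zero]; exact segD_nonneg P k l A i⟩,
    ⟨_, fun _ _ h => segD_norm_le hw h⟩, fun A i _ => segD_nonneg P k l A i⟩

lemma isBd_seg (hw : IsUnitTriple w) {P Q : Plane} {k : ZMod 6} {l : ℝ} (hl : 0 < l)
    (hQ : P + l • dir w k = Q) : IsBd w D (pt P (dir w k) - pt Q (dir w k)) :=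
  ⟨_, isPerturbation_segD hw P k l, by rw [bd_segD hw P k hl, hQ]⟩

lemma isBdAt_seg (hw : IsUnitTriple w) {P Q : Plane} {k : ZMod 6} {l : ℝ} (hl : 0 < l)
    (hQ : P + l • dir w k = Q) : IsBdAt w D P k (pt P (dir w k) - pt Q (dir w k)) := by
  refine ⟨_, isPerturbation_segD hw P k l, by rw [bd_segD hw P k hl, hQ], ?_⟩
  have := segD_self hw P k l 0
  rw [zero_smul, add_zero, if_pos ⟨le_rfl, hl⟩] at this
  exact this.ge

lemma isBd_neg_seg (hw : IsUnitTriple w) {P Q : Plane} {k : ZMod 6} {l : ℝ} (hl : 0 < l)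
    (hQ : P + l • dir w k = Q) (hc : Covers w D P k l) :
    IsBd w D (pt Q (dir w k) - pt P (dir w k)) := by
  refine ⟨fun A i => -segD w P k l A i, ⟨?_, ⟨1, fun A i => ?_⟩, ⟨‖P‖ + l, fun A i h => ?_⟩,
    fun A i h => ?_⟩, ?_⟩
  · have := (isStep_segD hw P k l).smul (-1)
    simpa only [neg_one_mul] using this
  · exact neg_le_neg (segD_le_one P k l A i)
  · exact segD_norm_le hw fun h0 => h (by rw [h0, neg_zero])
  · have : segD w P k l A i = 0 := by
      by_contra hne
      rcases segD_supp hne with ⟨rfl, s, h1, h2, rfl⟩ | ⟨rfl, s, h1, h2, rfl⟩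
      · exact (hc.1 s h1 h2).ne' h
      · exact (hc.2 s h1 h2).ne' h
    rw [this, neg_zero]
  · rw [bd_neg, bd_segD hw P k hl, hQ]; abel

end

section

variable {w : Fin 3 → Plane} {D : Plane → ZMod 6 → ℝ}

/-! ### Tubes around paths in the support -/

/-- The cross-section at `X` of a tube of width `d` in direction `dir w k`. In a tube around a path,
two units of density along the path are replaced by one unit on each of the two parallel paths at
distance `d`. A tube is built from pieces whose boundaries cancel along common cross-sections. -/
def cs (w : Fin 3 → Plane) (d : ℝ) (X : Plane) (k : ZMod 6) : Plane → Plane :=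
  pt (X + d • dir w (k + 1)) (dir w k) + pt (X + d • dir w (k + 5)) (dir w k) -
    (2 : ℝ) • pt X (dir w k)

/-- The pointed end of a tube, around a point at which three consecutive germs behind the tube are
in the support. -/
lemma isBdAt_start (hw : IsUnitTriple w) {d : ℝ} (hd : 0 < d) {X : Plane} {k : ZMod 6}
    (hT : D (X + d • dir w (k + 3)) (k + 1) = 0) (h2 : Covers w D X (k + 2) d)
    (h3 : Covers w D X (k + 3) d) (h4 : Covers w D X (k + 4) d) :
    IsBdAt w D (X + d • dir w (k + 3)) (k + 1) (-cs w d X k) := by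
  obtain ⟨T, eT⟩ : ∃ T, X + d • dir w (k + 3) = T := ⟨_, rfl⟩
  obtain ⟨V2, e2⟩ : ∃ T, X + d • dir w (k + 2) = T := ⟨_, rfl⟩
  obtain ⟨V4, e4⟩ : ∃ T, X + d • dir w (k + 4) = T := ⟨_, rfl⟩
  obtain ⟨V1, e1⟩ : ∃ T, X + d • dir w (k + 1) = T := ⟨_, rfl⟩
  obtain ⟨V5, e5⟩ : ∃ T, X + d • dir w (k + 5) = T := ⟨_, rfl⟩
  have p1 : IsBdAt w D T (k + 1) (pt T (dir w (k + 1)) - pt V2 (dir w (k + 1))) :=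
    isBdAt_seg hw hd (by rw [← eT, ← e2, dir_add_three, dir_add_two hw]; module)
  have p2 : IsBd w D (pt T (dir w (k + 5)) - pt V4 (dir w (k + 5))) :=
    isBd_seg hw hd (by rw [← eT, ← e4, dir_add_three, dir_add_four, dir_add_five hw]; module)
  have p3 : IsBd w D (pt V2 (dir w k) - pt V1 (dir w k)) :=
    isBd_seg hw hd (by rw [← e2, ← e1, dir_add_two hw]; module)
  have p4 : IsBd w D (pt V4 (dir w k) - pt V5 (dir w k)) :=
    isBd_seg hw hd (by rw [← e4, ← e5, dir_add_four, dir_add_five hw]; module)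
  have p5 := isBd_neg_seg hw hd e2 h2
  have p6 := isBd_neg_seg hw hd eT h3
  have p7 := isBd_neg_seg hw hd e4 h4
  rw [eT] at hT ⊢
  have h := (((((p1.add hT p2).add hT p3).add hT p4).add hT p5).add hT p6).add hT p7
  rw [cs, e1, e5]
  convert h using 1
  simp only [dir_add_two hw, dir_add_three, dir_add_four, dir_add_five hw, map_sub, map_neg]
  module

/-- The straight part of a tube. -/
lemma isBd_edge (hw : IsUnitTriple w) (d : ℝ) {l : ℝ} (hl : 0 < l) {X : Plane} {k : ZMod 6}
    (h : Covers w D X k l) : IsBd w D (cs w d X k - cs w d (X + l • dir w k) k) := by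
  have p1 := isBd_neg_seg hw hl rfl h
  have p2 : IsBd w D (pt (X + d • dir w (k + 1)) (dir w k) -
      pt (X + l • dir w k + d • dir w (k + 1)) (dir w k)) := isBd_seg hw hl (by module)
  have p3 : IsBd w D (pt (X + d • dir w (k + 5)) (dir w k) -
      pt (X + l • dir w k + d • dir w (k + 5)) (dir w k)) := isBd_seg hw hl (by module)
  convert ((p1.add p1).add p2).add p3 using 1
  simp only [cs]
  module

/-- The part of a tube around a turn from `dir w k` to `dir w (k + 1)`. -/
lemma isBd_left (hw : IsUnitTriple w) {d : ℝ} (hd : 0 < d) {Z Y : Plane} {k : ZMod 6}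
    (hZ : Z + d • dir w k = Y) (h : Covers w D Z k d) (h5 : Covers w D Y (k + 5) d) :
    IsBd w D (cs w d Z k - cs w d Y (k + 1)) := by
  have i1 : ∀ k : ZMod 6, k + 1 + 5 = k := by decide
  have i2 : ∀ k : ZMod 6, k + 1 + 1 = k + 2 := by decide
  obtain ⟨V0, e0⟩ : ∃ T, Y + d • dir w k = T := ⟨_, rfl⟩
  obtain ⟨V2, e2⟩ : ∃ T, Y + d • dir w (k + 2) = T := ⟨_, rfl⟩
  obtain ⟨V4, e4⟩ : ∃ T, Y + d • dir w (k + 4) = T := ⟨_, rfl⟩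
  obtain ⟨V5, e5⟩ : ∃ T, Y + d • dir w (k + 5) = T := ⟨_, rfl⟩
  have c1 : Z + d • dir w (k + 1) = V2 := by rw [← e2, ← hZ, dir_add_two hw]; module
  have c2 : Z + d • dir w (k + 5) = V4 := by
    rw [← e4, ← hZ, dir_add_five hw, dir_add_four]; module
  have p1 := isBd_neg_seg hw hd hZ h
  have p2 : IsBd w D (pt Y (dir w (k + 2)) - pt V2 (dir w (k + 2))) := isBd_seg hw hd e2
  have p3 : IsBd w D (pt V4 (dir w k) - pt V5 (dir w k)) :=
    isBd_seg hw hd (by rw [← e4, ← e5, dir_add_four, dir_add_five hw]; module)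
  have p4 : IsBd w D (pt V5 (dir w (k + 1)) - pt V0 (dir w (k + 1))) :=
    isBd_seg hw hd (by rw [← e5, ← e0, dir_add_five hw]; module)
  have p5 := isBd_neg_seg hw hd e5 h5
  convert ((((p1.add p1).add p2).add p3).add p4).add p5 using 1
  rw [cs, cs, c1, c2, i1, i2, e0, e2]
  simp only [dir_add_two hw, dir_add_five hw, map_sub]
  module

/-- The part of a tube around a turn from `dir w k` to `dir w (k + 5)`. -/
lemma isBd_right (hw : IsUnitTriple w) {d : ℝ} (hd : 0 < d) {Z Y : Plane} {k : ZMod 6}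
    (hZ : Z + d • dir w k = Y) (h : Covers w D Z k d) (h1 : Covers w D Y (k + 1) d) :
    IsBd w D (cs w d Z k - cs w d Y (k + 5)) := by
  have i1 : ∀ k : ZMod 6, k + 5 + 5 = k + 4 := by decide
  have i2 : ∀ k : ZMod 6, k + 5 + 1 = k := by decide
  obtain ⟨V0, e0⟩ : ∃ T, Y + d • dir w k = T := ⟨_, rfl⟩
  obtain ⟨V1, e1⟩ : ∃ T, Y + d • dir w (k + 1) = T := ⟨_, rfl⟩
  obtain ⟨V2, e2⟩ : ∃ T, Y + d • dir w (k + 2) = T := ⟨_, rfl⟩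
  obtain ⟨V4, e4⟩ : ∃ T, Y + d • dir w (k + 4) = T := ⟨_, rfl⟩
  have c1 : Z + d • dir w (k + 1) = V2 := by rw [← e2, ← hZ, dir_add_two hw]; module
  have c2 : Z + d • dir w (k + 5) = V4 := by
    rw [← e4, ← hZ, dir_add_five hw, dir_add_four]; module
  have p1 := isBd_neg_seg hw hd hZ h
  have p2 : IsBd w D (pt Y (dir w (k + 4)) - pt V4 (dir w (k + 4))) := isBd_seg hw hd e4
  have p3 : IsBd w D (pt V2 (dir w k) - pt V1 (dir w k)) :=
    isBd_seg hw hd (by rw [← e2, ← e1, dir_add_two hw]; module)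
  have p4 : IsBd w D (pt V1 (dir w (k + 5)) - pt V0 (dir w (k + 5))) :=
    isBd_seg hw hd (by rw [← e1, ← e0, dir_add_five hw]; module)
  have p5 := isBd_neg_seg hw hd e1 h1
  convert ((((p1.add p1).add p2).add p3).add p4).add p5 using 1
  rw [cs, cs, c1, c2, i1, i2, e0, e4]
  simp only [dir_add_four, dir_add_five hw, map_sub, map_neg]
  module

/-- The pointed end closing a tube. -/
lemma isBd_end (hw : IsUnitTriple w) {d : ℝ} (hd : 0 < d) {Z Y : Plane} {k : ZMod 6}
    (hZ : Z + d • dir w k = Y) (h : Covers w D Z k d) (h0 : Covers w D Y k d)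
    (h1 : Covers w D Y (k + 1) d) (h5 : Covers w D Y (k + 5) d) : IsBd w D (cs w d Z k) := by
  obtain ⟨V0, e0⟩ : ∃ T, Y + d • dir w k = T := ⟨_, rfl⟩
  obtain ⟨V1, e1⟩ : ∃ T, Y + d • dir w (k + 1) = T := ⟨_, rfl⟩
  obtain ⟨V2, e2⟩ : ∃ T, Y + d • dir w (k + 2) = T := ⟨_, rfl⟩
  obtain ⟨V4, e4⟩ : ∃ T, Y + d • dir w (k + 4) = T := ⟨_, rfl⟩
  obtain ⟨V5, e5⟩ : ∃ T, Y + d • dir w (k + 5) = T := ⟨_, rfl⟩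
  have c1 : Z + d • dir w (k + 1) = V2 := by rw [← e2, ← hZ, dir_add_two hw]; module
  have c2 : Z + d • dir w (k + 5) = V4 := by
    rw [← e4, ← hZ, dir_add_five hw, dir_add_four]; module
  have p1 := isBd_neg_seg hw hd hZ h
  have p2 : IsBd w D (pt V2 (dir w k) - pt V1 (dir w k)) :=
    isBd_seg hw hd (by rw [← e2, ← e1, dir_add_two hw]; module)
  have p3 : IsBd w D (pt V1 (dir w (k + 5)) - pt V0 (dir w (k + 5))) :=
    isBd_seg hw hd (by rw [← e1, ← e0, dir_add_five hw]; module)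
  have p4 : IsBd w D (pt V4 (dir w k) - pt V5 (dir w k)) :=
    isBd_seg hw hd (by rw [← e4, ← e5, dir_add_four, dir_add_five hw]; module)
  have p5 : IsBd w D (pt V5 (dir w (k + 1)) - pt V0 (dir w (k + 1))) :=
    isBd_seg hw hd (by rw [← e5, ← e0, dir_add_five hw]; module)
  have p6 := isBd_neg_seg hw hd e0 h0
  have p7 := isBd_neg_seg hw hd e1 h1
  have p8 := isBd_neg_seg hw hd e5 h5
  convert (((((((p1.add p1).add p2).add p3).add p4).add p5).add p6).add p7).add p8 using 1
  rw [cs, c1, c2]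
  simp only [dir_add_five hw, map_sub]
  module

/-- If all six germs at a point are in the support, they can be replaced near the point by the
boundary of a small hexagon. -/
lemma isBdAt_hexagon (hw : IsUnitTriple w) {d : ℝ} (hd : 0 < d) {Y : Plane}
    (h : ∀ k, Covers w D Y k d) (k : ZMod 6) (hT : D (Y + d • dir w k) (k + 2) = 0) :
    IsBdAt w D (Y + d • dir w k) (k + 2) 0 := by
  have i1 : ∀ k : ZMod 6, k + 1 + 2 = k + 3 := by decide
  have i2 : ∀ k : ZMod 6, k + 2 + 2 = k + 4 := by decide
  have i3 : ∀ k : ZMod 6, k + 3 + 2 = k + 5 := by decide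
  have i4 : ∀ k : ZMod 6, k + 4 + 2 = k := by decide
  have i5 : ∀ k : ZMod 6, k + 5 + 2 = k + 1 := by decide
  obtain ⟨V0, e0⟩ : ∃ T, Y + d • dir w k = T := ⟨_, rfl⟩
  obtain ⟨V1, e1⟩ : ∃ T, Y + d • dir w (k + 1) = T := ⟨_, rfl⟩
  obtain ⟨V2, e2⟩ : ∃ T, Y + d • dir w (k + 2) = T := ⟨_, rfl⟩
  obtain ⟨V3, e3⟩ : ∃ T, Y + d • dir w (k + 3) = T := ⟨_, rfl⟩
  obtain ⟨V4, e4⟩ : ∃ T, Y + d • dir w (k + 4) = T := ⟨_, rfl⟩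
  obtain ⟨V5, e5⟩ : ∃ T, Y + d • dir w (k + 5) = T := ⟨_, rfl⟩
  have p0 : IsBdAt w D V0 (k + 2) (pt V0 (dir w (k + 2)) - pt V1 (dir w (k + 2))) :=
    isBdAt_seg hw hd (by rw [← e0, ← e1, dir_add_two hw]; module)
  have p1 : IsBd w D (pt V1 (dir w (k + 3)) - pt V2 (dir w (k + 3))) :=
    isBd_seg hw hd (by rw [← e1, ← e2, dir_add_two hw, dir_add_three]; module)
  have p2 : IsBd w D (pt V2 (dir w (k + 4)) - pt V3 (dir w (k + 4))) :=
    isBd_seg hw hd (by rw [← e2, ← e3, dir_add_two hw, dir_add_three, dir_add_four]; module)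
  have p3 : IsBd w D (pt V3 (dir w (k + 5)) - pt V4 (dir w (k + 5))) :=
    isBd_seg hw hd (by rw [← e3, ← e4, dir_add_three, dir_add_four, dir_add_five hw]; module)
  have p4 : IsBd w D (pt V4 (dir w k) - pt V5 (dir w k)) :=
    isBd_seg hw hd (by rw [← e4, ← e5, dir_add_four, dir_add_five hw]; module)
  have p5 : IsBd w D (pt V5 (dir w (k + 1)) - pt V0 (dir w (k + 1))) :=
    isBd_seg hw hd (by rw [← e5, ← e0, dir_add_five hw]; module)
  have q0 := isBd_neg_seg hw hd e0 (h k)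
  have q1 := isBd_neg_seg hw hd e1 (h _)
  have q2 := isBd_neg_seg hw hd e2 (h _)
  have q3 := isBd_neg_seg hw hd e3 (h _)
  have q4 := isBd_neg_seg hw hd e4 (h _)
  have q5 := isBd_neg_seg hw hd e5 (h _)
  rw [e0] at hT ⊢
  convert ((((((((((p0.add hT p1).add hT p2).add hT p3).add hT p4).add hT p5).add hT q0).add hT
    q1).add hT q2).add hT q3).add hT q4).add hT q5 using 1
  simp only [dir_add_two hw, dir_add_three, dir_add_four, dir_add_five hw, map_sub, map_neg]
  module

/-! ### Open tubes -/

lemma eventually_covers (hD : IsStep w D) {A : Plane} {k : ZMod 6} (h : 0 < D A k) :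
    ∀ᶠ d in 𝓝[>] (0 : ℝ), Covers w D A k d := by
  have hloc := hD.loc A k
  rw [eventually_nhdsWithin_iff, Metric.eventually_nhds_iff] at hloc
  obtain ⟨η, hη, hloc⟩ := hloc
  have key : ∀ s : ℝ, 0 < s → s < η → D (A + s • dir w k) k = D A k ∧
      D (A + s • dir w k) (k + 3) = D A k := fun s h0 h1 =>
    hloc (y := s) (by rw [Real.dist_eq, sub_zero, abs_of_pos h0]; exact h1) h0
  filter_upwards [Ioo_mem_nhdsGT hη] with d hd
  refine ⟨fun s h0 h1 => ?_, fun s h0 h1 => ?_⟩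
  · rcases eq_or_lt_of_le h0 with rfl | h0
    · rwa [zero_smul, add_zero]
    · rw [(key s h0 (h1.trans hd.2)).1]; exact h
  · rw [(key s h0 (h1.trans_lt hd.2)).2]; exact h

lemma Covers.left {P : Plane} {k : ZMod 6} {l m : ℝ} (h : Covers w D P k l) (hm : m ≤ l) :
    Covers w D P k m :=
  ⟨fun s h0 h1 => h.1 s h0 (h1.trans_le hm), fun s h0 h1 => h.2 s h0 (h1.trans hm)⟩

lemma Covers.right {P : Plane} {k : ZMod 6} {l m : ℝ} (h : Covers w D P k l) (h0 : 0 ≤ m) :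
    Covers w D (P + m • dir w k) k (l - m) := by
  refine ⟨fun s h1 h2 => ?_, fun s h1 h2 => ?_⟩
  · rw [ray_ray]; exact h.1 _ (by linarith) (by linarith)
  · rw [ray_ray]; exact h.2 _ (by linarith) (by linarith)

/-- For all small `d`, there is a tube of width `d` with a pointed end at `X₀`, starting in
direction `k₀`, and with open end at `X` in direction `k`. -/
def Tube (w : Fin 3 → Plane) (D : Plane → ZMod 6 → ℝ) (X₀ : Plane) (k₀ : ZMod 6) (X : Plane)
    (k : ZMod 6) : Prop :=
  ∀ᶠ d in 𝓝[>] (0 : ℝ),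
    IsBdAt w D (X₀ + d • dir w (k₀ + 3)) (k₀ + 1) (-cs w d X k)

lemma eventually_tip (hw : IsUnitTriple w) (hD : IsStep w D) (X₀ : Plane) (k₀ : ZMod 6) :
    ∀ᶠ d in 𝓝[>] (0 : ℝ), D (X₀ + d • dir w (k₀ + 3)) (k₀ + 1) = 0 := by
  have h : ∀ k : ZMod 6, k + 1 ≠ k + 3 ∧ k + 1 ≠ k + 3 + 3 := by decide
  filter_upwards [hD.eventually_only hw X₀ (k₀ + 3)] with d hd using hd _ (h k₀).1 (h k₀).2

lemma Tube.start (hw : IsUnitTriple w) (hD : IsStep w D) {X : Plane} {k : ZMod 6}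
    (h2 : 0 < D X (k + 2)) (h3 : 0 < D X (k + 3)) (h4 : 0 < D X (k + 4)) :
    Tube w D X k X k := by
  filter_upwards [eventually_tip hw hD X k, eventually_covers hD h2, eventually_covers hD h3,
    eventually_covers hD h4, self_mem_nhdsWithin] with d hT c2 c3 c4 hd
  exact isBdAt_start hw hd hT c2 c3 c4

lemma Tube.extend (hw : IsUnitTriple w) (hD : IsStep w D) {X₀ X Y : Plane} {k₀ k i : ZMod 6}
    (h : Tube w D X₀ k₀ X k)
    (hp : ∀ᶠ d in 𝓝[>] (0 : ℝ), IsBd w D (cs w d X k - cs w d Y i)) : Tube w D X₀ k₀ Y i := by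
  filter_upwards [eventually_tip hw hD X₀ k₀, h, hp] with d hT h1 h2
  convert h1.add hT h2 using 1
  abel

lemma Tube.straight (hw : IsUnitTriple w) (hD : IsStep w D) {X₀ X : Plane} {k₀ k : ZMod 6}
    (h : Tube w D X₀ k₀ X k) {t : ℝ} (ht : 0 < t) (hc : Covers w D X k t) :
    Tube w D X₀ k₀ (X + t • dir w k) k :=
  h.extend hw hD (Eventually.of_forall fun d => isBd_edge hw d ht hc)

lemma Tube.left (hw : IsUnitTriple w) (hD : IsStep w D) {X₀ X : Plane} {k₀ k : ZMod 6}
    (h : Tube w D X₀ k₀ X k) {t : ℝ} (ht : 0 < t) (hc : Covers w D X k t)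
    (h5 : 0 < D (X + t • dir w k) (k + 5)) :
    Tube w D X₀ k₀ (X + t • dir w k) (k + 1) := by
  refine h.extend hw hD ?_
  filter_upwards [Ioo_mem_nhdsGT ht, eventually_covers hD h5] with d hd c5
  have e1 := isBd_edge hw d (sub_pos.2 hd.2) (hc.left (m := t - d) (by linarith [hd.1]))
  have e2 := isBd_left hw hd.1 (Z := X + (t - d) • dir w k) (by rw [ray_ray, sub_add_cancel])
    (by have := hc.right (m := t - d) (by linarith [hd.2]); rwa [sub_sub_cancel] at this) c5
  simpa using e1.add e2

lemma Tube.right (hw : IsUnitTriple w) (hD : IsStep w D) {X₀ X : Plane} {k₀ k : ZMod 6}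
    (h : Tube w D X₀ k₀ X k) {t : ℝ} (ht : 0 < t) (hc : Covers w D X k t)
    (h1 : 0 < D (X + t • dir w k) (k + 1)) :
    Tube w D X₀ k₀ (X + t • dir w k) (k + 5) := by
  refine h.extend hw hD ?_
  filter_upwards [Ioo_mem_nhdsGT ht, eventually_covers hD h1] with d hd c1
  have e1 := isBd_edge hw d (sub_pos.2 hd.2) (hc.left (m := t - d) (by linarith [hd.1]))
  have e2 := isBd_right hw hd.1 (Z := X + (t - d) • dir w k) (by rw [ray_ray, sub_add_cancel])
    (by have := hc.right (m := t - d) (by linarith [hd.2]); rwa [sub_sub_cancel] at this) c1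
  simpa using e1.add e2

lemma Tube.close (hw : IsUnitTriple w) (hD : IsStep w D) {X₀ X : Plane} {k₀ k : ZMod 6}
    (h : Tube w D X₀ k₀ X k) {t : ℝ} (ht : 0 < t) (hc : Covers w D X k t)
    (h0 : 0 < D (X + t • dir w k) k) (h1 : 0 < D (X + t • dir w k) (k + 1))
    (h5 : 0 < D (X + t • dir w k) (k + 5)) : ∃ T i, IsBdAt w D T i 0 := by
  have hI : ∀ᶠ d in 𝓝[>] (0 : ℝ), d ∈ Ioo 0 t := Ioo_mem_nhdsGT ht
  obtain ⟨d, hd, c0, c1, c5, hT, hX⟩ := (hI.and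
    ((eventually_covers hD h0).and ((eventually_covers hD h1).and ((eventually_covers hD h5).and
      ((eventually_tip hw hD X₀ k₀).and h))))).exists
  refine ⟨X₀ + d • dir w (k₀ + 3), k₀ + 1, ?_⟩
  have e1 := isBd_edge hw d (sub_pos.2 hd.2) (hc.left (m := t - d) (by linarith [hd.1]))
  have e2 := isBd_end hw hd.1 (Z := X + (t - d) • dir w k) (by rw [ray_ray, sub_add_cancel])
    (by have := hc.right (m := t - d) (by linarith [hd.2]); rwa [sub_sub_cancel] at this)
    c0 c1 c5
  convert hX.add hT (e1.add e2) using 1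
  abel

/-- For a rigid measure there is no closed tube: it would be a perturbation without boundary,
that is, a balanced one. -/
lemma IsRigid.not_isBdAt (hw : IsUnitTriple w) {r : ℝ} (hr : 0 < r) {μ : Measure Plane}
    (hμ : IsRigid w r μ) (T : Plane) (i : ZMod 6) : ¬IsBdAt w (germ w μ) T i 0 := by
  rintro ⟨δ, hδ, hbd, h1⟩
  have hin := inTriangle_germ hw hr hμ.1
  have hb := isBalanced_of_bd hw hbd
  obtain ⟨C, hC⟩ := hδ.lower
  obtain ⟨R, hR⟩ := hδ.supp
  have := hμ.eq_zero hw hδ.step hb hC hδ.sign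
    (fun A hA k => hin.confine hw hr hδ.step hb hR hδ.sign A hA k) T i
  linarith

/-- For a rigid measure, one of the six germs at each point is zero. -/
lemma IsRigid.exists_germ_eq_zero (hw : IsUnitTriple w) {r : ℝ} (hr : 0 < r) {μ : Measure Plane}
    (hμ : IsRigid w r μ) (A : Plane) : ∃ k, germ w μ A k = 0 := by
  by_contra! h
  have hin := inTriangle_germ hw hr hμ.1
  have hc : ∀ᶠ d in 𝓝[>] (0 : ℝ), ∀ k, Covers w (germ w μ) A k d :=
    Filter.eventually_all.2 fun k =>
      eventually_covers hin.step (lt_of_le_of_ne (hin.nonneg A k) (h k).symm)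
  obtain ⟨d, hc, h0, hd⟩ := (hc.and ((hin.step.eventually_only hw A 0).and
    self_mem_nhdsWithin)).exists
  exact hμ.not_isBdAt hw hr _ _ (isBdAt_hexagon hw hd hc 0
    (h0 _ (by decide) (by decide)))

end

section

variable {w : Fin 3 → Plane}

/-! ### The balance condition at one point -/

/-- Three germs at mutual angles `2π/3`, one of them `k`, are in the support. -/
def Tri (d : ZMod 6 → ℝ) (k : ZMod 6) : Prop := 0 < d k ∧ 0 < d (k + 2) ∧ 0 < d (k + 4)

/-- The germ `k` belongs to a triple as in `Tri`, and the opposite germ is not in the support. -/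
def IsPure (d : ZMod 6 → ℝ) (k : ZMod 6) : Prop := Tri d k ∧ d (k + 3) = 0

/-- The germ `k` belongs to a triple as in `Tri`, and the opposite germ is in the support. The
density at `k` is then the sum of the densities at `k + 3` and at any pure germ. -/
def Composite (d : ZMod 6 → ℝ) (k : ZMod 6) : Prop := Tri d k ∧ 0 < d (k + 3)

/-- Two germs at one point whose densities are equal for every balanced density supported in the
support of `d`. -/
def Link (d : ZMod 6 → ℝ) (k l : ZMod 6) : Prop :=
  (l = k + 3 ∧ 0 < d k ∧ 0 < d (k + 3) ∧ ¬Tri d k ∧ ¬Tri d (k + 3)) ∨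
    (IsPure d k ∧ IsPure d l ∧ (l = k + 2 ∨ l = k + 4))

variable {d y : ZMod 6 → ℝ} {k l : ZMod 6}

lemma Link.symm (h : Link d k l) : Link d l k := by
  have e : ∀ k : ZMod 6, k = k + 2 + 4 ∧ k = k + 4 + 2 := by decide
  rcases h with ⟨rfl, h1, h2, h3, h4⟩ | ⟨h1, h2, rfl | rfl⟩
  · exact Or.inl ⟨(add_three_three k).symm, h2, by rwa [add_three_three], h4,
      by rwa [add_three_three]⟩
  · exact Or.inr ⟨h2, h1, Or.inr (e k).1⟩
  · exact Or.inr ⟨h2, h1, Or.inl (e k).2⟩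

lemma Link.trans {m : ZMod 6} (h : Link d k l) (h' : Link d l m) : m = k ∨ Link d k m := by
  rcases h with ⟨rfl, h1, h2, h3, h4⟩ | ⟨h1, h2, e⟩
  · rcases h' with ⟨rfl, -⟩ | ⟨h5, -⟩
    · exact Or.inl (add_three_three k)
    · exact absurd h5.1 h4
  · rcases h' with ⟨rfl, -, -, h5, -⟩ | ⟨-, h5, e'⟩
    · exact absurd h2.1 h5
    · have key : ∀ k l m : ZMod 6, (l = k + 2 ∨ l = k + 4) → (m = l + 2 ∨ m = l + 4) →
          m = k ∨ m = k + 2 ∨ m = k + 4 := by decide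
      rcases key k l m e e' with h | h
      · exact Or.inl h
      · exact Or.inr (Or.inr ⟨h1, h5, h⟩)

lemma Link.pos (h : Link d k l) : 0 < d l := by
  rcases h with ⟨rfl, -, h, -⟩ | ⟨-, h, -⟩
  · exact h
  · exact h.1.1

lemma Link.not_composite (h : Link d k l) : ¬Composite d k := by
  rintro ⟨h1, h2⟩
  rcases h with ⟨-, -, -, h, -⟩ | ⟨h, -⟩
  · exact h h1
  · exact h2.ne' h.2

lemma Composite.exists_pure (hz : ∃ i, d i = 0) (h : Composite d k) :
    ∃ p, (p = k + 2 ∨ p = k + 4) ∧ IsPure d p := by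
  have e : ∀ k : ZMod 6, k + 2 + 2 = k + 4 ∧ k + 2 + 4 = k ∧ k + 2 + 3 = k + 5 ∧
    k + 4 + 2 = k ∧ k + 4 + 4 = k + 2 ∧ k + 4 + 3 = k + 1 := by decide
  obtain ⟨e1, e2, e3, e4, e5, e6⟩ := e k
  by_contra! hc
  have h5 : d (k + 5) ≠ 0 := fun h0 => hc (k + 2) (Or.inl rfl)
    ⟨⟨h.1.2.1, by rw [e1]; exact h.1.2.2, by rw [e2]; exact h.1.1⟩, by rw [e3]; exact h0⟩
  have h1 : d (k + 1) ≠ 0 := fun h0 => hc (k + 4) (Or.inr rfl)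
    ⟨⟨h.1.2.2, by rw [e4]; exact h.1.1, by rw [e5]; exact h.1.2.1⟩, by rw [e6]; exact h0⟩
  obtain ⟨i, hi⟩ := hz
  exact forall_dir_index (P := fun i => d i ≠ 0) k h.1.1.ne' h1 h.1.2.1.ne' h.2.ne' h.1.2.2.ne'
    h5 i hi

/-- Linked germs have equal densities: the balance condition for `d`, and the positivity of `d`,
force enough of the other germs to vanish. -/
lemma Link.eq (hn : ∀ i, 0 ≤ d i) (hd : ∀ i, d i - d (i + 3) = d (i + 2) - d (i + 5))
    (hy : ∀ i, y i - y (i + 3) = y (i + 2) - y (i + 5)) (h0 : ∀ i, d i = 0 → y i = 0)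
    (h : Link d k l) : y k = y l := by
  have e : ∀ k : ZMod 6, k + 2 + 2 = k + 4 ∧ k + 2 + 3 = k + 5 ∧
    k + 2 + 5 = k + 1 ∧ k + 4 + 2 = k ∧ k + 4 + 3 = k + 1 ∧ k + 4 + 5 = k + 3 ∧
    k + 3 + 2 = k + 5 ∧ k + 3 + 4 = k + 1 := by decide
  obtain ⟨e1, e2, e3, e4, e5, e6, e7, e8⟩ := e k
  have d1 := hd k
  have d2 := hd (k + 2)
  have y1 := hy k
  have y2 := hy (k + 2)
  rw [e1, e2, e3] at d2 y2
  rcases h with ⟨rfl, h1, h2, h3, h4⟩ | ⟨h1, h2, rfl | rfl⟩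
  · have h3 : d (k + 2) = 0 ∨ d (k + 4) = 0 := by
      by_contra! hc
      exact h3 ⟨h1, lt_of_le_of_ne (hn _) hc.1.symm, lt_of_le_of_ne (hn _) hc.2.symm⟩
    have h4 : d (k + 5) = 0 ∨ d (k + 1) = 0 := by
      by_contra! hc
      refine h4 ⟨h2, ?_, ?_⟩
      · rw [e7]; exact lt_of_le_of_ne (hn _) hc.1.symm
      · rw [e8]; exact lt_of_le_of_ne (hn _) hc.2.symm
    have n1 := hn (k + 1)
    have n2 := hn (k + 2)
    have n4 := hn (k + 4)
    have n5 := hn (k + 5)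
    have : (d (k + 2) = 0 ∧ d (k + 5) = 0) ∨ (d (k + 4) = 0 ∧ d (k + 1) = 0) := by
      rcases h3 with h | h <;> rcases h4 with h' | h'
      · exact Or.inl ⟨h, h'⟩
      · exact Or.inl ⟨h, by linarith⟩
      · exact Or.inl ⟨by linarith, h'⟩
      · exact Or.inr ⟨h, h'⟩
    rcases this with ⟨h, h'⟩ | ⟨h, h'⟩
    · have := h0 _ h; have := h0 _ h'; linarith
    · have := h0 _ h; have := h0 _ h'; linarith
  · have := h0 _ h1.2
    have h2 := h2.2
    rw [e2] at h2
    have := h0 _ h2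
    linarith
  · have := h0 _ h1.2
    have h2 := h2.2
    rw [e5] at h2
    have := h0 _ h2
    linarith

lemma Composite.eq (hy : ∀ i, y i - y (i + 3) = y (i + 2) - y (i + 5))
    (h0 : ∀ i, d i = 0 → y i = 0) {p : ZMod 6} (hp : p = k + 2 ∨ p = k + 4)
    (h : IsPure d p) : y k = y (k + 3) + y p := by
  have e : ∀ k : ZMod 6, k + 2 + 2 = k + 4 ∧ k + 2 + 3 = k + 5 ∧
    k + 2 + 5 = k + 1 ∧ k + 4 + 3 = k + 1 := by decide
  obtain ⟨e1, e2, e3, e4⟩ := e k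
  have y1 := hy k
  have y2 := hy (k + 2)
  rw [e1, e2, e3] at y2
  have h := h.2
  rcases hp with rfl | rfl
  · rw [e2] at h; have := h0 _ h; linarith
  · rw [e4] at h; have := h0 _ h; linarith

/-- Conversely, the equations of the links and of the composite germs imply balance. -/
lemma balanced_of_links (hn : ∀ i, 0 ≤ d i) (hd : ∀ i, d i - d (i + 3) = d (i + 2) - d (i + 5))
    (hz : ∃ i, d i = 0) (h0 : ∀ i, d i = 0 → y i = 0) (hl : ∀ k l, Link d k l → y k = y l)
    (hc : ∀ k p, Composite d k → (p = k + 2 ∨ p = k + 4) → IsPure d p → y k = y (k + 3) + y p)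
    (i : ZMod 6) : y i - y (i + 3) = y (i + 2) - y (i + 5) := by
  have suff : ∀ (p : ZMod 6) (a : ℝ), y p - y (p + 3) = a → y (p + 2) - y (p + 5) = a →
      y (p + 4) - y (p + 1) = a → y i - y (i + 3) = y (i + 2) - y (i + 5) := by
    intro p a h1 h2 h3
    have e : ∀ p : ZMod 6, p + 1 + 2 = p + 3 ∧ p + 1 + 3 = p + 4 ∧ p + 1 + 5 = p ∧
      p + 2 + 2 = p + 4 ∧ p + 2 + 3 = p + 5 ∧ p + 2 + 5 = p + 1 ∧
      p + 3 + 2 = p + 5 ∧ p + 3 + 3 = p ∧ p + 3 + 5 = p + 2 ∧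
      p + 4 + 2 = p ∧ p + 4 + 3 = p + 1 ∧ p + 4 + 5 = p + 3 ∧
      p + 5 + 2 = p + 1 ∧ p + 5 + 3 = p + 2 ∧ p + 5 + 5 = p + 4 := by decide
    obtain ⟨e1, e2, e3, e4, e5, e6, e7, e8, e9, e10, e11, e12, e13, e14, e15⟩ := e p
    refine forall_dir_index (P := fun i => y i - y (i + 3) = y (i + 2) - y (i + 5)) p ?_ ?_ ?_ ?_
      ?_ ?_ i
    · linarith
    · rw [e1, e2, e3]; linarith
    · rw [e4, e5, e6]; linarith
    · rw [e7, e8, e9]; linarith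
    · rw [e10, e11, e12]; linarith
    · rw [e13, e14, e15]; linarith
  by_cases ht : ∃ k, Tri d k
  · obtain ⟨p, hp⟩ : ∃ p, IsPure d p := by
      obtain ⟨k, hk⟩ := ht
      by_cases h3 : d (k + 3) = 0
      · exact ⟨k, hk, h3⟩
      · obtain ⟨p, -, hp⟩ := Composite.exists_pure hz
          ⟨hk, lt_of_le_of_ne (hn _) (Ne.symm h3)⟩
        exact ⟨p, hp⟩
    have key : ∀ q, Tri d q → (p = q + 2 ∨ p = q + 4) → y q - y (q + 3) = y p := by
      intro q hq hpq
      by_cases h3 : d (q + 3) = 0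
      · rw [h0 _ h3, hl q p (Or.inr ⟨⟨hq, h3⟩, hp, hpq⟩), sub_zero]
      · rw [hc q p ⟨hq, lt_of_le_of_ne (hn _) (Ne.symm h3)⟩ hpq hp]; ring
    have e : ∀ p : ZMod 6, p + 2 + 2 = p + 4 ∧ p + 2 + 4 = p ∧ p + 4 + 2 = p ∧
      p + 4 + 4 = p + 2 ∧ p + 2 + 3 = p + 5 ∧ p + 4 + 3 = p + 1 := by decide
    obtain ⟨e1, e2, e3, e4, e5, e6⟩ := e p
    have k2 := key (p + 2) ⟨hp.1.2.1, by rw [e1]; exact hp.1.2.2, by rw [e2]; exact hp.1.1⟩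
      (Or.inr e2.symm)
    have k4 := key (p + 4) ⟨hp.1.2.2, by rw [e3]; exact hp.1.1, by rw [e4]; exact hp.1.2.1⟩
      (Or.inl e3.symm)
    rw [e5] at k2
    rw [e6] at k4
    exact suff p (y p) (by rw [h0 _ hp.2, sub_zero]) k2 k4
  · push Not at ht
    have pos3 : ∀ k, 0 < d k → 0 < d (k + 3) := by
      intro k hk
      by_contra h3
      have h3 : d (k + 3) = 0 := le_antisymm (not_lt.1 h3) (hn _)
      have e : ∀ p : ZMod 6, p + 2 + 2 = p + 4 ∧ p + 2 + 3 = p + 5 ∧ p + 2 + 5 = p + 1 := by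
        decide
      obtain ⟨e1, e2, e3⟩ := e k
      have d1 := hd k
      have d2 := hd (k + 2)
      rw [e1, e2, e3] at d2
      have := hn (k + 1)
      have := hn (k + 5)
      exact ht k ⟨hk, by linarith, by linarith⟩
    have hop : ∀ k, y k = y (k + 3) := by
      intro k
      by_cases hk : d k = 0
      · have : d (k + 3) = 0 := by
          by_contra h3
          have := pos3 _ (lt_of_le_of_ne (hn _) (Ne.symm h3))
          rw [add_three_three] at this
          exact this.ne' hk
        rw [h0 _ hk, h0 _ this]
      · have hk := lt_of_le_of_ne (hn _) (Ne.symm hk)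
        exact hl _ _ (Or.inl ⟨rfl, hk, pos3 k hk, ht _, ht _⟩)
    have h5 := hop (i + 2)
    rw [show i + 2 + 3 = i + 5 by ring] at h5
    rw [hop i, h5]; ring

end

section

variable {w : Fin 3 → Plane} {D : Plane → ZMod 6 → ℝ}

/-! ### Classes of germs -/

/-- The two end germs of a segment without branch points in its interior. -/
def Flip (w : Fin 3 → Plane) (D : Plane → ZMod 6 → ℝ) (g h : Plane × ZMod 6) : Prop :=
  ∃ t : ℝ, 0 < t ∧ h = (g.1 + t • dir w g.2, g.2 + 3) ∧
    ∀ s, 0 < s → s < t → NonBranch D (g.1 + s • dir w g.2)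

/-- Two germs which are the ends of one edge or are linked at their common point. -/
def Adj (w : Fin 3 → Plane) (D : Plane → ZMod 6 → ℝ) (g h : Plane × ZMod 6) : Prop :=
  Flip w D g h ∨ (g.1 = h.1 ∧ Link (D g.1) g.2 h.2)

/-- Germs connected by a chain of edges and links. All balanced densities with support in the
support of `D` are constant on the classes of this relation. -/
def Conn (w : Fin 3 → Plane) (D : Plane → ZMod 6 → ℝ) : Plane × ZMod 6 → Plane × ZMod 6 → Prop :=
  Relation.ReflTransGen (Adj w D)

lemma Flip.symm {g h : Plane × ZMod 6} (hf : Flip w D g h) : Flip w D h g := by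
  obtain ⟨A, k⟩ := g
  obtain ⟨t, ht, rfl, hn⟩ := hf
  refine ⟨t, ht, ?_, fun s h0 h1 => ?_⟩
  · simp only
    rw [ray_back, sub_self, zero_smul, add_zero, add_three_three]
  · simp only
    rw [ray_back]
    exact hn _ (by linarith) (by linarith)

lemma Conn.symm {g h : Plane × ZMod 6} (hc : Conn w D g h) : Conn w D h g := by
  induction hc with
  | refl => exact .refl
  | tail _ h1 ih =>
    refine .head ?_ ih
    rcases h1 with h1 | ⟨h1, h2⟩
    · exact Or.inl h1.symm
    · exact Or.inr ⟨h1.symm, by rw [← h1]; exact h2.symm⟩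

/-- A balanced step function with support in the support of `D` has equal values at both ends of
an edge. -/
lemma Flip.eq {y : Plane → ZMod 6 → ℝ} (hy : IsStep w y) (hb : IsBalanced y)
    (h0 : ∀ A k, D A k = 0 → y A k = 0) {g h : Plane × ZMod 6} (hf : Flip w D g h) :
    y g.1 g.2 = y h.1 h.2 := by
  obtain ⟨t, ht, rfl, hn⟩ := hf
  refine (hy.const ht fun s hs hs' => ?_).2.symm
  obtain ⟨i, hi⟩ := hn s hs hs'
  exact NonBranch.no_jump hb ⟨i, fun k h1 h2 => h0 _ _ (hi k h1 h2)⟩ _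

lemma Conn.eq {y : Plane → ZMod 6 → ℝ} (hDn : ∀ A k, 0 ≤ D A k) (hDb : IsBalanced D)
    (hy : IsStep w y) (hb : IsBalanced y) (h0 : ∀ A k, D A k = 0 → y A k = 0)
    {g h : Plane × ZMod 6} (hc : Conn w D g h) : y g.1 g.2 = y h.1 h.2 := by
  induction hc with
  | refl => rfl
  | tail _ h1 ih =>
    rw [ih]
    rcases h1 with h1 | ⟨h1, h2⟩
    · exact h1.eq hy hb h0
    · rw [← h1]
      exact h2.eq (hDn _) (hDb _) (hb _) (h0 _)

lemma covers_of_nonBranch (hD : IsStep w D) (hb : IsBalanced D) {X : Plane} {k : ZMod 6}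
    (hpos : 0 < D X k) {t : ℝ} (ht : 0 < t)
    (hn : ∀ s, 0 < s → s < t → NonBranch D (X + s • dir w k)) : Covers w D X k t := by
  have h := hD.const ht fun s h0 h1 => (hn s h0 h1).no_jump hb k
  have h' : ∀ s, 0 < s → s < t → D (X + s • dir w k) k = D X k := h.1
  refine ⟨fun s h0 h1 => ?_, fun s h0 h1 => ?_⟩
  · rcases eq_or_lt_of_le h0 with rfl | h0
    · rwa [zero_smul, add_zero]
    · rw [h' s h0 h1]; exact hpos
  · rcases eq_or_lt_of_le h1 with rfl | h1
    · rw [h.2]; exact hpos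
    · rw [← (hn s h0 h1).no_jump hb k, h' s h0 h1]; exact hpos

/-- The germs reached from `g` by a path of edges and links through branch points, pointing away
from `g`. -/
inductive Reach (w : Fin 3 → Plane) (D : Plane → ZMod 6 → ℝ) (g : Plane × ZMod 6) :
    Plane → ZMod 6 → Prop
  | base : Reach w D g g.1 g.2
  | step {X : Plane} {k l : ZMod 6} {t : ℝ} (h : Reach w D g X k) (ht : 0 < t)
      (hn : ∀ s, 0 < s → s < t → NonBranch D (X + s • dir w k))
      (hb : ¬NonBranch D (X + t • dir w k)) (hl : Link (D (X + t • dir w k)) (k + 3) l) :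
      Reach w D g (X + t • dir w k) l

lemma Tri.not_nonBranch {A : Plane} {k : ZMod 6} (h : Tri (D A) k) : ¬NonBranch D A := by
  intro hn
  have e : ∀ k : ZMod 6, k + 2 ≠ k ∧ k + 2 ≠ k + 3 := by decide
  exact h.2.1.ne' (hn.eq_zero h.1.ne' (e k).1 (e k).2)

lemma Reach.not_nonBranch {g : Plane × ZMod 6} (hg : Composite (D g.1) g.2) {X : Plane}
    {k : ZMod 6} (h : Reach w D g X k) : ¬NonBranch D X := by
  cases h with
  | base => exact hg.1.not_nonBranch
  | step _ _ _ hb _ => exact hb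

lemma Reach.pos {g : Plane × ZMod 6} (hg : Composite (D g.1) g.2) {X : Plane}
    {k : ZMod 6} (h : Reach w D g X k) : 0 < D X k := by
  cases h with
  | base => exact hg.1.1
  | step _ _ _ _ hl => exact hl.pos

/-- A path which starts at a composite germ is the core of a tube: the start of the tube replaces
the three germs around the opposite direction, and at a turn the third germ of the triple is
replaced. -/
lemma Reach.tube (hw : IsUnitTriple w) (hD : IsStep w D) (hb : IsBalanced D)
    {g : Plane × ZMod 6} (hg : Composite (D g.1) g.2) {X : Plane} {k : ZMod 6}
    (h : Reach w D g X k) : Tube w D g.1 g.2 X k := by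
  induction h with
  | base => exact Tube.start hw hD hg.1.2.1 hg.2 hg.1.2.2
  | @step X k l t h ht hn _ hl ih =>
    have hc := covers_of_nonBranch hD hb (h.pos hg) ht hn
    have e : ∀ k : ZMod 6, k + 3 + 2 = k + 5 ∧ k + 3 + 4 = k + 1 := by decide
    obtain ⟨e1, e2⟩ := e k
    rcases hl with ⟨rfl, -⟩ | ⟨h1, h2, rfl | rfl⟩
    · rw [add_three_three]; exact ih.straight hw hD ht hc
    · rw [e1]
      refine ih.right hw hD ht hc ?_
      rw [← e2]; exact h1.1.2.2
    · rw [e2]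
      refine ih.left hw hD ht hc ?_
      rw [← e1]; exact h1.1.2.1

/-- The germs on the open edges which start at the germs reached from `g`. -/
def OnEdge (w : Fin 3 → Plane) (D : Plane → ZMod 6 → ℝ) (g h : Plane × ZMod 6) : Prop :=
  ∃ (X : Plane) (j : ZMod 6) (s : ℝ), Reach w D g X j ∧ 0 ≤ s ∧ h.1 = X + s • dir w j ∧
    (∀ s', 0 < s' → s' < s → NonBranch D (X + s' • dir w j)) ∧
    ((h.2 = j ∧ (s = 0 ∨ NonBranch D h.1)) ∨ (h.2 = j + 3 ∧ 0 < s))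

lemma OnEdge.adj {g h h' : Plane × ZMod 6} (hg : Composite (D g.1) g.2)
    (ho : OnEdge w D g h) (ha : Adj w D h h') : OnEdge w D g h' := by
  obtain ⟨A, i⟩ := h
  obtain ⟨X, j, s, hR, hs, hA, hn, hor⟩ := ho
  simp only at hA hor
  subst hA
  rcases ha with ⟨t, ht, rfl, hnt⟩ | ⟨h1, hl⟩
  · simp only at hnt ⊢
    rcases hor with ⟨rfl, hor⟩ | ⟨rfl, hs0⟩
    · refine ⟨X, i, s + t, hR, by linarith, by rw [ray_ray], fun s' h0 h1 => ?_,
        Or.inr ⟨rfl, by linarith⟩⟩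
      rcases lt_trichotomy s' s with h | rfl | h
      · exact hn s' h0 h
      · exact hor.resolve_left h0.ne'
      · have := hnt (s' - s) (by linarith) (by linarith)
        rwa [ray_ray, add_sub_cancel] at this
    · -- the flip cannot pass `X`, which is a branch point
      have hts : t ≤ s := by
        by_contra hts
        have := hnt s hs0 (not_le.1 hts)
        rw [ray_back, sub_self, zero_smul, add_zero] at this
        exact hR.not_nonBranch hg this
      refine ⟨X, j, s - t, hR, by linarith, by rw [ray_back],
        fun s' h0 h1 => hn s' h0 (by linarith), Or.inl ⟨add_three_three j, ?_⟩⟩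
      rcases eq_or_lt_of_le hts with h | h
      · left; linarith
      · right; simp only; rw [ray_back]; exact hn _ (by linarith) (by linarith)
  · obtain ⟨B, l⟩ := h'
    simp only at h1 hl ⊢
    subst h1
    rcases hor with ⟨rfl, hor⟩ | ⟨rfl, hs0⟩
    · by_cases hs0 : s = 0
      · subst hs0
        rw [zero_smul, add_zero] at hl ⊢
        cases hR with
        | base => exact absurd hg hl.not_composite
        | @step Y k _ t h' ht' hn' hb' hl' =>
          -- links are transitive, up to the return to the incoming germ
          rcases hl'.trans hl with rfl | hl2
          · exact ⟨Y, k, t, h', ht'.le, rfl, hn', Or.inr ⟨rfl, ht'⟩⟩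
          · exact ⟨_, l, 0, .step h' ht' hn' hb' hl2, le_rfl, by simp,
              fun s' h0 h1 => absurd h0 (not_lt.2 h1.le), Or.inl ⟨rfl, Or.inl rfl⟩⟩
      · have hor := hor.resolve_left hs0
        rcases hl with ⟨rfl, -⟩ | ⟨h1, -⟩
        · exact ⟨X, i, s, hR, hs, rfl, hn, Or.inr ⟨rfl, lt_of_le_of_ne hs (Ne.symm hs0)⟩⟩
        · exact absurd hor h1.1.not_nonBranch
    · by_cases hb : NonBranch D (X + s • dir w j)
      · rcases hl with ⟨rfl, -⟩ | ⟨h1, -⟩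
        · exact ⟨X, j, s, hR, hs, rfl, hn, Or.inl ⟨add_three_three j, Or.inr hb⟩⟩
        · exact absurd hb h1.1.not_nonBranch
      · exact ⟨_, l, 0, .step hR hs0 hn hb hl, le_rfl, by simp,
          fun s' h0 h1 => absurd h0 (not_lt.2 h1.le), Or.inl ⟨rfl, Or.inl rfl⟩⟩

/-- Unless there is a closed tube, each class contains at most one composite germ: a path between
two composite germs is the core of a closed tube. -/
lemma Conn.composite_unique (hw : IsUnitTriple w) (hD : IsStep w D) (hb : IsBalanced D)
    (hT : ∀ T i, ¬IsBdAt w D T i 0) {g h : Plane × ZMod 6} (hc : Conn w D g h)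
    (hg : Composite (D g.1) g.2) (hh : Composite (D h.1) h.2) : g = h := by
  have key : OnEdge w D g h := by
    clear hh
    induction hc with
    | refl =>
      exact ⟨g.1, g.2, 0, .base, le_rfl, by simp,
        fun s' h0 h1 => absurd h0 (not_lt.2 h1.le), Or.inl ⟨rfl, Or.inl rfl⟩⟩
    | tail _ h1 ih => exact ih.adj hg h1
  obtain ⟨A, i⟩ := h
  obtain ⟨X, j, s, hR, hs, hA, hn, hor⟩ := key
  simp only at hA hor hh
  subst hA
  rcases hor with ⟨rfl, rfl | hor⟩ | ⟨rfl, hs0⟩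
  · rw [zero_smul, add_zero] at hh ⊢
    cases hR with
    | base => rfl
    | step _ _ _ _ hl => exact absurd hh hl.symm.not_composite
  · exact absurd hor hh.1.not_nonBranch
  · exfalso
    have e : ∀ k : ZMod 6, k + 3 + 2 = k + 5 ∧ k + 3 + 4 = k + 1 := by decide
    obtain ⟨⟨h3, h5, h1⟩, h0⟩ := hh
    rw [(e j).1] at h5
    rw [(e j).2] at h1
    rw [add_three_three] at h0
    obtain ⟨T, i, hTi⟩ := (hR.tube hw hD hb hg).close hw hD hs0
      (covers_of_nonBranch hD hb (hR.pos hg) hs0 hn) h0 h1 h5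
    exact hT T i hTi

end

section

variable {w : Fin 3 → Plane} {D : Plane → ZMod 6 → ℝ}

/-! ### Balanced densities are determined by their values on root classes -/

/-- A nonnegative balanced germ density without a point where all six germs are in the support,
and without closed tubes. -/
structure Tame (w : Fin 3 → Plane) (D : Plane → ZMod 6 → ℝ) : Prop where
  step : IsStep w D
  nonneg : ∀ A k, 0 ≤ D A k
  balanced : IsBalanced D
  bdd : ∃ C, ∀ A k, D A k ≤ C
  low : ∃ ε, 0 < ε ∧ ∀ A k, D A k ≠ 0 → ε ≤ D A k
  exists_eq_zero : ∀ A, ∃ k, D A k = 0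
  not_isBdAt : ∀ T i, ¬IsBdAt w D T i 0

/-- The equations which characterize the balanced step functions with support in the support
of `D`. -/
structure Harmonic (w : Fin 3 → Plane) (D y : Plane → ZMod 6 → ℝ) : Prop where
  zero : ∀ A k, D A k = 0 → y A k = 0
  conn : ∀ g h, Conn w D g h → y g.1 g.2 = y h.1 h.2
  comp : ∀ A k p, Composite (D A) k → (p = k + 2 ∨ p = k + 4) → IsPure (D A) p →
    y A k = y A (k + 3) + y A p

lemma Tame.harmonic (hD : Tame w D) {y : Plane → ZMod 6 → ℝ} (hy : IsStep w y)
    (hb : IsBalanced y) (h0 : ∀ A k, D A k = 0 → y A k = 0) : Harmonic w D y :=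
  ⟨h0, fun _ _ h => h.eq hD.nonneg hD.balanced hy hb h0,
    fun A _ _ _ hp h => Composite.eq (hb A) (h0 A) hp h⟩

lemma Harmonic.isBalanced (hD : Tame w D) {y : Plane → ZMod 6 → ℝ} (hy : Harmonic w D y) :
    IsBalanced y := fun A k =>
  balanced_of_links (hD.nonneg A) (hD.balanced A) (hD.exists_eq_zero A) (hy.zero A)
    (fun k l h => hy.conn (A, k) (A, l) (.single (Or.inr ⟨rfl, h⟩))) (hy.comp A) k

/-- Being constant along the edges of `D` suffices for being a step function, because `D` has only
finitely many branch points. -/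
lemma Harmonic.isStep (hw : IsUnitTriple w) (hD : Tame w D) {y : Plane → ZMod 6 → ℝ}
    (hy : Harmonic w D y) : IsStep w y := by
  have hnb : ∀ A, NonBranch D A → ∀ k, y A k = y A (k + 3) := fun A ⟨i, hi⟩ k =>
    NonBranch.no_jump (hy.isBalanced hD) ⟨i, fun k h1 h2 => hy.zero _ _ (hi k h1 h2)⟩ k
  refine ⟨fun A k => ?_, fun k => (hD.step.lines k).subset ?_,
    (finite_branch hw hD.step).subset ?_⟩
  · have h := eventually_nonBranch hw hD.step A k
    rw [eventually_nhdsWithin_iff, Metric.eventually_nhds_iff] at h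
    obtain ⟨η, hη, h⟩ := h
    have h : ∀ s : ℝ, 0 < s → s < η → NonBranch D (A + s • dir w k) := fun s h0 h1 =>
      h (y := s) (by rw [Real.dist_eq, sub_zero, abs_of_pos h0]; exact h1) h0
    filter_upwards [Ioo_mem_nhdsGT hη] with s hs
    have h3 : y A k = y (A + s • dir w k) (k + 3) := hy.conn (A, k) (_, _)
      (.single (Or.inl ⟨s, hs.1, rfl, fun u h0 h1 => h u h0 (h1.trans hs.2)⟩))
    exact ⟨by rw [hnb _ (h s hs.1 hs.2), h3], h3.symm⟩
  · rintro b ⟨A, hA, rfl⟩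
    exact ⟨A, fun h => hA (hy.zero A k h), rfl⟩
  · rintro A ⟨k, hk⟩ h
    exact hk (hnb A h k)

/-- The class of `g` contains a composite germ. The classes without one are the roots. -/
def HasComposite (w : Fin 3 → Plane) (D : Plane → ZMod 6 → ℝ) (g : Plane × ZMod 6) : Prop :=
  ∃ h, Conn w D g h ∧ Composite (D h.1) h.2

lemma HasComposite.congr {g h : Plane × ZMod 6} (hc : Conn w D g h) (hg : HasComposite w D g) :
    HasComposite w D h := by
  obtain ⟨c, h1, h2⟩ := hg
  exact ⟨c, hc.symm.trans h1, h2⟩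

/-- Induction on the density of `D`: the two parts of a composite germ have smaller densities. -/
lemma Harmonic.eq_zero_of_roots (hD : Tame w D) {y : Plane → ZMod 6 → ℝ} (hy : Harmonic w D y)
    (hr : ∀ g, ¬HasComposite w D g → y g.1 g.2 = 0) (A : Plane) (k : ZMod 6) : y A k = 0 := by
  obtain ⟨ε, hε, hlow⟩ := hD.low
  have hDh := hD.harmonic hD.step hD.balanced fun _ _ h => h
  have key : ∀ (n : ℕ) (g : Plane × ZMod 6), D g.1 g.2 < n * ε → y g.1 g.2 = 0 := by
    intro n
    induction n with
    | zero =>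
      intro g hg
      rw [Nat.cast_zero, zero_mul] at hg
      exact absurd hg (not_lt.2 (hD.nonneg _ _))
    | succ n ih =>
      intro g hg
      by_cases hc : HasComposite w D g
      swap
      · exact hr g hc
      obtain ⟨⟨A, k⟩, h1, h2⟩ := hc
      obtain ⟨p, hp, hpp⟩ := h2.exists_pure (hD.exists_eq_zero A)
      have e1 := hDh.conn _ _ h1
      have e2 := hDh.comp A k p h2 hp hpp
      have l1 := hlow A (k + 3) h2.2.ne'
      have l2 := hlow A p hpp.1.1.ne'
      simp only at e1
      push_cast at hg
      rw [hy.conn _ _ h1, hy.comp A k p h2 hp hpp, ih (A, k + 3) (by simp only; linarith),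
        ih (A, p) (by simp only; linarith), add_zero]
  obtain ⟨n, hn⟩ := exists_nat_gt (D A k / ε)
  exact key n (A, k) (by rwa [div_lt_iff₀ hε] at hn)

/-- A pure germ next to the composite germ `k`. -/
def pureGerm (d : ZMod 6 → ℝ) (k : ZMod 6) : ZMod 6 :=
  Classical.epsilon fun p => (p = k + 2 ∨ p = k + 4) ∧ IsPure d p

/-- One step of the recursion which computes a solution of the equations of `Harmonic` from its
values `v` on the roots. -/
def extend (w : Fin 3 → Plane) (D : Plane → ZMod 6 → ℝ) (v f : Plane × ZMod 6 → ℝ)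
    (g : Plane × ZMod 6) : ℝ :=
  open Classical in
  if h : HasComposite w D g then
    f (h.choose.1, h.choose.2 + 3) + f (h.choose.1, pureGerm (D h.choose.1) h.choose.2)
  else v g

lemma Tame.pureGerm_spec (hD : Tame w D) {A : Plane} {k : ZMod 6} (h : Composite (D A) k) :
    (pureGerm (D A) k = k + 2 ∨ pureGerm (D A) k = k + 4) ∧ IsPure (D A) (pureGerm (D A) k) :=
  Classical.epsilon_spec (h.exists_pure (hD.exists_eq_zero A))

lemma Tame.extend_of_conn (hw : IsUnitTriple w) (hD : Tame w D) (v f : Plane × ZMod 6 → ℝ)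
    {g c : Plane × ZMod 6} (hc : Conn w D g c) (hcc : Composite (D c.1) c.2) :
    extend w D v f g = f (c.1, c.2 + 3) + f (c.1, pureGerm (D c.1) c.2) := by
  have h : HasComposite w D g := ⟨c, hc, hcc⟩
  have : h.choose = c := Conn.composite_unique hw hD.step hD.balanced hD.not_isBdAt
    (h.choose_spec.1.symm.trans hc) h.choose_spec.2 hcc
  rw [extend, dif_pos h, this]

/-- A solution can be cut down to a single root class. -/
lemma Harmonic.exists_restrict (hw : IsUnitTriple w) (hD : Tame w D) {m : Plane → ZMod 6 → ℝ}
    (hm : Harmonic w D m) (hm0 : ∀ A k, 0 ≤ m A k) (κ : Plane × ZMod 6) :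
    ∃ f, Harmonic w D f ∧ (∀ A k, 0 ≤ f A k) ∧ (∀ A k, f A k ≤ m A k) ∧
      (∀ g, ¬HasComposite w D g → Conn w D g κ → f g.1 g.2 = m g.1 g.2) ∧
      ∀ g, ¬HasComposite w D g → ¬Conn w D g κ → f g.1 g.2 = 0 := by
  classical
  obtain ⟨ε, hε, hlow⟩ := hD.low
  obtain ⟨C, hC⟩ := hD.bdd
  have hDh := hD.harmonic hD.step hD.balanced fun _ _ h => h
  -- the density of a composite germ exceeds those of its two parts by at least `ε`, so the
  -- recursion becomes stationary
  set v : Plane × ZMod 6 → ℝ := fun g => if Conn w D g κ then m g.1 g.2 else 0 with hv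
  set F : ℕ → Plane × ZMod 6 → ℝ := fun n => (extend w D v)^[n] 0 with hF
  have hsucc : ∀ n, F (n + 1) = extend w D v (F n) := fun n =>
    Function.iterate_succ_apply' _ _ _
  have hroot : ∀ n g, ¬HasComposite w D g → F (n + 1) g = v g := fun n g hg => by
    rw [hsucc, extend, dif_neg hg]
  have hcomp : ∀ n {g c : Plane × ZMod 6}, Conn w D g c → Composite (D c.1) c.2 →
      F (n + 1) g = F n (c.1, c.2 + 3) + F n (c.1, pureGerm (D c.1) c.2) := fun n g c hc hcc => by
    rw [hsucc, hD.extend_of_conn hw v _ hc hcc]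
  have hbd : ∀ n g, 0 ≤ F n g ∧ F n g ≤ m g.1 g.2 := by
    intro n
    induction n with
    | zero => exact fun g => ⟨le_rfl, hm0 _ _⟩
    | succ n ih =>
      intro g
      by_cases hg : HasComposite w D g
      · obtain ⟨c, hc, hcc⟩ := hg
        obtain ⟨hp, hpp⟩ := hD.pureGerm_spec hcc
        rw [hcomp n hc hcc, hm.conn _ _ hc, hm.comp _ _ _ hcc hp hpp]
        exact ⟨add_nonneg (ih _).1 (ih _).1, add_le_add (ih _).2 (ih _).2⟩
      · rw [hroot n g hg, hv]
        simp only
        split_ifs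
        · exact ⟨hm0 _ _, le_rfl⟩
        · exact ⟨le_rfl, hm0 _ _⟩
  have hconn : ∀ n g h, Conn w D g h → F n g = F n h := by
    intro n g h hgh
    cases n with
    | zero => rfl
    | succ n =>
      by_cases hg : HasComposite w D g
      · obtain ⟨c, hc, hcc⟩ := hg
        rw [hcomp n hc hcc, hcomp n (hgh.symm.trans hc) hcc]
      · rw [hroot n g hg, hroot n h fun hh => hg (hh.congr hgh.symm), hv]
        simp only
        rw [hm.conn _ _ hgh, show Conn w D g κ = Conn w D h κ from
          propext ⟨hgh.symm.trans, hgh.trans⟩]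
  have hstab : ∀ (n : ℕ) (g : Plane × ZMod 6), D g.1 g.2 < n * ε → F (n + 1) g = F n g := by
    intro n
    induction n with
    | zero =>
      intro g hg
      rw [Nat.cast_zero, zero_mul] at hg
      exact absurd hg (not_lt.2 (hD.nonneg _ _))
    | succ n ih =>
      intro g hg
      by_cases hc : HasComposite w D g
      swap
      · rw [hroot _ g hc, hroot _ g hc]
      obtain ⟨⟨A, k⟩, h1, h2⟩ := hc
      obtain ⟨hp, hpp⟩ := hD.pureGerm_spec h2
      have e1 := hDh.conn _ _ h1
      have e2 := hDh.comp A k _ h2 hp hpp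
      have l1 := hlow A (k + 3) h2.2.ne'
      have l2 := hlow A _ hpp.1.1.ne'
      simp only at e1
      push_cast at hg
      rw [hcomp (n + 1) h1 h2, hcomp n h1 h2, ih (A, k + 3) (by simp only; linarith),
        ih (A, _) (by simp only; linarith)]
  obtain ⟨N, hN⟩ := exists_nat_gt (C / ε)
  rw [div_lt_iff₀ hε] at hN
  have hfix : ∀ g, F (N + 1) g = F N g := fun g => hstab N g ((hC _ _).trans_lt hN)
  refine ⟨fun A k => F N (A, k), ⟨fun A k h => ?_, fun g h => hconn N g h, ?_⟩,
    fun A k => (hbd N _).1, fun A k => (hbd N _).2, fun g hg hc => ?_, fun g hg hc => ?_⟩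
  · have := hbd N (A, k)
    rw [hm.zero A k h] at this
    exact le_antisymm this.2 this.1
  · intro A k p hc hp hpp
    obtain ⟨hq, hqq⟩ := hD.pureGerm_spec hc
    have : F N (A, pureGerm (D A) k) = F N (A, p) := by
      by_cases h : p = pureGerm (D A) k
      · rw [h]
      refine hconn N _ _ (.single (Or.inr ⟨rfl, Or.inr ⟨hqq, hpp, ?_⟩⟩))
      have e : ∀ k p q : ZMod 6, (p = k + 2 ∨ p = k + 4) → (q = k + 2 ∨ q = k + 4) → p ≠ q →
        p = q + 2 ∨ p = q + 4 := by decide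
      exact e k p _ hp hq h
    rw [← hfix (A, k), hcomp N .refl hc, this]
  · change F N g = _
    rw [← hfix g, hroot N g hg, hv]
    exact if_pos hc
  · change F N g = _
    rw [← hfix g, hroot N g hg, hv]
    exact if_neg hc

/-! ### Extremal measures below a tame density -/

/-- A measure in `𝓜` whose germ densities are not larger than those of `m` and which is balanced
is realized below `m`. -/
lemma exists_measure_le (hw : IsUnitTriple w) {m : Measure Plane} (hm : HasStepDensity w m)
    {f : Plane → ZMod 6 → ℝ} (hf : IsStep w f) (hb : IsBalanced f) (h0 : ∀ A k, 0 ≤ f A k)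
    (hle : ∀ A k, f A k ≤ germ w m A k) : ∃ ν ∈ cone w, ν ≤ m ∧ germ w ν = f := by
  classical
  obtain ⟨L₀, hL₀⟩ := (isRep_germ hw hm).eq
  obtain ⟨L₁, hL₁⟩ := hf.exists_carries
  have hL := hL₁.mono (L' := L₀ ∪ L₁) Finset.subset_union_right
  have hg := germ_lineSum hw hf h0 hL
  refine ⟨lineSum w (L₀ ∪ L₁) f, (mem_cone_iff _).2 ⟨hasStepDensity_lineSum hw hf _, ?_⟩, ?_, hg⟩
  · rw [hg]; exact hb
  · rw [hL₀ (L₀ ∪ L₁) Finset.subset_union_left]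
    exact lineSum_mono hle _

/-- An extremal measure is supported by one root class. -/
lemma IsExtremal.exists_root (hw : IsUnitTriple w) (hD : Tame w D) {m : Measure Plane}
    (hm : IsExtremal w m) (hmD : ∀ A k, germ w m A k ≤ D A k) :
    Harmonic w D (germ w m) ∧ ∃ κ, ¬HasComposite w D κ ∧ germ w m κ.1 κ.2 ≠ 0 ∧
      ∀ g, ¬HasComposite w D g → ¬Conn w D g κ → germ w m g.1 g.2 = 0 := by
  obtain ⟨hc, hne, hext⟩ := hm
  obtain ⟨hsd, hb⟩ := (mem_cone_iff m).1 hc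
  have hrep := isRep_germ hw hsd
  have hh : Harmonic w D (germ w m) := hD.harmonic hrep.step hb fun A k h =>
    le_antisymm ((hmD A k).trans_eq h) (hrep.nonneg A k)
  refine ⟨hh, ?_⟩
  obtain ⟨κ, hκ, hκm⟩ : ∃ κ, ¬HasComposite w D κ ∧ germ w m κ.1 κ.2 ≠ 0 := by
    by_contra! hcon
    refine hne (eq_of_germ_eq hw hsd HasStepDensity.zero ?_)
    rw [(IsRep.zero (w := w)).germ_eq hw]
    ext A k
    exact hh.eq_zero_of_roots hD hcon A k
  refine ⟨κ, hκ, hκm, fun g hg hgκ => ?_⟩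
  obtain ⟨f, hf, hf0, hfm, hfin, hfout⟩ := hh.exists_restrict hw hD hrep.nonneg κ
  obtain ⟨ν, hν, hνm, hνf⟩ := exists_measure_le hw hsd (hf.isStep hw hD) (hf.isBalanced hD) hf0 hfm
  obtain ⟨c, rfl⟩ := hext ν hν hνm
  have hcm : ∀ A k, f A k = c * germ w m A k := by
    rw [← hνf, (hrep.smul hw c).germ_eq hw]; exact fun _ _ => rfl
  have h1 := hfin κ hκ .refl
  rw [hcm] at h1
  have hc1 : (c : ℝ) = 1 := mul_right_cancel₀ hκm (by rw [h1, one_mul])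
  have h2 := hfout g hg hgκ
  rwa [hcm, hc1, one_mul] at h2

/-- Mutually inequivalent extremal measures below a tame density have linearly independent germ
densities. -/
lemma eq_zero_of_sum_germ (hw : IsUnitTriple w) (hD : Tame w D) {ι : Type*} [Fintype ι]
    {m : ι → Measure Plane} (hext : ∀ j, IsExtremal w (m j))
    (hineq : ∀ i j, i ≠ j → Inequivalent (m i) (m j))
    (hmD : ∀ j A k, germ w (m j) A k ≤ D A k) {c : ι → ℝ}
    (hsum : ∀ A k, ∑ j, c j * germ w (m j) A k = 0) (j : ι) : c j = 0 := by
  choose hh κ hκ hκm hout using fun j => (hext j).exists_root hw hD (hmD j)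
  have hrep := fun j => isRep_germ hw ((mem_cone_iff _).1 (hext j).1).1
  have hdist : ∀ i, i ≠ j → germ w (m i) (κ j).1 (κ j).2 = 0 := by
    intro i hij
    by_contra h
    have hji : Conn w D (κ j) (κ i) := by
      by_contra hn
      exact h (hout i _ (hκ j) hn)
    set a := germ w (m i) (κ j).1 (κ j).2 with ha
    set b := germ w (m j) (κ j).1 (κ j).2 with hb
    have hb0 : b ≠ 0 := hκm j
    have ha0 : 0 ≤ a := (hrep i).nonneg _ _
    have hb1 : 0 ≤ b := (hrep j).nonneg _ _
    -- the multiple is chosen such that the difference vanishes on the common root class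
    set y : Plane → ZMod 6 → ℝ := fun A k => germ w (m i) A k + -(a / b) * germ w (m j) A k
      with hy
    have hyh : Harmonic w D y := by
      refine hD.harmonic ((hrep i).step.add ((hrep j).step.smul _))
        (((hh i).isBalanced hD).add (((hh j).isBalanced hD).smul _)) fun A k h0 => ?_
      simp only [hy]
      rw [(hh i).zero A k h0, (hh j).zero A k h0, mul_zero, add_zero]
    have hy0 := hyh.eq_zero_of_roots hD fun g hg => by
      by_cases hgc : Conn w D g (κ j)
      · rw [hyh.conn _ _ hgc]
        simp only [hy]
        rw [← ha, ← hb]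
        field_simp
        ring
      · have hgi : ¬Conn w D g (κ i) := fun h => hgc (h.trans hji.symm)
        simp only [hy]
        rw [hout i g hg hgi, hout j g hg hgc, mul_zero, add_zero]
    obtain ⟨q, hq⟩ : ∃ q : ℝ≥0, (q : ℝ) = a / b := ⟨⟨a / b, div_nonneg ha0 hb1⟩, rfl⟩
    refine (hineq i j hij).1 q ?_
    refine eq_of_germ_eq hw ((mem_cone_iff _).1 (hext i).1).1
      (((hrep j).smul hw q).hasStepDensity hw) ?_
    rw [((hrep j).smul hw q).germ_eq hw]
    ext A k
    have := hy0 A k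
    simp only [hy] at this
    rw [hq]
    linarith
  have := hsum (κ j).1 (κ j).2
  rw [Finset.sum_eq_single j (fun i _ hij => by rw [hdist i hij, mul_zero])
    (fun h => absurd (Finset.mem_univ j) h)] at this
  exact (mul_eq_zero.1 this).resolve_right (hκm j)

end

section

variable {w : Fin 3 → Plane} {D E : Plane → ZMod 6 → ℝ}

/-! ### Flux -/

/-- Let `g t` and `h t` be the densities to the right and to the left of `t` of a step function
with jumps in `S` which vanishes near `-∞`. Then the density is the sum of the previous jumps. -/
lemma sum_jumps {g h : ℝ → ℝ} {S : Finset ℝ}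
    (hc : ∀ a b, a < b → (∀ s ∈ S, a < s → b ≤ s) → h b = g a) {T₀ : ℝ}
    (h0 : ∀ t < T₀, g t = 0) {T : ℝ} (hT : ∀ s ∈ S, s < T) : h T = ∑ s ∈ S, (g s - h s) := by
  have key : ∀ S' : Finset ℝ, ∀ T, (∀ s ∈ S', s < T) → (∀ s ∈ S, s < T → s ∈ S') →
      S' ⊆ S → h T = ∑ s ∈ S', (g s - h s) := by
    intro S'
    induction S' using Finset.induction_on_max with
    | empty =>
      intro T _ h2 _
      rw [Finset.sum_empty, hc (min T T₀ - 1) T (by linarith [min_le_left T T₀]) fun s hs _ =>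
        not_lt.1 fun hsT => absurd (h2 s hs hsT) (Finset.notMem_empty s)]
      exact h0 _ (by linarith [min_le_right T T₀])
    | insert a S' hmax ih =>
      intro T h1 h2 h3
      have ha : a ∉ S' := fun h => lt_irrefl a (hmax a h)
      rw [Finset.sum_insert ha, hc a T (h1 a (Finset.mem_insert_self _ _)) fun s hs has =>
        not_lt.1 fun hsT => ?_, ← ih a hmax (fun s hs hsa => ?_)
        ((Finset.subset_insert _ _).trans h3)]
      · ring
      · have h4 := h2 s hs (hsa.trans (h1 a (Finset.mem_insert_self _ _)))
        exact (Finset.mem_insert.1 h4).resolve_left hsa.ne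
      · rcases Finset.mem_insert.1 (h2 s hs hsT) with h | h
        · exact has.ne' h
        · exact lt_asymm has (hmax s h)
  exact key S T hT (fun s hs _ => hs) subset_rfl

/-- The source at a point: the common value of the differences of opposite densities. -/
def source (E : Plane → ZMod 6 → ℝ) (A : Plane) : ℝ := E A 0 - E A 3

lemma IsBalanced.source_eq (hb : IsBalanced E) (A : Plane) (j : Fin 3) :
    E A (ev j) - E A (ev j + 3) = source E A := by
  have h1 := hb A 0
  have h2 := hb.four A 0
  simp only [zero_add] at h1 h2
  fin_cases j
  · rfl
  · exact h1.symm
  · exact h2.symm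

/-- The density at the far end of a line is the sum of the sources on this line. -/
lemma IsStep.sum_source (hw : IsUnitTriple w) (hE : IsStep w E) (hb : IsBalanced E) (j : Fin 3)
    (b : ℝ) {T₀ : ℝ} (h0 : ∀ t < T₀, E (linePt w j b t) (ev j) = 0) :
    ∀ᶠ T in atTop, E (linePt w j b T) (ev j) =
      ∑ A ∈ hE.jumps.toFinset with ht w (ev j) A = b, source E A := by
  classical
  set J := hE.jumps.toFinset.filter fun A => ht w (ev j) A = b with hJ
  set S := J.image (pos w j) with hS
  have hline : ∀ A ∈ J, linePt w j b (pos w j A) = A := by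
    intro A hA
    have := (Finset.mem_filter.1 hA).2
    conv_lhs => rw [← this]
    exact linePt_pos hw j A
  have hnj : ∀ t, t ∉ S → E (linePt w j b t) (ev j) = E (linePt w j b t) (ev j + 3) := by
    intro t ht
    by_contra h
    refine ht (Finset.mem_image.2 ⟨linePt w j b t, ?_, pos_linePt hw j b t⟩)
    rw [hJ, Finset.mem_filter, Set.Finite.mem_toFinset]
    exact ⟨⟨_, h⟩, ht_linePt hw j b t⟩
  have hev : ∀ᶠ T : ℝ in atTop, ∀ s ∈ S, s < T :=
    (Filter.eventually_all_finset S).2 fun s _ => eventually_gt_atTop s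
  filter_upwards [hev] with T hT
  rw [hnj T fun h => lt_irrefl _ (hT T h)]
  have h := sum_jumps (g := fun t => E (linePt w j b t) (ev j))
    (h := fun t => E (linePt w j b t) (ev j + 3)) (S := S) ?_ h0 hT
  · rw [h, hS, Finset.sum_image]
    · refine Finset.sum_congr rfl fun A hA => ?_
      rw [hline A hA, hb.source_eq]
    · intro A hA B hB hAB
      rw [← hline A hA, ← hline B hB, hAB]
  · intro a c hac hs
    have := (hE.const (A := linePt w j b a) (k := ev j) (sub_pos.2 hac) fun s h1 h2 => ?_).2
    · rwa [← linePt_add, add_sub_cancel] at this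
    · rw [← linePt_add]
      refine hnj _ fun hmem => ?_
      have := hs _ hmem (by linarith)
      linarith

lemma abs_ht_le (hw : IsUnitTriple w) {r : ℝ} (hr : 0 < r) {A : Plane} (hA : A ∈ triangle w r)
    (k : ZMod 6) : |ht w k A| ≤ r := by
  obtain ⟨h0, h2, h4⟩ := (mem_triangle_iff hw hr A).1 hA
  have e2 := ht_add_two hw 0 A
  have e4 := ht_add_four w 0 A
  have e3 := ht_add_three w 0 A
  have e5 := ht_add_three w 2 A
  rw [zero_add] at e2 e4 e3
  rw [show (2 : ZMod 6) + 3 = 5 from rfl] at e5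
  rw [zero_add] at e2 e4
  rw [abs_le]
  rcases six_cases k with rfl | rfl | rfl | rfl | rfl | rfl <;> constructor <;> linarith

/-- The nonzero values of a balanced step function with support in the support of `D` are
transported to infinity along the half-lines leaving the triangle. -/
lemma InTriangle.ray_const {r : ℝ} (hD : InTriangle w r D)
    (hE : IsStep w E) (hb : IsBalanced E) (h0 : ∀ A k, D A k = 0 → E A k = 0)
    {j : Fin 3} {P : Plane} (hP : ∀ s : ℝ, 0 < s → P + s • w j ∉ triangle w r) {t : ℝ}
    (ht : 0 < t) : E (P + t • w j) (ev j) = E P (ev j) ∧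
      E (P + t • w j) (ev j + 3) = E P (ev j) := by
  have hnj : ∀ s : ℝ, 0 < s → E (P + s • dir w (ev j)) (ev j) =
      E (P + s • dir w (ev j)) (ev j + 3) := by
    intro s hs
    obtain ⟨i, hi⟩ := hD.nonBranch _ (hP s hs)
    rw [dir_ev]
    exact NonBranch.no_jump hb ⟨i, fun k h1 h2 => h0 _ _ (hi k h1 h2)⟩ _
  have := (hE.const ht fun s h1 _ => hnj s h1).2
  have h2 := hnj t ht
  rw [dir_ev] at this h2
  exact ⟨h2.trans this, this⟩

/-- Let a balanced step function with support in the support of `D` vanish at all exits, except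
possibly at the corners where the leaving half-line extends a side. Then it vanishes outside the
triangle: the sums of the sources and of their moments show that its total flux is zero. -/
lemma InTriangle.eq_zero_outside (hw : IsUnitTriple w) {r : ℝ} (hr : 0 < r)
    (hD : InTriangle w r D) (hE : IsStep w E) (hb : IsBalanced E)
    (h0 : ∀ A k, D A k = 0 → E A k = 0)
    (hexit : ∀ j P, P ∈ triangle w r → (∀ s : ℝ, 0 < s → P + s • w j ∉ triangle w r) →
      ht w (ev j) P ≠ bnd r (ev j) → E P (ev j) = 0)
    (A : Plane) (hA : A ∉ triangle w r) (k : ZMod 6) : E A k = 0 := by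
  classical
  have exits : ∀ j b t, (t < -r ∨ r < t) → E (linePt w j b t) (ev j) ≠ 0 →
      ∃ (P : Plane) (s : ℝ), P ∈ triangle w r ∧ (∀ s : ℝ, 0 < s → P + s • w j ∉ triangle w r) ∧
        0 < s ∧ linePt w j b t = P + s • w j := by
    intro j b t hbt hne
    have hout : linePt w j b t ∉ triangle w r := by
      intro h
      have h1 := abs_le.1 (abs_ht_le hw hr h (ev j + 1))
      have h2 := pos_linePt hw j b t
      rw [pos] at h2
      rcases hbt with h | h <;> linarith [h1.1, h1.2]
    obtain ⟨j', P, s, h1, h2, h3, h4, h5⟩ := hD.exits _ _ hout fun h => hne (h0 _ _ h)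
    obtain rfl := ev_inj (Or.inl rfl) h5
    exact ⟨P, s, h1, h2, h3, h4⟩
  -- the support contains no half-line in direction `-w j`
  have far : ∀ j b, ∀ t < -r, E (linePt w j b t) (ev j) = 0 := by
    intro j b t htr
    by_contra hne
    obtain ⟨P, s, h1, -, h3, h4⟩ := exits j b t (Or.inl htr) hne
    have h5 := abs_le.1 (abs_ht_le hw hr h1 (ev j + 1))
    have h6 := pos_linePt hw j b t
    rw [h4, ← dir_ev w j, pos_add hw, pos] at h6
    linarith [h5.2]
  set J := hE.jumps.toFinset with hJ
  have hsum := fun j b => hE.sum_source hw hb j b (far j b)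
  rw [← hJ] at hsum
  have hzero : ∀ j b, b ≠ bnd r (ev j) → ∑ A ∈ J with ht w (ev j) A = b, source E A = 0 := by
    intro j b hbj
    obtain ⟨T, h1, h2⟩ := ((hsum j b).and (eventually_gt_atTop r)).exists
    rw [← h1]
    by_contra hne
    obtain ⟨P, s, h3, h4, h5, h6⟩ := exits j b T (Or.inr h2) hne
    have h7 : ht w (ev j) P = b := by
      rw [← ht_linePt hw j b T, h6, ← dir_ev w j, ht_along]
    rw [h6, (hD.ray_const hE hb h0 h4 h5).1] at hne
    exact hne (hexit j P h3 h4 (by rw [h7]; exact hbj))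
  -- all flux in direction `w j` is at height `bnd r (ev j)`
  have hmoment : ∀ j, ∑ A ∈ J, (ht w (ev j) A - bnd r (ev j)) * source E A = 0 := by
    intro j
    rw [← Finset.sum_fiberwise_of_maps_to (g := ht w (ev j)) (t := J.image (ht w (ev j)))
      fun A hA => Finset.mem_image_of_mem _ hA]
    refine Finset.sum_eq_zero fun b _ => ?_
    have : ∑ A ∈ J with ht w (ev j) A = b, (ht w (ev j) A - bnd r (ev j)) * source E A =
        (b - bnd r (ev j)) * ∑ A ∈ J with ht w (ev j) A = b, source E A := by
      rw [Finset.mul_sum]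
      exact Finset.sum_congr rfl fun A hA => by rw [(Finset.mem_filter.1 hA).2]
    rw [this]
    by_cases h : b = bnd r (ev j)
    · rw [h, sub_self, zero_mul]
    · rw [hzero j b h, mul_zero]
  -- the three heights of a point add up to zero, and the bounds `bnd` to `-r`
  have htotal : ∑ A ∈ J, source E A = 0 := by
    have h1 : ∑ A ∈ J, r * source E A = 0 := by
      have h2 : ∑ A ∈ J, ((ht w (ev 0) A - bnd r (ev 0)) * source E A +
          (ht w (ev 1) A - bnd r (ev 1)) * source E A +
          (ht w (ev 2) A - bnd r (ev 2)) * source E A) = 0 := by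
        rw [Finset.sum_add_distrib, Finset.sum_add_distrib, hmoment, hmoment, hmoment]; simp
      rw [← h2]
      refine Finset.sum_congr rfl fun A _ => ?_
      have a : bnd r (ev 0) = 0 := by rw [bnd, if_neg (by decide)]
      have b : bnd r (ev 1) = -r := by rw [bnd, if_pos (by decide)]
      have c : bnd r (ev 2) = 0 := by rw [bnd, if_neg (by decide)]
      have e2 := ht_add_two hw 0 A
      have e4 := ht_add_four w 0 A
      rw [zero_add] at e2 e4
      rw [zero_add] at e2 e4
      rw [a, b, c, show ev 0 = 0 from rfl, show ev 1 = 2 from rfl, show ev 2 = 4 from rfl, e2, e4]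
      ring
    rw [← Finset.mul_sum] at h1
    exact (mul_eq_zero.1 h1).resolve_left hr.ne'
  have hall : ∀ j b, ∑ A ∈ J with ht w (ev j) A = b, source E A = 0 := by
    intro j b
    by_cases h : b = bnd r (ev j)
    swap
    · exact hzero j b h
    rw [← htotal, ← Finset.sum_fiberwise_of_maps_to (s := J) (g := ht w (ev j))
      (t := insert b (J.image (ht w (ev j)))) fun A hA =>
        Finset.mem_insert_of_mem (Finset.mem_image_of_mem _ hA)]
    refine (Finset.sum_eq_single b (fun c _ hc => hzero j c (by rw [← h]; exact hc)) fun hc =>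
      absurd (Finset.mem_insert_self _ _) hc).symm
  by_contra hne
  obtain ⟨j, P, t, h1, h2, h3, rfl, h5⟩ := hD.exits A k hA fun h => hne (h0 _ _ h)
  have hPE : E P (ev j) ≠ 0 := by
    have := hD.ray_const hE hb h0 h2 h3
    rcases h5 with rfl | rfl
    · rwa [this.1] at hne
    · rwa [this.2] at hne
  obtain ⟨T, h6, h7⟩ := ((hsum j (ht w (ev j) P)).and (eventually_gt_atTop (pos w j P))).exists
  rw [hall] at h6
  have h8 : linePt w j (ht w (ev j) P) T = P + (T - pos w j P) • w j := by
    have h9 := linePt_add w j (ht w (ev j) P) (pos w j P) (T - pos w j P)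
    rwa [linePt_pos hw, dir_ev, add_sub_cancel] at h9
  rw [h8, (hD.ray_const hE hb h0 h2 (sub_pos.2 h7)).1] at h6
  exact hPE h6

/-! ### Exit points and attachment points -/

lemma mem_exitPoints (hw : IsUnitTriple w) {r : ℝ} (hr : 0 < r) {μ : Measure Plane}
    (hμ : μ ∈ coneIn w r) {j : Fin 3} {P : Plane} (hP : P ∈ triangle w r)
    (hout : ∀ s : ℝ, 0 < s → P + s • w j ∉ triangle w r) (h : germ w μ P (ev j) ≠ 0) :
    (j, P) ∈ exitPoints w r μ := by
  have hsd := ((mem_cone_iff μ).1 hμ.1).1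
  have hin := inTriangle_germ hw hr hμ
  refine ⟨mem_frontier_of_leaves hP hout, ?_⟩
  rintro _ ⟨t, ht, rfl⟩
  refine ⟨(mem_support_iff_germ hw hsd _).2 ⟨ev j, ?_⟩, hout t ht⟩
  rwa [(hin.ray_const hin.step hin.balanced (fun _ _ h => h) hout ht).1]

lemma ht_vertex (hw : IsUnitTriple w) (r : ℝ) :
    (ht w 0 (vertex w r 0) = 0 ∧ ht w 2 (vertex w r 0) = -r ∧ ht w 4 (vertex w r 0) = r) ∧
    (ht w 0 (vertex w r 1) = r ∧ ht w 2 (vertex w r 1) = -r ∧ ht w 4 (vertex w r 1) = 0) ∧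
    (ht w 0 (vertex w r 2) = 0 ∧ ht w 2 (vertex w r 2) = 0 ∧ ht w 4 (vertex w r 2) = 0) := by
  have v0 : vertex w r 0 = r • dir w 0 := rfl
  have v1 : vertex w r 1 = r • dir w 1 := by
    have h : dir w 1 = -w 2 := rfl
    have h' : vertex w r 1 = r • (w 0 + w 1) := rfl
    rw [h', h, hw.two_eq]; module
  have v2 : vertex w r 2 = 0 := rfl
  have a1 : ht w 0 (dir w 0) = 0 := ht_dir w 0
  have a2 : ht w 2 (dir w 0) = -1 := ht_dir_four hw 2
  have a3 : ht w 4 (dir w 0) = 1 := ht_dir_two hw 4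
  have b1 : ht w 0 (dir w 1) = 1 := ht_dir_one hw 0
  have b2 : ht w 2 (dir w 1) = -1 := ht_dir_five hw 2
  have b3 : ht w 4 (dir w 1) = 0 := ht_dir_three w 4
  rw [v0, v1, v2]
  simp only [map_smul, map_zero, a1, a2, a3, b1, b2, b3, smul_eq_mul]
  refine ⟨⟨?_, ?_, ?_⟩, ⟨?_, ?_, ?_⟩, ?_⟩ <;> simp

/-- An exit point is an attachment point unless it is a corner where the leaving half-line extends
a side. -/
lemma mem_attachmentPoints (hw : IsUnitTriple w) {r : ℝ} (hr : 0 < r) {μ : Measure Plane}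
    {j : Fin 3} {P : Plane} (h : (j, P) ∈ exitPoints w r μ)
    (h2 : ht w (ev j + 2) P = bnd r (ev j + 2)) (hne : ht w (ev j) P ≠ bnd r (ev j)) :
    (j, P) ∈ attachmentPoints w r μ := by
  refine ⟨h, ?_⟩
  by_cases hv : ∃ i, P = vertex w r i
  swap
  · left; push Not at hv; exact hv
  obtain ⟨i, rfl⟩ := hv
  refine Or.inr ⟨i, rfl, ?_⟩
  obtain ⟨⟨a0, a2, a4⟩, ⟨b0, b2, b4⟩, c0, c2, c4⟩ := ht_vertex hw r
  have n0 : bnd r 0 = 0 := by rw [bnd, if_neg (by decide)]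
  have n2 : bnd r 2 = -r := by rw [bnd, if_pos rfl]
  have n4 : bnd r 4 = 0 := by rw [bnd, if_neg (by decide)]
  fin_cases j
  · change ht w 2 (vertex w r i) = bnd r 2 at h2
    change ht w 0 (vertex w r i) ≠ bnd r 0 at hne
    rw [n2] at h2
    rw [n0] at hne
    fin_cases i
    · exact absurd a0 hne
    · exact ⟨r, show r • w 0 - 0 = r • w 0 from sub_zero _⟩
    · exact absurd (c2.symm.trans h2) (by linarith)
  · change ht w 4 (vertex w r i) = bnd r 4 at h2
    change ht w 2 (vertex w r i) ≠ bnd r 2 at hne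
    rw [n4] at h2
    rw [n2] at hne
    fin_cases i
    · exact absurd (a4.symm.trans h2) hr.ne'
    · exact absurd b2 hne
    · exact ⟨r, show r • (w 0 + w 1) - r • w 0 = _ by change _ = r • w 1; module⟩
  · change ht w 0 (vertex w r i) = bnd r 0 at h2
    change ht w 4 (vertex w r i) ≠ bnd r 4 at hne
    rw [n0] at h2
    rw [n4] at hne
    fin_cases i
    · refine ⟨r, show 0 - r • (w 0 + w 1) = r • w 2 from ?_⟩
      rw [hw.two_eq]; module
    · exact absurd (b0.symm.trans h2) hr.ne'
    · exact absurd c4 hne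

/-- Each line parallel to `w j` in the support contains at most one exit point with
direction `j`. -/
lemma finite_exitPoints (hw : IsUnitTriple w) {r : ℝ} (hr : 0 < r) {μ : Measure Plane}
    (hμ : μ ∈ coneIn w r) : (exitPoints w r μ).Finite := by
  have hin := inTriangle_germ hw hr hμ
  have hsd := ((mem_cone_iff μ).1 hμ.1).1
  refine Set.Finite.of_finite_image (f := fun p => (p.1, ht w (ev p.1) p.2))
    ((Set.finite_univ.prod (Set.finite_iUnion fun j => hin.step.lines (ev j))).subset ?_) ?_
  · rintro _ ⟨⟨j, P⟩, ⟨-, hs⟩, rfl⟩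
    refine ⟨mem_univ _, mem_iUnion.2 ⟨j, ?_⟩⟩
    obtain ⟨s, h, hs0⟩ := ((hin.step.eventually_only hw P (ev j)).and self_mem_nhdsWithin).exists
    have hmem : P + s • dir w (ev j) ∈ μ.support \ triangle w r :=
      hs ⟨s, hs0, by rw [dir_ev]⟩
    refine ⟨P + s • dir w (ev j), fun hz => ?_, ht_along w _ P s⟩
    obtain ⟨k, hk⟩ := (mem_support_iff_germ hw hsd _).1 hmem.1
    have hz3 := (hin.nonBranch _ hmem.2).no_jump hin.balanced (ev j)
    rw [hz] at hz3
    by_cases h1 : k = ev j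
    · exact hk (h1 ▸ hz)
    by_cases h2 : k = ev j + 3
    · exact hk (h2 ▸ hz3.symm)
    exact hk (h k h1 h2)
  · have key : ∀ (j : Fin 3) (P Q : Plane), P ∈ triangle w r →
        (∀ s : ℝ, 0 < s → Q + s • w j ∉ triangle w r) → ∀ s : ℝ, P = Q + s • dir w (ev j) →
        s ≤ 0 := by
      intro j P Q hP hQ s hs
      by_contra h
      rw [dir_ev] at hs
      exact hQ s (not_le.1 h) (hs ▸ hP)
    rintro ⟨j, P⟩ ⟨hP, hPs⟩ ⟨j', Q⟩ ⟨hQ, hQs⟩ h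
    simp only [Prod.mk.injEq] at h
    obtain ⟨rfl, h⟩ := h
    obtain ⟨s, hs⟩ := exists_along hw h
    have hP := frontier_subset_triangle hw hr hP
    have hQ := frontier_subset_triangle hw hr hQ
    have h1 := key j P Q hP (fun s hs => (hQs ⟨s, hs, rfl⟩).2) s hs
    have h2 := key j Q P hQ (fun s hs => (hPs ⟨s, hs, rfl⟩).2) (-s) (by rw [hs]; module)
    have h3 : s = 0 := le_antisymm h1 (by linarith)
    rw [hs, h3, zero_smul, add_zero]

/-! ### Linear independence -/

lemma IsRigid.tame (hw : IsUnitTriple w) {r : ℝ} (hr : 0 < r) {μ : Measure Plane}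
    (hμ : IsRigid w r μ) : Tame w (germ w μ) := by
  have hin := inTriangle_germ hw hr hμ.1
  have hrep := isRep_germ hw ((mem_cone_iff μ).1 hμ.1.1).1
  exact ⟨hin.step, hin.nonneg, hin.balanced, hrep.bdd, hrep.low, hμ.exists_germ_eq_zero hw hr,
    hμ.not_isBdAt hw hr⟩

/-- A combination of measures below a rigid measure whose densities at the attachment points
vanish is zero. -/
lemma IsRigid.eq_zero_of_attachmentPoints (hw : IsUnitTriple w) {r : ℝ} (hr : 0 < r)
    {μ : Measure Plane} (hμ : IsRigid w r μ) {E : Plane → ZMod 6 → ℝ} (hE : IsStep w E)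
    (hb : IsBalanced E) {C : ℝ} (hC : ∀ A k, -C ≤ E A k)
    (h0 : ∀ A k, germ w μ A k = 0 → E A k = 0)
    (hatt : ∀ p ∈ attachmentPoints w r μ, E p.2 (ev p.1) = 0) (A : Plane) (k : ZMod 6) :
    E A k = 0 := by
  have hin := inTriangle_germ hw hr hμ.1
  refine hμ.eq_zero hw hE hb hC (fun A k h => (h0 A k h).ge) (fun A hA k =>
    hin.eq_zero_outside hw hr hE hb h0 (fun j P hP hout hne => ?_) A hA k) A k
  by_contra h
  exact h (hatt (j, P) (mem_attachmentPoints hw hr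
    (mem_exitPoints hw hr hμ.1 hP hout fun h' => h (h0 _ _ h')) (ht_eq_of_leaves hw hr hP hout)
    hne))

/-- A linear relation between the vectors of exit densities extends to the germ densities of the
measures, which are linearly independent. -/
lemma IsRigid.linearIndependent (hw : IsUnitTriple w) {r : ℝ} (hr : 0 < r) {μ : Measure Plane}
    (hμ : IsRigid w r μ) {k : ℕ} {m : Fin k → Measure Plane} (hext : ∀ j, IsExtremal w (m j))
    (hineq : ∀ i j, i ≠ j → Inequivalent (m i) (m j)) (hsum : μ = ∑ j, m j) {q : ℕ}
    {A : Fin q → Fin 3 × Plane} (hA : range A = attachmentPoints w r μ) :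
    LinearIndependent ℝ (fun (j : Fin k) (i : Fin q) => exitDensity w (m j) (A i)) := by
  have hrep := fun j => isRep_germ hw ((mem_cone_iff _).1 (hext j).1).1
  have hbal := fun j => ((mem_cone_iff _).1 (hext j).1).2
  have hgerm : germ w μ = fun B i => ∑ j, germ w (m j) B i := by
    rw [hsum]
    exact (IsRep.sum hw Finset.univ fun j _ => hrep j).germ_eq hw
  have hle : ∀ j B i, germ w (m j) B i ≤ germ w μ B i := fun j B i => by
    rw [hgerm]
    exact Finset.single_le_sum (f := fun j => germ w (m j) B i)
      (fun j _ => (hrep j).nonneg B i) (Finset.mem_univ j)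
  rw [Fintype.linearIndependent_iff]
  intro c hc
  refine eq_zero_of_sum_germ hw (hμ.tame hw hr) hext hineq hle ?_
  obtain ⟨C, hC⟩ := (hμ.tame hw hr).bdd
  refine hμ.eq_zero_of_attachmentPoints hw hr
    (IsStep.sum Finset.univ fun j _ => (hrep j).step.smul (c j))
    (IsBalanced.sum Finset.univ fun j _ => (hbal j).smul (c j)) (C := ∑ j, |c j| * C)
    (fun B i => ?_) (fun B i h => Finset.sum_eq_zero fun j _ => ?_) fun p hp => ?_
  · rw [← Finset.sum_neg_distrib]
    refine Finset.sum_le_sum fun j _ => ?_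
    have h1 := (hrep j).nonneg B i
    have h2 := (hle j B i).trans (hC B i)
    have h3 : |c j * germ w (m j) B i| ≤ |c j| * C := by
      rw [abs_mul, abs_of_nonneg h1]
      exact mul_le_mul_of_nonneg_left h2 (abs_nonneg _)
    exact (abs_le.1 h3).1
  · rw [le_antisymm ((hle j B i).trans_eq h) ((hrep j).nonneg B i), mul_zero]
  · rw [← hA] at hp
    obtain ⟨i, rfl⟩ := hp
    have := congrFun hc i
    simpa only [Finset.sum_apply, Pi.zero_apply, Pi.smul_apply, smul_eq_mul, exitDensity, densityPos_eq]
      using this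

end

end HoneycombMeasure

end

theorem mainTheorem4
    (w : Fin 3 → HoneycombMeasure.Plane) (hw : HoneycombMeasure.IsUnitTriple w)
    (r : ℝ) (hr : 0 < r)
    (μ : MeasureTheory.Measure HoneycombMeasure.Plane)
    (hμ : HoneycombMeasure.IsRigid w r μ)
    (k : ℕ) (m : Fin k → MeasureTheory.Measure HoneycombMeasure.Plane)
    (hext : ∀ j, HoneycombMeasure.IsExtremal w (m j))
    (hineq : ∀ i j, i ≠ j → HoneycombMeasure.Inequivalent (m i) (m j))
    (hsum : μ = ∑ j, m j) :
    (HoneycombMeasure.attachmentPoints w r μ).Finite ∧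
    ∀ (q : ℕ) (A : Fin q → Fin 3 × HoneycombMeasure.Plane),
      Function.Injective A →
      Set.range A = HoneycombMeasure.attachmentPoints w r μ →
      LinearIndependent ℝ
        (fun (j : Fin k) (i : Fin q) => HoneycombMeasure.exitDensity w (m j) (A i)) :=
  ⟨(HoneycombMeasure.finite_exitPoints hw hr hμ.1).subset fun _ hp => hp.1,
    fun _ _ _ hA => hμ.linearIndependent hw hr hext hineq hsum hA⟩
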